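/- Define functions on the natural numbers by $\mathfrak{d}_n(b)=(2b)^{2^n}$ for $n\ge 0$; $\mathfrak{e}(n,b)=2^{(b+\mathfrak{d}_{n-1}(b))^{n-1}+1}\,b+b+\mathfrak{d}_{n-1}(b)$ for $n\ge 1$ (with $0^0=1$); $\zeta_0(n,d)=\binom{n+\mathfrak{d}_n(d)}{n}$; $\zeta_1(n,d,b)=\left(\binom{b+n}{n}+2\right)\zeta_0(n,d)$; $\zeta_2(n,d,b)=(\zeta_1(n,d,b)+1)^{2^{\zeta_1(n,d,b)}-1}$. Define $\mathfrak{p}_n(d)$ recursively by $\mathfrak{p}_1(d)=d$ (and, by convention, $\mathfrak{p}_0(d)=d$), and for $n\ge 2$ $$\mathfrak{p}_n(d)=\max\left\{2\binom{\upsilon(n,d)+n}{n}\upsilon(n,d),\ \mathfrak{e}(n-1,d)\right\},$$ where $\upsilon(n,d)=\zeta_1(n-1,\mathfrak{p}_{n-1}(d),d)\cdot\zeta_2(n-1,\mathfrak{p}_{n-1}(d),d)$. An ideal $I$ of $K[X_1,\dots,X_n]$ is called prime up to $b$ if, for all $f,g\in K[X_1,\dots,X_n]$ of total degree at most $b$ with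 $fg\in I$, we have $f\in I$ or $g\in I$. Theorem. Let $K$ be a field, let $n,d\ge 0$ be integers, and let $\Lambda\subseteq K[X_1,\dots,X_n]$ be a set of polynomials of total degree at most $d$ such that the ideal $(\Lambda)$ generated by $\Lambda$ does not contain $1$. If $(\Lambda)$ is prime up to $\mathfrak{p}_n(d)$, then $(\Lambda)$ is a prime ideal. -/

import Mathlib

namespace PrimalityBound

/-- `𝔡_n(b) = (2b)^(2^n)`. -/
def flatBound (n b : ℕ) : ℕ := (2 * b) ^ 2 ^ n

/-- `𝔢(n,b) = 2^((b + 𝔡_{n-1}(b))^(n-1) + 1) * b + b + 𝔡_{n-1}(b)`, used for `n ≥ 1` only. -/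
def extBound (n b : ℕ) : ℕ :=
  2 ^ ((b + flatBound (n - 1) b) ^ (n - 1) + 1) * b + b + flatBound (n - 1) b

/-- `ζ₀(n,d)`, the number of monomials of degree at most `𝔡_n(d)` in `n` variables. -/
def zeta0 (n d : ℕ) : ℕ := (n + flatBound n d).choose n

/-- `ζ₁(n,d,b) = (binom(b+n, n) + 2) * ζ₀(n,d)`. -/
def zeta1 (n d b : ℕ) : ℕ := ((b + n).choose n + 2) * zeta0 n d

/-- `ζ₂(n,d,b) = (ζ₁(n,d,b) + 1)^(2^ζ₁(n,d,b) - 1)`. -/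
def zeta2 (n d b : ℕ) : ℕ := (zeta1 n d b + 1) ^ (2 ^ zeta1 n d b - 1)

/-- The bound `𝔭_n(d)`: `𝔭_1(d) = d`, and for `n ≥ 2`
`𝔭_n(d) = max (2 * binom(υ+n, n) * υ) (𝔢(n-1,d))` where
`υ = ζ₁(n-1, 𝔭_{n-1}(d), d) * ζ₂(n-1, 𝔭_{n-1}(d), d)`.
The value `𝔭_0(d) = d` for polynomials in no variables is a convention. -/
def primeBound : ℕ → ℕ → ℕ
  | 0, d => d
  | 1, d => d
  | n + 2, d =>
    let υ := zeta1 (n + 1) (primeBound (n + 1) d) d * zeta2 (n + 1) (primeBound (n + 1) d) d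
    max (2 * (υ + (n + 2)).choose (n + 2) * υ) (extBound (n + 1) d)

/-- An ideal `I` of a polynomial ring is prime up to `b` if for all `f`, `g` of total degree
at most `b` with `f * g ∈ I`, one has `f ∈ I` or `g ∈ I`. -/
def IsPrimeUpTo {σ K : Type*} [Field K] (I : Ideal (MvPolynomial σ K)) (b : ℕ) : Prop :=
  ∀ f g : MvPolynomial σ K, f.totalDegree ≤ b → g.totalDegree ≤ b → f * g ∈ I → f ∈ I ∨ g ∈ I

end PrimalityBound

/-!
Let `I = (Λ)`, with generators of degree at most `d`. The idea is to show that if `I` fails to be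
prime, then this failure is already visible in degrees bounded in terms of `n` and `d`, where
primality up to `𝔭_n(d)` excludes it. With `x = (2d)^(2^(n-1))`, the degrees that occur in the
argument are at most `2^(10x^4)` (`bounds_le`), and `𝔭_n(d)` is at least `2^(2^(4x+4))`
(`two_pow_two_pow_le_primeBound`). This is for `n ≥ 2` and `d ≥ 1`; for `n ≤ 1` or `d = 0` the ideal
is principal and the claim is elementary.

Choose a maximal set `S` of variables with `I ∩ K[S] = 0`, let `A = K[S]`, let `τ` be the set of the
remaining variables and `Q = A[τ]/I`. Every element of `Q` is algebraic over `A`.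

All degree bounds come from two sources. Hermann's theorem (`exists_bounded_solution`) bounds the
degrees in `τ` of the solutions of a linear equation over `F[τ]`, for any field `F`: one picks a
maximal minor, makes it monic in one variable by a linear change of coordinates, divides by it, and
compares coefficients in order to pass to fewer variables. Cramer's rule
(`mem_span_bounded_kernel`) then bounds the degrees of the coefficients when `F` is the fraction
field of `A`, or of a quotient of `A`.

*Torsion.* `Q` is torsion-free over `A` (`mem_of_rename_mul_mem`). If `q ∈ A` is prime and
`q * h ∈ I`, reduce modulo `q`: the syzygies of the generators over the residue field of `q` are
generated by bounded ones, and a bounded syzygy modulo `q` gives a bounded product `q * t ∈ I`,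
hence `t ∈ I`. So `u * h ∈ I` for some `u ∈ A` not divisible by `q`. Eliminating a variable between `q` and
`u`, and induction on the number of variables in `S` that occur, give `h ∈ I`.

*Separable elements.* The element `∑ sᵢ yᵢ`, where the `yᵢ` are the classes in `Q` of the variables
in `τ` and the `sᵢ` are new variables, is a root of a bounded nonzero polynomial over `A[s]`
(`exists_bounded_generic`), and one of its irreducible factors `π` vanishes there
(`exists_irreducible_generic`): a product of two bounded elements of `Q[s]` is zero only if one of
them is. Everything in `A[s][∑ sᵢ yᵢ]` is then zero or regular, since it can be eliminated against
`π`. Differentiating the relation in `sᵢ` shows that `∂π/∂T` times `yᵢ` lies in this ring. So if the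
derivative does not vanish, then every element of `A[y]` is zero or regular. If it does vanish, all
partial derivatives of `π` do, `π` is a polynomial in `p`-th powers, and one passes from the `yᵢ` to
`yᵢ^p`. After `e` steps, with `p^e` at most the degree of `π`, every element of `A[y^(p^e)]` is zero
or regular (`exists_separable_generic`, `eq_zero_or_regular_of_separable`).

*Nilpotents.* If `a ≠ 0` in `Q`, then `a^(p^e) ≠ 0` (`mem_of_pow_mem`). Clearing denominators, `a`
has bounded degree in `τ`. Membership of `a^(p^e)` in `I` is tested by linear functionals with
bounded coefficients, and the Cartier operators turn the resulting equations, which are linear in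
the `p^e`-th powers of the coefficients of `a`, into equations linear in the coefficients of `a`
itself. So `a` is a combination of bounded elements whose `p^e`-th powers are in `I`, and these
bounded elements are in `I` since `I` is prime up to a sufficiently large degree.

Finally let `a * b = 0` and `a ≠ 0` in `Q`. Then `a^(p^e)` is a nonzero element of `A[y^(p^e)]`, so
it is regular, and `b = 0`.
-/

namespace PrimalityBound

open MvPolynomial

universe u


/-! ### Kernels of matrices with entries of bounded degree -/

/-- A filtration of a commutative ring by additive subgroups that is compatible with the product, as
the one of a polynomial ring by degree. It need not be exhaustive. -/
structure DegreeFiltration (A : Type*) [CommRing A] where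
  piece : ℕ → AddSubgroup A
  mono : Monotone piece
  one_mem : 1 ∈ piece 0
  mul_mem : ∀ {i j : ℕ} {a b : A}, a ∈ piece i → b ∈ piece j → a * b ∈ piece (i + j)

namespace DegreeFiltration

variable {A : Type*} [CommRing A] (G : DegreeFiltration A)

theorem mem_of_le {i j : ℕ} (h : i ≤ j) {a : A} (ha : a ∈ G.piece i) : a ∈ G.piece j :=
  G.mono h ha

theorem prod_mem {ι : Type*} (s : Finset ι) (f : ι → A) (e : ι → ℕ)
    (h : ∀ i ∈ s, f i ∈ G.piece (e i)) : ∏ i ∈ s, f i ∈ G.piece (∑ i ∈ s, e i) := by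
  classical
  induction s using Finset.induction_on with
  | empty => simpa using G.one_mem
  | insert a s ha ih =>
    rw [Finset.prod_insert ha, Finset.sum_insert ha]
    exact G.mul_mem (h _ (Finset.mem_insert_self _ _))
      (ih fun i hi => h i (Finset.mem_insert_of_mem hi))

theorem pow_mem {a : A} {i : ℕ} (h : a ∈ G.piece i) (k : ℕ) : a ^ k ∈ G.piece (k * i) := by
  simpa using G.prod_mem (Finset.range k) (fun _ => a) (fun _ => i) (fun _ _ => h)

theorem det_mem {ι : Type*} [Fintype ι] [DecidableEq ι] (M : Matrix ι ι A) (e : ι → ℕ)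
    (h : ∀ i j, M i j ∈ G.piece (e j)) : M.det ∈ G.piece (∑ j, e j) := by
  rw [Matrix.det_apply]
  refine sum_mem fun σ _ => ?_
  have := G.prod_mem Finset.univ (fun i => M (σ i) i) e fun i _ => h _ _
  rcases Int.units_eq_one_or (Equiv.Perm.sign σ) with hs | hs <;> rw [hs]
  · simpa using this
  · simpa using this

theorem cramer_mem {ι : Type*} [Fintype ι] [DecidableEq ι] (M : Matrix ι ι A) (b : ι → A)
    (e d : ℕ) (hM : ∀ i j, M i j ∈ G.piece d) (hb : ∀ i, b i ∈ G.piece e) (i : ι) :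
    M.cramer b i ∈ G.piece ((Fintype.card ι - 1) * d + e) := by
  rw [Matrix.cramer_apply]
  have := G.det_mem (M.updateCol i b) (fun j => if j = i then e else d) (by
    intro a j
    by_cases hj : j = i
    · subst hj; simpa using hb a
    · simpa [hj] using hM a j)
  refine G.mem_of_le (le_of_eq ?_) this
  rw [Finset.sum_ite, Finset.filter_eq' , if_pos (Finset.mem_univ _), Finset.filter_ne',
    Finset.sum_const, Finset.sum_const, Finset.card_erase_of_mem (Finset.mem_univ _),
    Finset.card_univ]
  simp [add_comm]

end DegreeFiltration

/-- The rows of a matrix over a field are spanned by the rows of a maximal nonvanishing minor. The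
field is the target of `φ`, while the minor is taken over the source. -/
theorem exists_maximal_minor {A F ι κ : Type*} [CommRing A] [Field F] [Fintype κ]
    (φ : A →+* F) (M : Matrix ι κ A) :
    ∃ (r : ℕ) (e : Fin r → ι) (c : Fin r → κ), Function.Injective e ∧ Function.Injective c ∧
      φ (M.submatrix e c).det ≠ 0 ∧
      ∀ i, (fun j => φ (M i j)) ∈
        Submodule.span F (Set.range fun k : Fin r => fun j => φ (M (e k) j)) := by
  classical
  obtain ⟨ι', a, ha, hspan, hli⟩ := exists_linearIndependent' F (fun i => fun j => φ (M i j))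
  have : Finite ι' := hli.finite
  obtain ⟨r, ⟨f⟩⟩ := Finite.exists_equiv_fin ι'
  let e : Fin r → ι := a ∘ f.symm
  have hli' : LinearIndependent F (fun k : Fin r => fun j => φ (M (e k) j)) :=
    hli.comp f.symm f.symm.injective
  have hspan' : Submodule.span F (Set.range fun k : Fin r => fun j => φ (M (e k) j)) =
      Submodule.span F (Set.range fun i => fun j => φ (M i j)) := by
    rw [← hspan]
    congr 1
    exact (f.symm.surjective.range_comp ((fun i => fun j => φ (M i j)) ∘ a))
  let N : Matrix (Fin r) κ F := Matrix.of fun k j => φ (M (e k) j)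
  have hrank : N.rank = r := by
    have := LinearIndependent.rank_matrix (M := N) hli'
    simpa using this
  obtain ⟨κ', c, hc, hcspan, hcli⟩ := exists_linearIndependent' F N.col
  have : Finite κ' := hcli.finite
  have : Fintype κ' := Fintype.ofFinite κ'
  have hcard : Fintype.card κ' = r := by
    rw [← finrank_span_eq_card hcli, hcspan, ← Matrix.rank_eq_finrank_span_cols, hrank]
  let g : Fin r ≃ κ' := (Fintype.equivFinOfCardEq hcard).symm
  refine ⟨r, e, c ∘ g, ha.comp f.symm.injective, hc.comp g.injective, ?_, fun i => ?_⟩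
  · have h1 : LinearIndependent F (N.submatrix id (c ∘ g)).col :=
      hcli.comp g g.injective
    have h2 := (Matrix.isUnit_iff_isUnit_det _).1 (Matrix.linearIndependent_cols_iff_isUnit.1 h1)
    have h3 : N.submatrix id (c ∘ g) = (M.submatrix e (c ∘ g)).map φ := by
      ext; simp [N]
    rw [h3] at h2
    rw [RingHom.map_det]
    exact h2.ne_zero
  · rw [hspan']
    exact Submodule.subset_span ⟨i, rfl⟩

/-- The vector that Cramer's rule associates with a square submatrix of `M` and a column index `j`:
its entry at `j` is the minor, and its entries at the columns of the submatrix are chosen so that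
the rows of the submatrix annihilate it. -/
noncomputable def cramerKernel {A κ : Type*} [CommRing A] [DecidableEq κ] {r : ℕ} {ι : Type*}
    (M : Matrix ι κ A) (e : Fin r → ι) (c : Fin r → κ) (j : κ) : κ → A :=
  Pi.single j (M.submatrix e c).det -
    ∑ k, Pi.single (c k) ((M.submatrix e c).cramer (fun i => M (e i) j) k)

section cramerKernel
variable {A κ : Type*} [CommRing A] [DecidableEq κ] {r : ℕ} {ι : Type*}
    (M : Matrix ι κ A) (e : Fin r → ι) (c : Fin r → κ)

theorem cramerKernel_apply_of_notMem (j i : κ) (hi : i ∉ Set.range c) :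
    cramerKernel M e c j i = if i = j then (M.submatrix e c).det else 0 := by
  simp only [cramerKernel, Pi.sub_apply, Finset.sum_apply]
  rw [Finset.sum_eq_zero, sub_zero, Pi.single_apply]
  intro k _
  rw [Pi.single_apply, if_neg]
  rintro rfl
  exact hi ⟨k, rfl⟩

theorem cramerKernel_mem (G : DegreeFiltration A) {d : ℕ} (hM : ∀ i j, M i j ∈ G.piece d)
    (j i : κ) : cramerKernel M e c j i ∈ G.piece (r * d) := by
  have key : ∀ k, (M.submatrix e c).cramer (fun i => M (e i) j) k ∈ G.piece (r * d) := by
    intro k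
    refine G.mem_of_le ?_ (G.cramer_mem _ _ d d (fun _ _ => hM _ _) (fun _ => hM _ _) k)
    rw [Fintype.card_fin]
    obtain ⟨m, rfl⟩ : ∃ m, r = m + 1 := ⟨r - 1, by have := k.pos; omega⟩
    simp [add_mul]
  have hdet : (M.submatrix e c).det ∈ G.piece (r * d) := by
    simpa using G.det_mem (M.submatrix e c) (fun _ => d) (fun _ _ => hM _ _)
  simp only [cramerKernel, Pi.sub_apply, Finset.sum_apply]
  refine sub_mem ?_ (sum_mem fun k _ => ?_)
  · rw [Pi.single_apply]; split_ifs; exacts [hdet, zero_mem _]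
  · rw [Pi.single_apply]; split_ifs; exacts [key k, zero_mem _]

theorem cramerKernel_row [Fintype κ] (j : κ) (k : Fin r) :
    ∑ i, M (e k) i * cramerKernel M e c j i = 0 := by
  have h := congrFun (Matrix.mulVec_cramer (M.submatrix e c) (fun i => M (e i) j)) k
  simp only [Matrix.mulVec, dotProduct, Matrix.submatrix_apply, Pi.smul_apply, smul_eq_mul] at h
  simp only [cramerKernel, Pi.sub_apply, Finset.sum_apply, mul_sub, Finset.sum_sub_distrib,
    Finset.mul_sum]
  rw [Finset.sum_comm]
  simp only [Pi.single_apply, mul_ite, mul_zero, Finset.sum_ite_eq',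
    Finset.mem_univ, if_true]
  rw [h]; ring

end cramerKernel

/-- The kernel of a matrix over a field `F` that is the image of a matrix over `A` with entries of
degree at most `d` is spanned by images of vectors of degree at most `n * d`, where `n` bounds the
number of columns or the number of rows. The vectors are those of `cramerKernel` for a maximal
minor. -/
theorem mem_span_bounded_kernel {A F ι κ : Type*} [CommRing A] [Field F] [Fintype κ]
    (G : DegreeFiltration A) (φ : A →+* F) (M : Matrix ι κ A) {d n : ℕ}
    (hM : ∀ i j, M i j ∈ G.piece d) (hn : Fintype.card κ ≤ n ∨ (Finite ι ∧ Nat.card ι ≤ n))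
    (x : κ → F) (hx : ∀ i, ∑ j, φ (M i j) * x j = 0) :
    x ∈ Submodule.span F ((fun w : κ → A => fun j => φ (w j)) ''
      {w | (∀ j, w j ∈ G.piece (n * d)) ∧ ∀ i, φ (∑ j, M i j * w j) = 0}) := by
  classical
  obtain ⟨r, e, c, he, hc, hdet, hrow⟩ := exists_maximal_minor φ M
  have hr : r ≤ n := by
    rcases hn with h | ⟨_, h⟩
    · have := Fintype.card_le_of_injective c hc
      simp at this; omega
    · have := Nat.card_le_card_of_injective e he
      simp at this; omega
  set Δ := (M.submatrix e c).det with hΔ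
  have hker : ∀ (y : κ → F), (∀ k, ∑ j, φ (M (e k) j) * y j = 0) →
      ∀ i, ∑ j, φ (M i j) * y j = 0 := by
    intro y hy i
    refine Submodule.span_induction (p := fun (z : κ → F) _ => ∑ j, z j * y j = 0)
      ?_ ?_ ?_ ?_ (hrow i)
    · rintro _ ⟨k, rfl⟩; exact hy k
    · simp
    · intro a b _ _ ha hb; simp [add_mul, Finset.sum_add_distrib, ha, hb]
    · intro t a _ ha
      simp only [Pi.smul_apply, smul_eq_mul, mul_assoc, ← Finset.mul_sum, ha, mul_zero]
  have hmem : ∀ j, (fun i => φ (cramerKernel M e c j i)) ∈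
      Submodule.span F ((fun w : κ → A => fun j => φ (w j)) ''
      {w | (∀ j, w j ∈ G.piece (n * d)) ∧ ∀ i, φ (∑ j, M i j * w j) = 0}) := by
    intro j
    refine Submodule.subset_span ⟨_, ⟨fun i => ?_, fun i => ?_⟩, rfl⟩
    · exact G.mem_of_le (Nat.mul_le_mul_right d hr) (cramerKernel_mem M e c G hM j i)
    · have := hker (fun i => φ (cramerKernel M e c j i)) (fun k => by
        rw [← map_zero φ, ← cramerKernel_row M e c j k]; simp) i
      simpa using this
  -- subtracting the Cramer vectors kills all entries outside the chosen columns
  set y : κ → F := x - ∑ j ∈ Finset.univ.filter (fun j => j ∉ Set.range c),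
    (x j / φ Δ) • (fun i => φ (cramerKernel M e c j i)) with hy
  have hy0 : y = 0 := by
    have hfree : ∀ i, i ∉ Set.range c → y i = 0 := by
      intro i hi
      simp only [hy, Pi.sub_apply, Finset.sum_apply, Pi.smul_apply, smul_eq_mul,
        cramerKernel_apply_of_notMem M e c _ i hi]
      rw [Finset.sum_eq_single i]
      · simp [← hΔ, div_mul_cancel₀ _ hdet]
      · intro j _ hj; simp [Ne.symm hj]
      · intro h; exact (h (by simpa using hi)).elim
    have hyk : ∀ k, ∑ j, φ (M (e k) j) * y j = 0 := by
      intro k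
      have h2 : ∀ j, ∑ i, φ (M (e k) i) * φ (cramerKernel M e c j i) = 0 := by
        intro j
        rw [← map_zero φ, ← cramerKernel_row M e c j k]; simp
      simp only [hy, Pi.sub_apply, Finset.sum_apply, Pi.smul_apply, smul_eq_mul, mul_sub,
        Finset.sum_sub_distrib, Finset.mul_sum]
      rw [hx, zero_sub, neg_eq_zero, Finset.sum_comm]
      refine Finset.sum_eq_zero fun j _ => ?_
      rw [← mul_zero (x j / φ Δ), ← h2 j, Finset.mul_sum]
      exact Finset.sum_congr rfl fun _ _ => by ring
    have hsub : ∀ k, ∑ l, φ (M (e k) (c l)) * y (c l) = 0 := by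
      intro k
      rw [← hyk k, ← Finset.sum_image (f := fun j => φ (M (e k) j) * y j) (fun a _ b _ h => hc h)]
      refine Finset.sum_subset (Finset.subset_univ _) fun j _ hj => ?_
      rw [hfree j (by simpa using hj), mul_zero]
    have h3 : ((M.submatrix e c).map φ).mulVec (fun l => y (c l)) = 0 := by
      ext k; simpa [Matrix.mulVec, dotProduct] using hsub k
    have h4 := Matrix.eq_zero_of_mulVec_eq_zero (by
      rw [← RingHom.mapMatrix_apply, ← RingHom.map_det]; exact hdet) h3
    ext i
    by_cases hi : i ∈ Set.range c
    · obtain ⟨l, rfl⟩ := hi; exact congrFun h4 l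
    · exact hfree i hi
  have hxe : x = ∑ j ∈ Finset.univ.filter (fun j => j ∉ Set.range c),
    (x j / φ Δ) • (fun i => φ (cramerKernel M e c j i)) := by
    rw [← sub_eq_zero]; exact hy0
  rw [hxe]
  exact Submodule.sum_mem _ fun j _ => Submodule.smul_mem _ _ (hmem j)


/-! ### Hermann's degree bound for linear equations -/

/-- The filtration of a univariate polynomial ring by `natDegree`. -/
def natDegreeFiltration (B : Type*) [CommRing B] : DegreeFiltration (Polynomial B) where
  piece n :=
    { carrier := {p | p.natDegree ≤ n}
      zero_mem' := by simp
      add_mem' := fun ha hb => (Polynomial.natDegree_add_le _ _).trans (max_le ha hb)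
      neg_mem' := fun ha => by simpa using ha }
  mono := fun _ _ h _ hp => le_trans hp h
  one_mem := by
    change (1 : Polynomial B).natDegree ≤ 0
    simp
  mul_mem := fun ha hb => Polynomial.natDegree_mul_le.trans (add_le_add ha hb)

theorem mem_natDegreeFiltration {B : Type*} [CommRing B] {p : Polynomial B} {n : ℕ} :
    p ∈ (natDegreeFiltration B).piece n ↔ p.natDegree ≤ n := Iff.rfl

/-- The filtration of a multivariate polynomial ring by total degree. -/
def totalDegreeFiltration (σ B : Type*) [CommRing B] : DegreeFiltration (MvPolynomial σ B) where
  piece n :=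
    { carrier := {p | p.totalDegree ≤ n}
      zero_mem' := by simp
      add_mem' := fun ha hb => (totalDegree_add _ _).trans (max_le ha hb)
      neg_mem' := fun ha => by simpa using ha }
  mono := fun _ _ h _ hp => le_trans hp h
  one_mem := by
    change (1 : MvPolynomial σ B).totalDegree ≤ 0
    simp
  mul_mem := fun ha hb => (totalDegree_mul _ _).trans (add_le_add ha hb)

theorem mem_totalDegreeFiltration {σ B : Type*} [CommRing B] {p : MvPolynomial σ B} {n : ℕ} :
    p ∈ (totalDegreeFiltration σ B).piece n ↔ p.totalDegree ≤ n := Iff.rfl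

/-- Some solution of `M *ᵥ v = b` has entries in `bd`, and the given solution `v` differs from it by
a combination of solutions with entries in `bd` of the homogeneous system. -/
def HasBoundedSolution {R ι κ : Type*} [CommRing R] [Fintype κ] (bd : R → Prop)
    (M : Matrix ι κ R) (b : ι → R) (v : κ → R) : Prop :=
  ∃ v', M.mulVec v' = b ∧ (∀ j, bd (v' j)) ∧
    v - v' ∈ Submodule.span R {w | M.mulVec w = 0 ∧ ∀ j, bd (w j)}

theorem HasBoundedSolution.of_ringEquiv {R R' ι κ : Type*} [CommRing R] [CommRing R'] [Fintype κ]
    {bd : R → Prop} {bd' : R' → Prop} (Θ : R ≃+* R') (hbd : ∀ x, bd' x → bd (Θ.symm x))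
    {M : Matrix ι κ R} {b : ι → R} {v : κ → R}
    (h : HasBoundedSolution bd' (M.map Θ) (Θ ∘ b) (Θ ∘ v)) : HasBoundedSolution bd M b v := by
  obtain ⟨v', hv', hb, hs⟩ := h
  have key : ∀ (w : κ → R'), M.mulVec (Θ.symm ∘ w) = Θ.symm ∘ ((M.map Θ).mulVec w) := by
    intro w; ext i
    simp [Matrix.mulVec, dotProduct, map_sum]
  refine ⟨Θ.symm ∘ v', ?_, fun j => hbd _ (hb j), ?_⟩
  · rw [key, hv']; ext i; simp
  · have : v - Θ.symm ∘ v' = Θ.symm ∘ (Θ ∘ v - v') := by ext i; simp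
    rw [this]
    refine Submodule.span_induction
      (p := fun (z : κ → R') _ =>
        Θ.symm ∘ z ∈ Submodule.span R {w | M.mulVec w = 0 ∧ ∀ j, bd (w j)})
      ?_ ?_ ?_ ?_ hs
    · rintro w ⟨hw, hw'⟩
      refine Submodule.subset_span ⟨?_, fun j => hbd _ (hw' j)⟩
      rw [key, hw]; ext i; simp
    · convert Submodule.zero_mem _; ext i; simp
    · intro x y _ _ hx hy
      convert Submodule.add_mem _ hx hy using 1; ext i; simp
    · intro a x _ hx
      convert Submodule.smul_mem _ (Θ.symm a) hx using 1; ext i; simp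

theorem HasBoundedSolution.of_kernel {R ι κ : Type*} [CommRing R] [Fintype κ] {bd : R → Prop}
    {M : Matrix ι κ R} {b : ι → R} {v v₁ : κ → R}
    (h : v - v₁ ∈ Submodule.span R {w | M.mulVec w = 0 ∧ ∀ j, bd (w j)})
    (h₁ : HasBoundedSolution bd M b v₁) : HasBoundedSolution bd M b v := by
  obtain ⟨v', hv', hb, hs⟩ := h₁
  refine ⟨v', hv', hb, ?_⟩
  have := Submodule.add_mem _ h hs
  simpa using this

section pack
variable {B κ : Type*} [CommRing B]

/-- The vector of univariate polynomials of degree at most `m` with given coefficients. -/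
noncomputable def pack (m : ℕ) : (κ × Fin (m + 1) → B) →ₗ[B] (κ → Polynomial B) where
  toFun u j := ∑ e : Fin (m + 1), Polynomial.C (u (j, e)) * Polynomial.X ^ (e : ℕ)
  map_add' u v := by ext1 j; simp [add_mul, Finset.sum_add_distrib]
  map_smul' a u := by ext1 j; simp [Finset.smul_sum, Polynomial.smul_eq_C_mul, mul_assoc]

theorem pack_apply (m : ℕ) (u : κ × Fin (m + 1) → B) (j : κ) :
    pack m u j = ∑ e : Fin (m + 1), Polynomial.C (u (j, e)) * Polynomial.X ^ (e : ℕ) := rfl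

theorem pack_coeff (m : ℕ) (v : κ → Polynomial B) (hv : ∀ j, (v j).natDegree ≤ m) :
    pack m (fun p => (v p.1).coeff p.2) = v := by
  ext1 j
  rw [pack_apply,
    ← Finset.sum_range (fun e => Polynomial.C ((v j).coeff e) * Polynomial.X ^ e)]
  exact (Polynomial.as_sum_range_C_mul_X_pow' _ (Nat.lt_succ_of_le (hv j))).symm

theorem natDegree_pack_le (m : ℕ) (u : κ × Fin (m + 1) → B) (j : κ) :
    (pack m u j).natDegree ≤ m := by
  rw [pack_apply]
  refine Polynomial.natDegree_sum_le_of_forall_le _ _ fun e _ => ?_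
  exact (Polynomial.natDegree_C_mul_X_pow_le _ _).trans (Nat.le_of_lt_succ e.2)

/-- The matrix that computes the coefficients of `M *ᵥ pack m u` in degrees below `t` from `u`. -/
def unpackMatrix {ι : Type*} (m t : ℕ) (M : Matrix ι κ (Polynomial B)) :
    Matrix (ι × Fin t) (κ × Fin (m + 1)) B :=
  fun p q => if (q.2 : ℕ) ≤ p.2 then (M p.1 q.1).coeff (p.2 - q.2) else 0

theorem unpackMatrix_mulVec [Fintype κ] {ι : Type*} (m t : ℕ) (M : Matrix ι κ (Polynomial B))
    (u : κ × Fin (m + 1) → B) (p : ι × Fin t) :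
    (unpackMatrix m t M).mulVec u p = (M.mulVec (pack m u) p.1).coeff p.2 := by
  simp only [Matrix.mulVec, dotProduct, pack_apply, unpackMatrix, Polynomial.finsetSum_coeff,
    Finset.mul_sum, Fintype.sum_prod_type]
  refine Finset.sum_congr rfl fun j _ => Finset.sum_congr rfl fun e _ => ?_
  rw [← mul_assoc, Polynomial.coeff_mul_X_pow']
  split_ifs
  · rw [Polynomial.coeff_mul_C]
  · simp

/-- A linear system over `B[X]`, for unknowns of degree at most `m`, follows from the linear system
over `B` obtained by comparing coefficients. -/
theorem mulVec_pack_eq [Fintype κ] {ι : Type*} (m d : ℕ) (M : Matrix ι κ (Polynomial B))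
    (hM : ∀ i j, (M i j).natDegree ≤ d) (b : ι → Polynomial B) (hb : ∀ i, (b i).natDegree ≤ d)
    (u : κ × Fin (m + 1) → B)
    (h : (unpackMatrix m (m + d + 1) M).mulVec u = fun p => (b p.1).coeff p.2) :
    M.mulVec (pack m u) = b := by
  ext i n
  by_cases hn : n < m + d + 1
  · have := congrFun h (i, ⟨n, hn⟩)
    rwa [unpackMatrix_mulVec] at this
  · rw [Polynomial.coeff_eq_zero_of_natDegree_lt, Polynomial.coeff_eq_zero_of_natDegree_lt]
    · have := hb i; omega
    · refine lt_of_le_of_lt (b := m + d) ?_ (by omega)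
      refine Polynomial.natDegree_sum_le_of_forall_le _ _ fun j _ => ?_
      refine Polynomial.natDegree_mul_le.trans ?_
      have h1 := hM i j
      have h2 := natDegree_pack_le m u j
      exact (add_le_add h1 h2).trans (by omega)

end pack

theorem exists_eq_mul_add_of_isUnit_leadingCoeff {B : Type*} [CommRing B] [IsDomain B]
    (Δ p : Polynomial B) (h : IsUnit Δ.leadingCoeff) :
    ∃ Q ρ : Polynomial B, p = Δ * Q + ρ ∧ ρ.natDegree ≤ Δ.natDegree := by
  obtain ⟨a, ha⟩ := h
  have hm : (Polynomial.C (↑a⁻¹ : B) * Δ).Monic := by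
    rw [Polynomial.Monic, Polynomial.leadingCoeff_mul, ← ha]; simp
  refine ⟨Polynomial.C (↑a⁻¹ : B) * (p /ₘ (Polynomial.C (↑a⁻¹ : B) * Δ)),
    p %ₘ (Polynomial.C (↑a⁻¹ : B) * Δ), ?_, ?_⟩
  · conv_lhs => rw [← Polynomial.modByMonic_add_div p (Polynomial.C (↑a⁻¹ : B) * Δ)]
    ring
  · refine (Polynomial.natDegree_modByMonic_le _ hm).trans ?_
    exact Polynomial.natDegree_C_mul_le _ _

/-- A vector annihilated by rows that span the row space is annihilated by all rows. -/
theorem mulVec_eq_of_maximal_minor {A ι κ : Type*} [CommRing A] [IsDomain A] [Fintype κ]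
    (M : Matrix ι κ A) {r : ℕ} (e : Fin r → ι)
    (hrow : ∀ i, (fun j => algebraMap A (FractionRing A) (M i j)) ∈
        Submodule.span (FractionRing A)
          (Set.range fun k : Fin r => fun j => algebraMap A (FractionRing A) (M (e k) j)))
    (y : κ → A) (hy : ∀ k, M.mulVec y (e k) = 0) : M.mulVec y = 0 := by
  ext i
  apply IsFractionRing.injective A (FractionRing A)
  have := Submodule.span_induction (p := fun (z : κ → FractionRing A) _ =>
    ∑ j, z j * algebraMap A (FractionRing A) (y j) = 0) ?_ ?_ ?_ ?_ (hrow i)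
  · simpa [Matrix.mulVec, dotProduct] using this
  · rintro _ ⟨k, rfl⟩
    have := congrArg (algebraMap A (FractionRing A)) (hy k)
    simpa [Matrix.mulVec, dotProduct] using this
  · simp
  · intro a b _ _ ha hb; simp [add_mul, Finset.sum_add_distrib, ha, hb]
  · intro t a _ ha
    simp only [Pi.smul_apply, smul_eq_mul, mul_assoc, ← Finset.mul_sum, ha, mul_zero]

/-- Division by a minor with invertible leading coefficient: modulo the vectors `cramerKernel`, the
entries of `v` outside the columns of the minor can be reduced modulo the minor. The equations then
bound the degrees of the remaining entries, by Cramer's rule. -/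
theorem exists_natDegree_le_of_minor {B ι κ : Type*} [CommRing B] [IsDomain B] [Fintype κ]
    [DecidableEq κ]
    (M : Matrix ι κ (Polynomial B)) {r d : ℕ} (e : Fin r → ι) (c : Fin r → κ)
    (hc : Function.Injective c)
    (hM : ∀ i j, (M i j).natDegree ≤ d)
    (hΔ : IsUnit (M.submatrix e c).det.leadingCoeff)
    (b : ι → Polynomial B) (hb : ∀ i, (b i).natDegree ≤ d) (v : κ → Polynomial B)
    (hv : ∀ k, M.mulVec v (e k) = b (e k)) :
    ∃ v₁ : κ → Polynomial B, (∀ j, (v₁ j).natDegree ≤ r * d) ∧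
      v - v₁ ∈ Submodule.span (Polynomial B) (Set.range (cramerKernel M e c)) := by
  set Δ := (M.submatrix e c).det with hΔdef
  have hΔ0 : Δ ≠ 0 := by
    intro h; rw [h] at hΔ; simp at hΔ
  have hΔdeg : Δ.natDegree ≤ r * d := by
    have := (natDegreeFiltration B).det_mem (M.submatrix e c) (fun _ => d) (fun _ _ => hM _ _)
    rw [mem_natDegreeFiltration] at this
    simpa using this
  choose Q ρ hQ hρ using fun j => exists_eq_mul_add_of_isUnit_leadingCoeff Δ (v j) hΔ
  set S := Finset.univ.filter (fun j : κ => j ∉ Set.range c) with hS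
  set v₁ : κ → Polynomial B := v - ∑ j ∈ S, Q j • cramerKernel M e c j with hv₁
  have hfree : ∀ i, i ∉ Set.range c → v₁ i = ρ i := by
    intro i hi
    simp only [hv₁, Pi.sub_apply, Finset.sum_apply, Pi.smul_apply, smul_eq_mul,
        cramerKernel_apply_of_notMem M e c _ i hi]
    rw [Finset.sum_eq_single i]
    · rw [if_pos rfl]; conv_lhs => rw [hQ i]
      ring
    · intro j _ hj; simp [Ne.symm hj]
    · intro h; exact (h (by simpa [hS] using hi)).elim
  have hrow : ∀ k, M.mulVec v₁ (e k) = b (e k) := by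
    intro k
    rw [hv₁, Matrix.mulVec_sub, Pi.sub_apply, hv k, sub_eq_self, Matrix.mulVec_sum,
      Finset.sum_apply]
    refine Finset.sum_eq_zero fun j _ => ?_
    rw [Matrix.mulVec_smul, Pi.smul_apply]
    have := cramerKernel_row M e c j k
    rw [Matrix.mulVec, dotProduct, this, smul_zero]
  refine ⟨v₁, fun i => ?_, ?_⟩
  · by_cases hi : i ∈ Set.range c
    · obtain ⟨l, rfl⟩ := hi
      set b' : Fin r → Polynomial B := fun k => b (e k) - ∑ j ∈ S, M (e k) j * ρ j with hb'
      have h3 : (M.submatrix e c).mulVec (fun l => v₁ (c l)) = b' := by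
        ext1 k
        rw [hb', eq_sub_iff_add_eq, ← hrow k]
        simp only [Matrix.mulVec, dotProduct, Matrix.submatrix_apply]
        rw [← Finset.sum_filter_add_sum_filter_not Finset.univ (fun j : κ => j ∉ Set.range c)
          (fun j => M (e k) j * v₁ j), add_comm]
        congr 1
        · refine Finset.sum_congr rfl fun j hj => ?_
          rw [hfree j (by simpa [hS] using hj)]
        · rw [← Finset.sum_image (f := fun j => M (e k) j * v₁ j) (fun a _ b _ h => hc h)]
          refine Finset.sum_congr ?_ fun _ _ => rfl
          ext j; simp
      have h4 : Δ * v₁ (c l) = (M.submatrix e c).cramer b' l := by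
        rw [← h3, Matrix.cramer_eq_adjugate_mulVec, Matrix.mulVec_mulVec, Matrix.adjugate_mul]
        simp [Matrix.smul_mulVec, hΔdef]
      have h5 : ∀ k, (b' k).natDegree ≤ d + Δ.natDegree := by
        intro k
        rw [← mem_natDegreeFiltration]
        refine AddSubgroup.sub_mem _ ?_ (sum_mem fun j _ => ?_)
        · exact mem_natDegreeFiltration.2 ((hb _).trans (by omega))
        · exact (natDegreeFiltration B).mul_mem (hM _ _) (hρ j)
      have h6 := (natDegreeFiltration B).cramer_mem (M.submatrix e c) b' _ d
        (fun _ _ => hM _ _) h5 l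
      rw [mem_natDegreeFiltration, ← h4] at h6
      by_cases h0 : v₁ (c l) = 0
      · simp [h0]
      · rw [Polynomial.natDegree_mul hΔ0 h0, Fintype.card_fin] at h6
        obtain ⟨m, rfl⟩ : ∃ m, r = m + 1 := ⟨r - 1, by have := l.pos; omega⟩
        simp only [Nat.add_sub_cancel] at h6
        rw [add_mul]; omega
    · rw [hfree i hi]; exact (hρ i).trans hΔdeg
  · rw [hv₁, sub_sub_cancel]
    exact Submodule.sum_mem _ fun j _ => Submodule.smul_mem _ _ (Submodule.subset_span ⟨j, rfl⟩)


/-- The degree bound for `r` equations of degree at most `d` in `k` variables: removing a variable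
replaces each of the `r` equations by one for each of its `r * d + d + 1` coefficients, where
`r * d` bounds the degree of the unknowns in this variable. -/
def hermannBound : ℕ → ℕ → ℕ → ℕ
  | 0, _, _ => 0
  | k + 1, r, d => hermannBound k (r * (r * d + d + 1)) d + r * d

theorem hermannBound_le (k : ℕ) : ∀ {r d : ℕ}, 0 < r → 0 < d →
    hermannBound k r d + r * d ≤ (3 * r * d) ^ 2 ^ k := by
  induction k with
  | zero => intro r d hr hd; simp [hermannBound]; nlinarith
  | succ k ih =>
    intro r d hr hd
    rw [hermannBound]
    have h1 : 0 < r * (r * d + d + 1) := by positivity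
    have h2 := ih h1 hd
    have hrd : 0 < r * d := by positivity
    have h3 : 2 * r ≤ r * (r * d + d + 1) := by nlinarith
    have h4 : 3 * (r * (r * d + d + 1)) * d ≤ (3 * r * d) ^ 2 := by
      have : r * d + d + 1 ≤ 3 * (r * d) := by nlinarith
      calc 3 * (r * (r * d + d + 1)) * d = 3 * (r * d) * (r * d + d + 1) := by ring
        _ ≤ 3 * (r * d) * (3 * (r * d)) := by gcongr
        _ = _ := by ring
    calc _ = hermannBound k (r * (r * d + d + 1)) d + 2 * r * d := by ring
      _ ≤ hermannBound k (r * (r * d + d + 1)) d + r * (r * d + d + 1) * d := by gcongr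
      _ ≤ _ := h2
      _ ≤ ((3 * r * d) ^ 2) ^ 2 ^ k := by gcongr
      _ = _ := by rw [← pow_mul, pow_succ, mul_comm 2]

/-- The linear change of variables `Xᵢ ↦ Xᵢ + cᵢ X₀` for `i ≠ 0`. -/
noncomputable def shear {F : Type*} [Field F] {k : ℕ} (c : Fin k → F) :
    MvPolynomial (Fin (k + 1)) F →ₐ[F] MvPolynomial (Fin (k + 1)) F :=
  aeval (Fin.cons (X 0) fun i => X i.succ + C (c i) * X 0)

theorem shear_comp_shear_neg {F : Type*} [Field F] {k : ℕ} (c : Fin k → F) :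
    (shear c).comp (shear (-c)) = AlgHom.id F _ := by
  ext1 i
  refine Fin.cases ?_ (fun i => ?_) i
  · simp [shear]
  · simp [shear]

/-- The linear change of variables `shear c` as an automorphism. -/
noncomputable def shearEquiv {F : Type*} [Field F] {k : ℕ} (c : Fin k → F) :
    MvPolynomial (Fin (k + 1)) F ≃ₐ[F] MvPolynomial (Fin (k + 1)) F :=
  AlgEquiv.ofAlgHom (shear c) (shear (-c)) (shear_comp_shear_neg c)
    (by simpa using shear_comp_shear_neg (-c))

theorem totalDegree_aeval_le {σ τ F : Type*} [Field F] (g : σ → MvPolynomial τ F)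
    (hg : ∀ i, (g i).totalDegree ≤ 1) (p : MvPolynomial σ F) :
    (aeval g p).totalDegree ≤ p.totalDegree := by
  rw [aeval_def, eval₂_eq]
  refine totalDegree_finsetSum_le fun m hm => ?_
  have h1 : (∏ i ∈ m.support, g i ^ m i).totalDegree ≤ m.sum fun _ e => e := by
    refine (totalDegree_finsetProd _ _).trans (Finset.sum_le_sum fun i _ => ?_)
    refine (totalDegree_pow _ _).trans ?_
    simpa using Nat.mul_le_mul_left (m i) (hg i)
  refine (totalDegree_mul _ _).trans ?_
  rw [algebraMap_eq, totalDegree_C, zero_add]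
  exact h1.trans (le_totalDegree hm)

theorem totalDegree_shear_le {F : Type*} [Field F] {k : ℕ} (c : Fin k → F)
    (p : MvPolynomial (Fin (k + 1)) F) : (shear c p).totalDegree ≤ p.totalDegree := by
  refine totalDegree_aeval_le _ (fun i => ?_) p
  refine Fin.cases ?_ (fun i => ?_) i
  · simp
  · rw [Fin.cons_succ]
    refine (totalDegree_add _ _).trans (max_le (by simp) ?_)
    refine (totalDegree_mul _ _).trans (by simp)

/-- A polynomial whose degree in `X₀` equals its total degree is monic in `X₀`, up to a unit. -/
theorem isUnit_leadingCoeff_of_totalDegree {F : Type*} [Field F] {k : ℕ}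
    (p : MvPolynomial (Fin (k + 1)) F)
    (h : (finSuccEquiv F k p).coeff p.totalDegree ≠ 0) :
    IsUnit (finSuccEquiv F k p).leadingCoeff := by
  have h1 : (finSuccEquiv F k p).natDegree = p.totalDegree := by
    refine le_antisymm ?_ (Polynomial.le_natDegree_of_ne_zero h)
    rw [natDegree_finSuccEquiv]; exact degreeOf_le_totalDegree _ _
  have h2 := totalDegree_coeff_finSuccEquiv_add_le p p.totalDegree h
  have h3 : ((finSuccEquiv F k p).coeff p.totalDegree).totalDegree = 0 := by omega
  rw [Polynomial.leadingCoeff, h1]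
  rw [totalDegree_eq_zero_iff_eq_C] at h3
  rw [h3]
  refine IsUnit.map C (IsUnit.mk0 _ fun h0 => h ?_)
  rw [h3, h0, map_zero]

theorem aeval_mul_of_isHomogeneous {σ R S : Type*} [CommSemiring R] [CommSemiring S] [Algebra R S]
    {q : MvPolynomial σ R} {n : ℕ} (hq : q.IsHomogeneous n) (t : S) (g : σ → S) :
    aeval (fun i => t * g i) q = t ^ n * aeval g q := by
  rw [aeval_def, aeval_def, eval₂_eq, eval₂_eq, Finset.mul_sum]
  refine Finset.sum_congr rfl fun m hm => ?_
  simp only [mul_pow, Finset.prod_mul_distrib, Finset.prod_pow_eq_pow_sum]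
  rw [hq.degree_eq_sum_deg_support hm]
  ring

/-- Over an infinite field, a linear change of variables makes a nonzero polynomial monic in `X₀` up
to a unit: it suffices that the leading form does not vanish at `(1, c)`. -/
theorem exists_shear_isUnit_leadingCoeff {F : Type*} [Field F] [Infinite F] {k : ℕ}
    (p : MvPolynomial (Fin (k + 1)) F) (hp : p ≠ 0) :
    ∃ c : Fin k → F, IsUnit (finSuccEquiv F k (shear c p)).leadingCoeff := by
  set δ := p.totalDegree with hδ
  set q := homogeneousComponent δ p with hq
  have hq0 : q ≠ 0 := by
    intro h0
    obtain ⟨m, hm, hmδ⟩ := Finset.exists_mem_eq_sup p.support (support_nonempty.2 hp)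
      (fun s => s.sum fun _ e => e)
    have : coeff m q = coeff m p := by
      rw [hq, coeff_homogeneousComponent, if_pos]
      rw [hδ, totalDegree, hmδ]; rfl
    rw [h0, coeff_zero] at this
    exact (mem_support_iff.1 hm) this.symm
  obtain ⟨a, ha⟩ : ∃ a, eval a (q * X 0) ≠ 0 := by
    by_contra! h
    exact mul_ne_zero hq0 (X_ne_zero 0) (MvPolynomial.funext fun x => by rw [h x, map_zero])
  rw [map_mul, eval_X] at ha
  have ha0 : a 0 ≠ 0 := right_ne_zero_of_mul ha
  have hqa : eval a q ≠ 0 := left_ne_zero_of_mul ha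
  set c : Fin k → F := fun i => a i.succ / a 0 with hc
  have hac : a = fun i => a 0 * (Fin.cons 1 c : Fin (k + 1) → F) i := by
    ext i; refine Fin.cases ?_ (fun i => ?_) i
    · simp
    · simp [hc, mul_div_cancel₀ _ ha0]
  have hqh : q.IsHomogeneous δ := homogeneousComponent_isHomogeneous δ p
  have hqc : aeval (Fin.cons 1 c : Fin (k + 1) → F) q ≠ 0 := by
    intro h0
    apply hqa
    have := aeval_mul_of_isHomogeneous hqh (a 0) (Fin.cons 1 c : Fin (k + 1) → F)
    rw [h0, mul_zero, ← hac] at this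
    exact this
  refine ⟨c, isUnit_leadingCoeff_of_totalDegree _ ?_⟩
  -- restrict to the line through the origin and `(1, c)`
  let ψ : MvPolynomial (Fin (k + 1)) F →ₐ[F] Polynomial F :=
    (Polynomial.mapAlgHom (aeval (fun _ => (0 : F)))).comp (finSuccEquiv F k).toAlgHom
  have hψ : ψ.comp (shear c) =
      aeval (fun i => Polynomial.X * Polynomial.C ((Fin.cons 1 c : Fin (k + 1) → F) i)) := by
    ext1 i
    refine Fin.cases ?_ (fun i => ?_) i
    · simp only [ψ, shear, AlgHom.comp_apply, aeval_X, Fin.cons_zero]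
      change Polynomial.map _ (finSuccEquiv F k (X 0)) = _
      rw [finSuccEquiv_X_zero]; simp
    · simp only [ψ, shear, AlgHom.comp_apply, aeval_X, Fin.cons_succ]
      change Polynomial.map _ (finSuccEquiv F k (X i.succ + C (c i) * X 0)) = _
      have h2 : finSuccEquiv F k (C (c i)) = Polynomial.C (C (c i)) :=
        (finSuccEquiv F k).commutes (c i)
      rw [map_add, map_mul, finSuccEquiv_X_zero, finSuccEquiv_X_succ, h2]
      simp only [Polynomial.map_add, Polynomial.map_mul, Polynomial.map_C, Polynomial.map_X]
      rw [mul_comm]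
      simp
  have hcoeff : (ψ (shear c p)).coeff δ = aeval (Fin.cons 1 c : Fin (k + 1) → F) q := by
    rw [← AlgHom.comp_apply, hψ]
    conv_lhs => rw [← sum_homogeneousComponent p]
    have h1 : ∀ j, aeval (fun i => Polynomial.X * Polynomial.C ((Fin.cons 1 c : Fin (k + 1) → F) i))
        (homogeneousComponent j p) = Polynomial.X ^ j *
          Polynomial.C (aeval (Fin.cons 1 c : Fin (k + 1) → F) (homogeneousComponent j p)) := by
      intro j
      rw [aeval_mul_of_isHomogeneous (homogeneousComponent_isHomogeneous j p)]
      congr 1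
      change aeval (fun i => algebraMap F (Polynomial F) _) _ = algebraMap F (Polynomial F) _
      exact aeval_algebraMap_apply _ _ _
    rw [map_sum, Polynomial.finsetSum_coeff]
    simp_rw [h1, Polynomial.coeff_X_pow_mul', Polynomial.coeff_C]
    rw [Finset.sum_eq_single δ]
    · simp [hq]
    · intro j hj hjδ
      have : j < δ := by simp at hj; omega
      rw [if_pos this.le, if_neg (by omega)]
    · intro h; simp [hδ] at h
  have hdeg : (shear c p).totalDegree = δ := by
    refine le_antisymm (totalDegree_shear_le c p) ?_
    have h1 : shear (-c) (shear c p) = p := by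
      have := shear_comp_shear_neg (-c)
      rw [neg_neg] at this
      exact congrArg (fun f => f p) this
    calc δ = (shear (-c) (shear c p)).totalDegree := by rw [h1]
      _ ≤ _ := totalDegree_shear_le _ _
  rw [hdeg]
  intro h0
  apply hqc
  rw [← hcoeff]
  simp only [ψ, AlgHom.comp_apply, Polynomial.coe_mapAlgHom, Polynomial.coeff_map]
  erw [h0]; simp


theorem cramerKernel_map {A A' ι κ : Type*} [CommRing A] [CommRing A'] [DecidableEq κ] {r : ℕ}
    (f : A →+* A') (M : Matrix ι κ A) (e : Fin r → ι) (c : Fin r → κ) (j : κ) :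
    cramerKernel (M.map f) e c j = f ∘ cramerKernel M e c j := by
  have h2 : (M.map f).submatrix e c = f.mapMatrix (M.submatrix e c) := by
    ext; simp
  ext1 i
  simp only [cramerKernel, Pi.sub_apply, Finset.sum_apply, Function.comp, map_sub, map_sum,
    Pi.single_apply, apply_ite f, map_zero]
  congr 1
  · rw [h2, ← RingHom.map_det]
  · refine Finset.sum_congr rfl fun l _ => ?_
    congr 1
    rw [Matrix.cramer_apply, Matrix.cramer_apply, RingHom.map_det]
    congr 1
    ext1 x y
    by_cases hy : y = l
    · subst hy; simp
    · simp [hy]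

theorem totalDegree_finSuccEquiv_symm_le {F : Type*} [Field F] {k m D : ℕ}
    (p : Polynomial (MvPolynomial (Fin k) F)) (hp : p.natDegree ≤ m)
    (hc : ∀ i, (p.coeff i).totalDegree ≤ D) :
    ((finSuccEquiv F k).symm p).totalDegree ≤ D + m := by
  rw [p.as_sum_range_C_mul_X_pow, map_sum]
  refine totalDegree_finsetSum_le fun i hi => ?_
  rw [map_mul, map_pow]
  have h1 : (finSuccEquiv F k).symm Polynomial.X = X 0 := by
    rw [AlgEquiv.symm_apply_eq, finSuccEquiv_X_zero]
  have h2 : ∀ a, (finSuccEquiv F k).symm (Polynomial.C a) = rename Fin.succ a := by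
    intro a
    rw [AlgEquiv.symm_apply_eq]
    refine congrArg (fun f : MvPolynomial (Fin k) F →ₐ[F] _ => f a)
      (?_ : (Algebra.ofId (MvPolynomial (Fin k) F)
        (Polynomial (MvPolynomial (Fin k) F))).restrictScalars F =
          (finSuccEquiv F k).toAlgHom.comp (rename Fin.succ))
    ext1 i
    simp [finSuccEquiv_X_succ, Algebra.ofId_apply]
  rw [h1, h2]
  refine (totalDegree_mul _ _).trans (add_le_add ?_ ?_)
  · exact (totalDegree_rename_le _ _).trans (hc i)
  · refine (totalDegree_pow _ _).trans ?_
    simp at hi ⊢; omega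

theorem totalDegree_coeff_finSuccEquiv_le {F : Type*} [Field F] {k : ℕ}
    (p : MvPolynomial (Fin (k + 1)) F) (i : ℕ) :
    ((finSuccEquiv F k p).coeff i).totalDegree ≤ p.totalDegree := by
  by_cases h : (finSuccEquiv F k p).coeff i = 0
  · simp [h]
  · have := totalDegree_coeff_finSuccEquiv_add_le p i h; omega

theorem natDegree_finSuccEquiv_le {F : Type*} [Field F] {k : ℕ}
    (p : MvPolynomial (Fin (k + 1)) F) : (finSuccEquiv F k p).natDegree ≤ p.totalDegree := by
  rw [natDegree_finSuccEquiv]; exact degreeOf_le_totalDegree _ _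


/-- Hermann's theorem over an infinite field, by induction on the number of variables. -/
theorem hasBoundedSolution_of_infinite {F : Type*} [Field F] [Infinite F] (k : ℕ) :
    ∀ (r d : ℕ) (ι κ : Type) [Fintype ι] [Fintype κ]
      (M : Matrix ι κ (MvPolynomial (Fin k) F)) (b : ι → MvPolynomial (Fin k) F)
      (v : κ → MvPolynomial (Fin k) F), Fintype.card ι ≤ r →
      (∀ i j, (M i j).totalDegree ≤ d) → (∀ i, (b i).totalDegree ≤ d) → M.mulVec v = b →
      HasBoundedSolution (fun p => p.totalDegree ≤ hermannBound k r d) M b v := by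
  classical
  induction k with
  | zero =>
    intro r d ι κ _ _ M b v _ _ _ hv
    have h0 : ∀ p : MvPolynomial (Fin 0) F, p.totalDegree ≤ hermannBound 0 r d := by
      intro p
      rw [eq_C_of_isEmpty p]; simp
    exact ⟨v, hv, fun j => h0 _, by simp⟩
  | succ k ih =>
    intro r d ι κ _ _ M b v hι hM hb hv
    obtain ⟨r', e, c, he, hc, hdet, hrow⟩ := exists_maximal_minor
      (algebraMap _ (FractionRing (MvPolynomial (Fin (k + 1)) F))) M
    have hr' : r' ≤ r := by
      have := Fintype.card_le_of_injective e he
      rw [Fintype.card_fin] at this; omega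
    have hΔ0 : (M.submatrix e c).det ≠ 0 := by
      intro h; rw [h, map_zero] at hdet; exact hdet rfl
    obtain ⟨a, ha⟩ := exists_shear_isUnit_leadingCoeff _ hΔ0
    -- coordinates in which the minor is monic up to a unit
    obtain ⟨Θ, hΘ, hΘs⟩ : ∃ Θ : MvPolynomial (Fin (k + 1)) F ≃+*
        Polynomial (MvPolynomial (Fin k) F), (∀ p, Θ p = finSuccEquiv F k (shear a p)) ∧
          ∀ p, Θ.symm p = shear (-a) ((finSuccEquiv F k).symm p) :=
      ⟨((shearEquiv a).trans (finSuccEquiv F k)).toRingEquiv, fun _ => rfl, fun _ => rfl⟩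
    have hdeg : ∀ p : MvPolynomial (Fin (k + 1)) F, p.totalDegree ≤ d → (Θ p).natDegree ≤ d :=
      fun p hp => by
        rw [hΘ]; exact (natDegree_finSuccEquiv_le _).trans ((totalDegree_shear_le a p).trans hp)
    have hcoeff : ∀ p : MvPolynomial (Fin (k + 1)) F, p.totalDegree ≤ d →
        ∀ i, ((Θ p).coeff i).totalDegree ≤ d := fun p hp i => by
      rw [hΘ]
      exact (totalDegree_coeff_finSuccEquiv_le _ _).trans ((totalDegree_shear_le a p).trans hp)
    set D := hermannBound k (r * (r * d + d + 1)) d with hD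
    let bd : Polynomial (MvPolynomial (Fin k) F) → Prop := fun p =>
      (Θ.symm p).totalDegree ≤ D + r * d
    have hbd : ∀ p : Polynomial (MvPolynomial (Fin k) F), p.natDegree ≤ r * d →
        (∀ i, (p.coeff i).totalDegree ≤ D) → bd p := fun p h1 h2 => by
      change (Θ.symm p).totalDegree ≤ _
      rw [hΘs]
      exact (totalDegree_shear_le _ _).trans (totalDegree_finSuccEquiv_symm_le p h1 h2)
    change HasBoundedSolution (fun p => p.totalDegree ≤ D + r * d) M b v
    refine HasBoundedSolution.of_ringEquiv (bd' := bd) Θ (fun x hx => hx) ?_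
    have hcram : ∀ j, (M.map Θ).mulVec (cramerKernel (M.map Θ) e c j) = 0 ∧
        ∀ i, bd (cramerKernel (M.map Θ) e c j i) := by
      intro j
      have h1 : cramerKernel (M.map Θ) e c j = Θ ∘ cramerKernel M e c j :=
        cramerKernel_map Θ.toRingHom M e c j
      constructor
      · rw [h1]
        have h3 : M.mulVec (cramerKernel M e c j) = 0 :=
          mulVec_eq_of_maximal_minor M e hrow _ fun l => cramerKernel_row M e c j l
        ext1 i
        have := congrArg Θ (congrFun h3 i)
        simpa [Matrix.mulVec, dotProduct] using this
      · intro i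
        have := cramerKernel_mem M e c (totalDegreeFiltration _ F) hM j i
        rw [mem_totalDegreeFiltration] at this
        change (Θ.symm _).totalDegree ≤ _
        rw [h1, Function.comp, RingEquiv.symm_apply_apply]
        exact this.trans ((Nat.mul_le_mul_right d hr').trans (Nat.le_add_left _ _))
    have hvΘ : (M.map Θ).mulVec (Θ ∘ v) = Θ ∘ b := by
      rw [← hv]; ext1 i; simp [Matrix.mulVec, dotProduct]
    have hunit : IsUnit ((M.map Θ).submatrix e c).det.leadingCoeff := by
      have h2 : ((M.map Θ).submatrix e c).det = Θ (M.submatrix e c).det :=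
        (RingHom.map_det Θ.toRingHom (M.submatrix e c)).symm
      rw [h2, hΘ]
      exact ha
    obtain ⟨v₁, hv₁, hspan⟩ := exists_natDegree_le_of_minor (M.map Θ) (d := d) e c hc
      (fun i j => hdeg _ (hM i j)) hunit (Θ ∘ b) (fun i => hdeg _ (hb i)) (Θ ∘ v)
      (fun l => congrFun hvΘ _)
    have hspan' : Θ ∘ v - v₁ ∈ Submodule.span _
        {w | (M.map Θ).mulVec w = 0 ∧ ∀ j, bd (w j)} :=
      Submodule.span_mono (by rintro _ ⟨j, rfl⟩; exact hcram j) hspan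
    refine HasBoundedSolution.of_kernel hspan' ?_
    have hv₁Θ : (M.map Θ).mulVec v₁ = Θ ∘ b := by
      have h0 : (M.map Θ).mulVec (Θ ∘ v - v₁) = 0 := by
        refine Submodule.span_induction (p := fun z _ => (M.map Θ).mulVec z = 0)
          (fun z hz => hz.1) (Matrix.mulVec_zero _) ?_ ?_ hspan'
        · intro x y _ _ hx hy; rw [Matrix.mulVec_add, hx, hy, add_zero]
        · intro x y _ hy; rw [Matrix.mulVec_smul, hy, smul_zero]
      rw [Matrix.mulVec_sub, hvΘ, sub_eq_zero] at h0
      exact h0.symm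
    -- compare coefficients of the powers of the last variable
    have hv₁' : ∀ j, (v₁ j).natDegree ≤ r * d := fun j =>
      (hv₁ j).trans (Nat.mul_le_mul_right d hr')
    have hcard : Fintype.card (ι × Fin (r * d + d + 1)) ≤ r * (r * d + d + 1) := by
      rw [Fintype.card_prod, Fintype.card_fin]; exact Nat.mul_le_mul_right _ hι
    obtain ⟨u, hu, hub, hus⟩ := ih _ d _ _ (unpackMatrix (r * d) (r * d + d + 1) (M.map Θ))
      (fun p => (Θ (b p.1)).coeff p.2) (fun p => (v₁ p.1).coeff p.2) hcard
      (fun p q => by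
        rw [unpackMatrix]
        split_ifs
        · exact hcoeff _ (hM _ _) _
        · simp)
      (fun p => hcoeff _ (hb _) _)
      (by
        ext1 p
        rw [unpackMatrix_mulVec, pack_coeff _ _ hv₁', hv₁Θ]; rfl)
    have hpackbd : ∀ w : κ × Fin (r * d + 1) → MvPolynomial (Fin k) F,
        (∀ q, (w q).totalDegree ≤ D) → ∀ j, bd (pack (r * d) w j) := by
      intro w hw j
      refine hbd _ (natDegree_pack_le _ _ _) fun i => ?_
      rw [pack_apply, Polynomial.finsetSum_coeff]
      refine totalDegree_finsetSum_le fun q _ => ?_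
      rw [Polynomial.coeff_C_mul_X_pow]
      split_ifs
      · exact hw _
      · simp
    have hpackeq : ∀ (b' : ι → Polynomial (MvPolynomial (Fin k) F))
        (_ : ∀ i, (b' i).natDegree ≤ d) (w : κ × Fin (r * d + 1) → MvPolynomial (Fin k) F),
        (unpackMatrix (r * d) (r * d + d + 1) (M.map Θ)).mulVec w =
          (fun p => (b' p.1).coeff p.2) → (M.map Θ).mulVec (pack (r * d) w) = b' :=
      fun b' hb' w hw => mulVec_pack_eq _ d _ (fun i j => hdeg _ (hM i j)) b' hb' w hw
    refine ⟨pack (r * d) u, hpackeq _ (fun i => hdeg _ (hb i)) u hu, hpackbd u hub, ?_⟩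
    rw [← pack_coeff _ _ hv₁', ← map_sub]
    refine Submodule.span_induction (p := fun z _ => pack (r * d) z ∈ Submodule.span _
        {w | (M.map Θ).mulVec w = 0 ∧ ∀ j, bd (w j)}) ?_ ?_ ?_ ?_ hus
    · rintro w ⟨hw, hw'⟩
      refine Submodule.subset_span ⟨hpackeq 0 (fun _ => by simp) w ?_, hpackbd w hw'⟩
      rw [hw]; ext1 p; simp
    · rw [map_zero]; exact Submodule.zero_mem _
    · intro x y _ _ hx hy; rw [map_add]; exact Submodule.add_mem _ hx hy
    · intro x y _ hy
      rw [map_smul]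
      have : x • pack (r * d) y = Polynomial.C x • pack (r * d) y := by
        ext1 j; simp [Polynomial.smul_eq_C_mul]
      rw [this]
      exact Submodule.smul_mem _ _ hy


section descent
variable {F E σ : Type*} [Field F] [Field E] [Algebra F E]

theorem coeff_sum_monomial_linearMap (π : E →ₗ[F] F) (p : MvPolynomial σ E) (m : σ →₀ ℕ) :
    (∑ l ∈ p.support, monomial l (π (p.coeff l))).coeff m = π (p.coeff m) := by
  classical
  simp only [coeff_sum, coeff_monomial, Finset.sum_ite_eq']
  split_ifs with h
  · rfl
  · rw [notMem_support_iff.1 h, map_zero]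

/-- A linear map applied to all coefficients of a polynomial. -/
noncomputable def mapCoeffs (π : E →ₗ[F] F) : MvPolynomial σ E →+ MvPolynomial σ F where
  toFun p := ∑ l ∈ p.support, monomial l (π (p.coeff l))
  map_zero' := by simp
  map_add' p q := by
    ext m
    rw [coeff_add, coeff_sum_monomial_linearMap, coeff_sum_monomial_linearMap,
      coeff_sum_monomial_linearMap, coeff_add, map_add]

theorem coeff_mapCoeffs (π : E →ₗ[F] F) (p : MvPolynomial σ E) (m : σ →₀ ℕ) :
    (mapCoeffs π p).coeff m = π (p.coeff m) :=
  coeff_sum_monomial_linearMap π p m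

theorem mapCoeffs_map_mul (π : E →ₗ[F] F) (p : MvPolynomial σ F) (q : MvPolynomial σ E) :
    mapCoeffs π (map (algebraMap F E) p * q) = p * mapCoeffs π q := by
  classical
  ext m
  rw [coeff_mapCoeffs, coeff_mul, coeff_mul, map_sum]
  refine Finset.sum_congr rfl fun x _ => ?_
  rw [coeff_map, coeff_mapCoeffs, ← Algebra.smul_def, map_smul, smul_eq_mul]

theorem totalDegree_mapCoeffs_le (π : E →ₗ[F] F) (p : MvPolynomial σ E) :
    (mapCoeffs π p).totalDegree ≤ p.totalDegree := by
  refine Finset.sup_mono fun m hm => ?_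
  rw [mem_support_iff, coeff_mapCoeffs] at hm
  rw [mem_support_iff]
  intro h; rw [h, map_zero] at hm; exact hm rfl

/-- Bounded solutions descend along a field extension, by applying a linear retraction of the
extension to all coefficients. -/
theorem HasBoundedSolution.descend {ι κ : Type*} [Fintype κ] {D : ℕ}
    {M : Matrix ι κ (MvPolynomial σ F)} {b : ι → MvPolynomial σ F} {v : κ → MvPolynomial σ F}
    (h : HasBoundedSolution (fun p => p.totalDegree ≤ D) (M.map (map (algebraMap F E)))
      (map (algebraMap F E) ∘ b) (map (algebraMap F E) ∘ v)) :
    HasBoundedSolution (fun p => p.totalDegree ≤ D) M b v := by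
  obtain ⟨π, hπ⟩ := (Algebra.linearMap F E).exists_leftInverse_of_injective
    (LinearMap.ker_eq_bot.2 (FaithfulSMul.algebraMap_injective F E))
  have hπ1 : ∀ p : MvPolynomial σ F, mapCoeffs π (map (algebraMap F E) p) = p := by
    intro p; ext m
    rw [coeff_mapCoeffs, coeff_map]
    exact LinearMap.congr_fun hπ _
  have hmul : ∀ w : κ → MvPolynomial σ E, M.mulVec (mapCoeffs π ∘ w) =
      mapCoeffs π ∘ ((M.map (map (algebraMap F E))).mulVec w) := by
    intro w; ext1 i
    simp only [Matrix.mulVec, dotProduct, Function.comp, map_sum, Matrix.map_apply,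
      mapCoeffs_map_mul]
  obtain ⟨v', hv', hb, hs⟩ := h
  refine ⟨mapCoeffs π ∘ v', ?_, fun j => (totalDegree_mapCoeffs_le _ _).trans (hb j), ?_⟩
  · rw [hmul, hv']; ext1 i; exact hπ1 _
  have h1 : v - mapCoeffs π ∘ v' =
      mapCoeffs π ∘ ((1 : MvPolynomial σ E) • (map (algebraMap F E) ∘ v - v')) := by
    ext1 i; simp [hπ1]
  rw [h1]
  refine Submodule.span_induction
    (p := fun (z : κ → MvPolynomial σ E) _ => ∀ a : MvPolynomial σ E, mapCoeffs π ∘ (a • z) ∈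
      Submodule.span _ {w | M.mulVec w = 0 ∧ ∀ j, (w j).totalDegree ≤ D}) ?_ ?_ ?_ ?_ hs 1
  · rintro w ⟨hw, hw'⟩ a
    induction a using MvPolynomial.induction_on' with
    | monomial m c =>
      have h2 : mapCoeffs π ∘ (monomial m c • w) =
          (monomial m (1 : F)) • (mapCoeffs π ∘ ((C c : MvPolynomial σ E) • w)) := by
        ext1 i
        simp only [Function.comp, Pi.smul_apply, smul_eq_mul]
        rw [← mapCoeffs_map_mul, map_monomial, map_one, ← mul_assoc, mul_comm (monomial m 1),
          C_mul_monomial, mul_one]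
      rw [h2]
      refine Submodule.smul_mem _ _ (Submodule.subset_span ⟨?_, fun j => ?_⟩)
      · rw [hmul, Matrix.mulVec_smul, hw]; ext1 i; simp
      · refine (totalDegree_mapCoeffs_le _ _).trans ?_
        refine (totalDegree_mul _ _).trans ?_
        rw [totalDegree_C, zero_add]; exact hw' j
    | add p q hp hq =>
      have : mapCoeffs π ∘ ((p + q) • w) = mapCoeffs π ∘ (p • w) + mapCoeffs π ∘ (q • w) := by
        ext1 i; simp [add_mul]
      rw [this]; exact Submodule.add_mem _ hp hq
  · intro a
    convert Submodule.zero_mem _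
    ext1 i; simp
  · intro x y _ _ hx hy a
    have : mapCoeffs π ∘ (a • (x + y)) = mapCoeffs π ∘ (a • x) + mapCoeffs π ∘ (a • y) := by
      ext1 i; simp
    rw [this]; exact Submodule.add_mem _ (hx a) (hy a)
  · intro a x _ hx c
    rw [smul_smul]; exact hx _

end descent

theorem totalDegree_map_le {F E σ : Type*} [CommSemiring F] [CommSemiring E] (f : F →+* E)
    (p : MvPolynomial σ F) : (map f p).totalDegree ≤ p.totalDegree :=
  Finset.sup_mono (support_map_subset _ _)

theorem hasBoundedSolution {F : Type*} [Field F] (k r d : ℕ) (ι κ : Type) [Fintype ι] [Fintype κ]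
      (M : Matrix ι κ (MvPolynomial (Fin k) F)) (b : ι → MvPolynomial (Fin k) F)
      (v : κ → MvPolynomial (Fin k) F) (hι : Fintype.card ι ≤ r)
      (hM : ∀ i j, (M i j).totalDegree ≤ d) (hb : ∀ i, (b i).totalDegree ≤ d)
      (hv : M.mulVec v = b) :
      HasBoundedSolution (fun p => p.totalDegree ≤ hermannBound k r d) M b v := by
  refine HasBoundedSolution.descend (E := AlgebraicClosure F) ?_
  have : Infinite (AlgebraicClosure F) := IsAlgClosed.instInfinite
  refine hasBoundedSolution_of_infinite k r d ι κ _ _ _ hι (fun i j => ?_) (fun i => ?_) ?_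
  · exact (totalDegree_map_le _ _).trans (hM i j)
  · exact (totalDegree_map_le _ _).trans (hb i)
  · ext1 i
    rw [← hv]
    simp [Matrix.mulVec, dotProduct]

/-- **Hermann's theorem** for one equation: the solutions of `∑ j, f j * v j = b` are generated in
degree at most `(3 * d) ^ 2 ^ n`. -/
theorem exists_bounded_solution {F τ : Type*} [Field F] [Fintype τ] {κ : Type} [Fintype κ]
    {d n : ℕ} (hd : 0 < d) (hn : Fintype.card τ ≤ n) (f : κ → MvPolynomial τ F)
    (b : MvPolynomial τ F) (v : κ → MvPolynomial τ F)
    (hf : ∀ j, (f j).totalDegree ≤ d) (hb : b.totalDegree ≤ d) (hv : ∑ j, f j * v j = b) :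
    ∃ v' : κ → MvPolynomial τ F, ∑ j, f j * v' j = b ∧
      (∀ j, (v' j).totalDegree ≤ (3 * d) ^ 2 ^ n) ∧
      v - v' ∈ Submodule.span (MvPolynomial τ F)
        {w | ∑ j, f j * w j = 0 ∧ ∀ j, (w j).totalDegree ≤ (3 * d) ^ 2 ^ n} := by
  obtain ⟨k, hk⟩ : ∃ k, k = Fintype.card τ := ⟨_, rfl⟩
  rw [← hk] at hn
  have hbound : hermannBound k 1 d ≤ (3 * d) ^ 2 ^ n := by
    have h1 := hermannBound_le k one_pos hd
    rw [mul_one] at h1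
    have h2 : (3 * d) ^ 2 ^ k ≤ (3 * d) ^ 2 ^ n :=
      Nat.pow_le_pow_right (by omega) (Nat.pow_le_pow_right (by omega) hn)
    omega
  obtain ⟨ρ, hρ⟩ : ∃ ρ : MvPolynomial τ F ≃+* MvPolynomial (Fin k) F,
      ∀ p, (ρ p).totalDegree = p.totalDegree :=
    ⟨(renameEquiv F (Fintype.equivFinOfCardEq hk.symm)).toRingEquiv,
      fun p => totalDegree_renameEquiv _ _⟩
  let M : Matrix Unit κ (MvPolynomial τ F) := fun _ j => f j
  have key : HasBoundedSolution (fun p : MvPolynomial τ F => p.totalDegree ≤ hermannBound k 1 d)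
      M (fun _ => b) v := by
    refine HasBoundedSolution.of_ringEquiv
      (bd' := fun p : MvPolynomial (Fin k) F => p.totalDegree ≤ hermannBound k 1 d) ρ
      (fun x hx => ?_) ?_
    · rw [← hρ, RingEquiv.apply_symm_apply]; exact hx
    · refine hasBoundedSolution k 1 d Unit κ _ _ _ (by simp) (fun i j => ?_) (fun i => ?_) ?_
      · exact (hρ _).trans_le (hf j)
      · exact (hρ _).trans_le hb
      · ext1 i
        rw [← hv]
        simp [Matrix.mulVec, dotProduct, M]
        rfl
  obtain ⟨v', h1, h2, h3⟩ := key
  refine ⟨v', congrFun h1 (), fun j => (h2 j).trans hbound, Submodule.span_mono ?_ h3⟩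
  rintro w ⟨hw, hw'⟩
  exact ⟨congrFun hw (), fun j => (hw' j).trans hbound⟩


/-! ### Syzygies and membership over a field of fractions -/

/-- The monomials of degree at most `D`. -/
noncomputable def monomialsLE (τ : Type*) [Finite τ] (D : ℕ) : Finset (τ →₀ ℕ) :=
  (Finsupp.finite_of_degree_le (σ := τ) D).toFinset

theorem mem_monomialsLE {τ : Type*} [Finite τ] {D : ℕ} {m : τ →₀ ℕ} :
    m ∈ monomialsLE τ D ↔ m.degree ≤ D := by
  simp [monomialsLE]

theorem card_monomialsLE_le (τ : Type*) [Fintype τ] (D : ℕ) :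
    (monomialsLE τ D).card ≤ (D + 1) ^ Fintype.card τ := by
  classical
  have h : ∀ m ∈ monomialsLE τ D, ∀ i, m i < D + 1 := fun m hm i =>
    Nat.lt_succ_of_le ((Finsupp.le_degree i m).trans (mem_monomialsLE.1 hm))
  let g : monomialsLE τ D → (τ → Fin (D + 1)) := fun m i => ⟨m.1 i, h m.1 m.2 i⟩
  have hg : Function.Injective g := by
    intro a b hab
    ext i
    exact congrArg Fin.val (congrFun hab i)
  have := Fintype.card_le_of_injective g hg
  simpa using this

theorem totalDegree_le_iff {τ A : Type*} [CommSemiring A] {D : ℕ} {p : MvPolynomial τ A} :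
    p.totalDegree ≤ D ↔ ∀ m, p.coeff m ≠ 0 → m.degree ≤ D := by
  rw [totalDegree, Finset.sup_le_iff]
  refine forall_congr' fun m => ?_
  rw [mem_support_iff]; rfl

theorem sum_monomialsLE {τ A : Type*} [Finite τ] [CommSemiring A] {D : ℕ} {p : MvPolynomial τ A}
    (h : p.totalDegree ≤ D) : ∑ m : monomialsLE τ D, monomial m.1 (p.coeff m.1) = p := by
  classical
  rw [Finset.sum_coe_sort (monomialsLE τ D) (fun m => monomial m (p.coeff m))]
  ext l
  rw [coeff_sum]
  simp only [coeff_monomial, Finset.sum_ite_eq']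
  split_ifs with hl
  · rfl
  · by_contra h0
    exact hl (mem_monomialsLE.2 (totalDegree_le_iff.1 h l (Ne.symm h0)))

/-- The total degree of `p` is at most `a`, and its coefficients have degree at most `b`. -/
def IsBounded {A : Type*} [CommRing A] (G : DegreeFiltration A) {τ : Type*} (a b : ℕ)
    (p : MvPolynomial τ A) : Prop :=
  p.totalDegree ≤ a ∧ ∀ m, p.coeff m ∈ G.piece b

theorem isBounded_sum_monomial {A : Type*} [CommRing A] (G : DegreeFiltration A) {τ : Type*}
    [Finite τ] (D : ℕ) {b : ℕ} (w : monomialsLE τ D → A) (hw : ∀ m, w m ∈ G.piece b) :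
    IsBounded G D b (∑ m : monomialsLE τ D, monomial m.1 (w m)) := by
  classical
  refine ⟨totalDegree_finsetSum_le fun m _ => ?_, fun l => ?_⟩
  · exact (totalDegree_monomial_le _ _).trans (mem_monomialsLE.1 m.2)
  · rw [coeff_sum]
    refine sum_mem fun m _ => ?_
    rw [coeff_monomial]
    split_ifs
    · exact hw m
    · exact zero_mem _

theorem isBounded_monomial_mul {A τ : Type*} [CommRing A] (G : DegreeFiltration A) {a b D : ℕ}
    {p : MvPolynomial τ A} (hp : IsBounded G a b p) {m : τ →₀ ℕ} (hm : m.degree ≤ D) :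
    IsBounded G (D + a) b (monomial m 1 * p) := by
  classical
  refine ⟨(totalDegree_mul _ _).trans (add_le_add ((totalDegree_monomial_le _ _).trans hm) hp.1),
    fun l => ?_⟩
  rw [coeff_monomial_mul']
  split_ifs
  · rw [one_mul]; exact hp.2 _
  · exact zero_mem _

/-- Every element of the field `F` is a quotient of images of elements of `A`. -/
def HasFractions {A F : Type*} [CommRing A] [Field F] (φ : A →+* F) : Prop :=
  ∀ x, ∃ a b, φ b ≠ 0 ∧ φ b * x = φ a

theorem HasFractions.mvPolynomial {A F τ : Type*} [CommRing A] [Field F] {φ : A →+* F}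
    (hφ : HasFractions φ) (p : MvPolynomial τ F) :
    ∃ (q : MvPolynomial τ A) (b : A), φ b ≠ 0 ∧ C (φ b) * p = map φ q := by
  induction p using MvPolynomial.induction_on' with
  | monomial m x =>
    obtain ⟨a, b, hb, h⟩ := hφ x
    exact ⟨monomial m a, b, hb, by rw [C_mul_monomial, h, map_monomial]⟩
  | add p q hp hq =>
    obtain ⟨p', b, hb, h⟩ := hp
    obtain ⟨q', c, hc, h'⟩ := hq
    refine ⟨C c * p' + C b * q', b * c, by rw [map_mul]; exact mul_ne_zero hb hc, ?_⟩
    simp only [map_add, map_mul, map_C, ← h, ← h']; ring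

section lift
variable {A F τ : Type*} [CommRing A] [Field F] [Fintype τ] (G : DegreeFiltration A) (φ : A →+* F)

/-- The linear relations over `F` between images of polynomials with bounded coefficients are
spanned by images of bounded vectors. -/
theorem mem_span_bounded_relations {χ : Type*} [Fintype χ] {D d n : ℕ} (hn : Fintype.card τ ≤ n)
    (P : χ → MvPolynomial τ A) (hP : ∀ c, IsBounded G D d (P c)) (x : χ → F)
    (hx : ∑ c, C (x c) * map φ (P c) = 0) :
    x ∈ Submodule.span F ((fun w : χ → A => fun c => φ (w c)) ''
      {w | (∀ c, w c ∈ G.piece ((D + 1) ^ n * d)) ∧ map φ (∑ c, C (w c) * P c) = 0}) := by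
  classical
  have h := mem_span_bounded_kernel G φ (ι := monomialsLE τ D) (fun m c => (P c).coeff m.1)
    (d := d) (n := (D + 1) ^ n) (fun m c => (hP c).2 m.1) (Or.inr ⟨inferInstance, by
      rw [Nat.card_eq_fintype_card, Fintype.card_coe]
      exact (card_monomialsLE_le τ D).trans (Nat.pow_le_pow_right (by omega) hn)⟩) x (by
      intro m
      have := congrArg (coeff m.1) hx
      rw [coeff_sum, coeff_zero] at this
      rw [← this]
      refine Finset.sum_congr rfl fun c _ => ?_
      rw [coeff_C_mul, coeff_map, mul_comm])
  refine Submodule.span_mono (Set.image_mono ?_) h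
  rintro w ⟨hw, hw'⟩
  refine ⟨hw, ?_⟩
  ext m
  rw [coeff_map, coeff_zero, coeff_sum]
  by_cases hm : m.degree ≤ D
  · have := hw' ⟨m, mem_monomialsLE.2 hm⟩
    rw [← this]
    congr 1
    refine Finset.sum_congr rfl fun c _ => ?_
    rw [coeff_C_mul, mul_comm]
  · rw [Finset.sum_eq_zero, map_zero]
    intro c _
    rw [coeff_C_mul]
    have : (P c).coeff m = 0 := by
      by_contra h0; exact hm (totalDegree_le_iff.1 (hP c).1 m h0)
    rw [this, mul_zero]

/-- Up to a denominator `u`, a syzygy over `F` of the images of bounded polynomials `f j` is a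
combination of lifts of syzygies that are bounded in `τ` and in their coefficients. -/
theorem exists_bounded_syzygies (hφ : HasFractions φ) {κ : Type} [Fintype κ] {d n : ℕ}
    (hd : 0 < d) (hn : Fintype.card τ ≤ n) (f : κ → MvPolynomial τ A)
    (hf : ∀ j, IsBounded G d d (f j)) (g : κ → MvPolynomial τ A)
    (hg : map φ (∑ j, f j * g j) = 0) :
    ∃ u, φ u ≠ 0 ∧ ∃ g' ∈ Submodule.span (MvPolynomial τ A) {s : κ → MvPolynomial τ A |
      (∀ j, IsBounded G ((3 * d) ^ 2 ^ n) (((3 * d) ^ 2 ^ n + d + 1) ^ n * d) (s j)) ∧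
        map φ (∑ j, f j * s j) = 0}, ∀ j, map φ (C u * g j) = map φ (g' j) := by
  classical
  set D := (3 * d) ^ 2 ^ n with hD
  set T₀ := {s : κ → MvPolynomial τ A |
      (∀ j, IsBounded G D ((D + d + 1) ^ n * d) (s j)) ∧ map φ (∑ j, f j * s j) = 0} with hT
  -- fractions of lifts of bounded syzygies form a submodule
  let N : Submodule (MvPolynomial τ F) (κ → MvPolynomial τ F) :=
    { carrier := {z | ∃ u, φ u ≠ 0 ∧ ∃ g' ∈ Submodule.span (MvPolynomial τ A) T₀,
        ∀ j, C (φ u) * z j = map φ (g' j)}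
      zero_mem' := ⟨1, by simp, 0, Submodule.zero_mem _, by simp⟩
      add_mem' := by
        rintro x y ⟨u, hu, g, hg, h⟩ ⟨u', hu', g', hg', h'⟩
        refine ⟨u * u', by rw [map_mul]; exact mul_ne_zero hu hu',
          (C u' : MvPolynomial τ A) • g + (C u : MvPolynomial τ A) • g',
          Submodule.add_mem _ (Submodule.smul_mem _ _ hg) (Submodule.smul_mem _ _ hg'),
          fun j => ?_⟩
        simp only [Pi.add_apply, Pi.smul_apply, smul_eq_mul, map_add, map_mul, map_C, ← h, ← h']
        ring
      smul_mem' := by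
        rintro a x ⟨u, hu, g, hg, h⟩
        obtain ⟨q, b, hb, hq⟩ := hφ.mvPolynomial a
        refine ⟨b * u, by rw [map_mul]; exact mul_ne_zero hb hu, q • g,
          Submodule.smul_mem _ _ hg, fun j => ?_⟩
        simp only [Pi.smul_apply, smul_eq_mul, map_mul, ← h, ← hq]
        ring }
  suffices hN : (fun j => map φ (g j)) ∈ N by
    obtain ⟨u, hu, g', hg', h⟩ := hN
    exact ⟨u, hu, g', hg', fun j => by rw [map_mul, map_C, h]⟩
  have hbd : ∀ w : κ → MvPolynomial τ F, ∑ j, map φ (f j) * w j = 0 →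
      (∀ j, (w j).totalDegree ≤ D) → w ∈ N := by
    intro w hw hwD
    let x : κ × monomialsLE τ D → F := fun p => (w p.1).coeff p.2.1
    let L : (κ × monomialsLE τ D → F) →ₗ[F] (κ → MvPolynomial τ F) :=
      { toFun := fun x j => ∑ m : monomialsLE τ D, monomial m.1 (x (j, m))
        map_add' := fun x y => by ext1 j; simp [Finset.sum_add_distrib]
        map_smul' := fun a x => by
          ext1 j; simp [Finset.smul_sum, smul_monomial] }
    have hLx : L x = w := by
      ext1 j; exact sum_monomialsLE (hwD j)
    have hx : x ∈ Submodule.span F _ := mem_span_bounded_relations (D := D + d) (d := d) G φ hn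
      (fun p : κ × monomialsLE τ D => monomial p.2.1 1 * f p.1)
      (fun p => isBounded_monomial_mul G (hf p.1) (mem_monomialsLE.1 p.2.2)) x (by
        rw [← hw, Fintype.sum_prod_type]
        refine Finset.sum_congr rfl fun j _ => ?_
        conv_rhs => rw [← hLx]
        change _ = _ * ∑ m : monomialsLE τ D, monomial m.1 (x (j, m))
        rw [Finset.mul_sum]
        refine Finset.sum_congr rfl fun m _ => ?_
        rw [map_mul, map_monomial, map_one, ← mul_assoc, C_mul_monomial, mul_one, mul_comm])
    rw [← hLx]
    refine Submodule.span_induction (p := fun z _ => L z ∈ N) ?_ ?_ ?_ ?_ hx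
    · rintro _ ⟨y, ⟨hy, hy'⟩, rfl⟩
      refine ⟨1, by simp, fun j => ∑ m : monomialsLE τ D, monomial m.1 (y (j, m)),
        Submodule.subset_span ⟨fun j => isBounded_sum_monomial G D _ fun m => hy _, ?_⟩,
        fun j => ?_⟩
      · rw [← hy', Fintype.sum_prod_type]
        congr 1
        refine Finset.sum_congr rfl fun j _ => ?_
        rw [Finset.mul_sum]
        refine Finset.sum_congr rfl fun m _ => ?_
        rw [← mul_assoc, C_mul_monomial, mul_one, mul_comm]
      · simp [L]
    · rw [map_zero]; exact N.zero_mem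
    · intro x y _ _ hx hy; rw [map_add]; exact N.add_mem hx hy
    · intro a x _ hx
      rw [map_smul]
      have : a • L x = (C a : MvPolynomial τ F) • L x := by
        ext1 j; simp [C_mul']
      rw [this]; exact N.smul_mem _ hx
  obtain ⟨v', hv', hb, hs⟩ := exists_bounded_solution hd hn (fun j => map φ (f j)) 0
    (fun j => map φ (g j)) (fun j => (totalDegree_map_le _ _).trans (hf j).1) (by simp)
    (by rw [← hg, map_sum]; simp)
  have h1 : (fun j => map φ (g j)) - v' ∈ N := by
    refine Submodule.span_le.2 ?_ hs
    rintro w ⟨hw, hw'⟩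
    exact hbd w hw hw'
  have := N.add_mem h1 (hbd v' hv' hb)
  simpa using this

/-- If `b` is in the ideal generated over `F` by the images of the `f j`, then it is so with a
denominator `c` of bounded degree. -/
theorem exists_bounded_membership {κ : Type} [Fintype κ] {d n : ℕ}
    (hd : 0 < d) (hn : Fintype.card τ ≤ n) (f : κ → MvPolynomial τ A)
    (hf : ∀ j, IsBounded G d d (f j)) (b : MvPolynomial τ A) (hb : IsBounded G d d b)
    (v : κ → MvPolynomial τ F) (hv : ∑ j, map φ (f j) * v j = map φ b) :
    ∃ c ∈ G.piece (((3 * d) ^ 2 ^ n + d + 1) ^ n * d), φ c ≠ 0 ∧ ∃ s : κ → MvPolynomial τ A,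
      map φ (∑ j, f j * s j) = map φ (C c * b) := by
  classical
  set D := (3 * d) ^ 2 ^ n with hD
  obtain ⟨v', hv', hvD, -⟩ := exists_bounded_solution hd hn (fun j => map φ (f j)) (map φ b)
    v (fun j => (totalDegree_map_le _ _).trans (hf j).1)
    ((totalDegree_map_le _ _).trans hb.1) hv
  let P : Option (κ × monomialsLE τ D) → MvPolynomial τ A := fun o =>
    o.elim b fun p => monomial p.2.1 1 * f p.1
  let x : Option (κ × monomialsLE τ D) → F := fun o => o.elim (-1) fun p => (v' p.1).coeff p.2.1
  have hx : x ∈ Submodule.span F _ := mem_span_bounded_relations (D := D + d) (d := d) G φ hn P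
    (by
      rintro (_ | p)
      · exact ⟨hb.1.trans (Nat.le_add_left _ _), hb.2⟩
      · exact isBounded_monomial_mul G (hf p.1) (mem_monomialsLE.1 p.2.2)) x (by
      rw [Fintype.sum_option, Fintype.sum_prod_type]
      have : ∀ j, ∑ m : monomialsLE τ D, C (x (some (j, m))) * map φ (P (some (j, m))) =
          map φ (f j) * v' j := by
        intro j
        conv_rhs => rw [← sum_monomialsLE (hvD j), Finset.mul_sum]
        refine Finset.sum_congr rfl fun m _ => ?_
        change C _ * map φ (_ * _) = _
        rw [map_mul, map_monomial, map_one, ← mul_assoc, C_mul_monomial, mul_one, mul_comm]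
        rfl
      simp_rw [this]
      rw [hv']
      simp [x, P])
  -- one of the bounded relations that span has a nonzero coefficient at `b`
  obtain ⟨w, ⟨hw, hw'⟩, hw0⟩ : ∃ w ∈ {w : Option (κ × monomialsLE τ D) → A |
      (∀ c, w c ∈ G.piece ((D + d + 1) ^ n * d)) ∧ map φ (∑ c, C (w c) * P c) = 0},
      φ (w none) ≠ 0 := by
    by_contra! hcon
    have : x none = 0 := by
      refine Submodule.span_induction (p := fun z _ => z none = 0) ?_ rfl ?_ ?_ hx
      · rintro _ ⟨w, hw, rfl⟩; exact hcon w hw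
      · intro x y _ _ hx hy; rw [Pi.add_apply, hx, hy, add_zero]
      · intro a x _ hx; rw [Pi.smul_apply, hx, smul_zero]
    simp [x] at this
  refine ⟨w none, hw none, hw0, fun j => -∑ m : monomialsLE τ D, monomial m.1 (w (some (j, m))), ?_⟩
  rw [Fintype.sum_option, map_add, ← eq_neg_iff_add_eq_zero] at hw'
  change map φ (C (w none) * b) = _ at hw'
  rw [hw', ← map_neg]
  congr 1
  rw [Fintype.sum_prod_type, ← Finset.sum_neg_distrib]
  refine Finset.sum_congr rfl fun j _ => ?_
  rw [mul_neg, Finset.mul_sum]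
  congr 1
  refine Finset.sum_congr rfl fun m _ => ?_
  change _ = C _ * (monomial m.1 1 * f j)
  rw [← mul_assoc, C_mul_monomial, mul_one, mul_comm]

end lift

/-! ### Elimination, and torsion with respect to one prime -/

/-- If `q` is irreducible in `B[X]` and does not divide `u`, then the ideal `(q, u)` contains a
nonzero constant. By Gauss's lemma, `q` and `u` are coprime over the fraction field of `B`. -/
theorem exists_elimination_polynomial {B : Type*} [CommRing B] [IsDomain B]
    [UniqueFactorizationMonoid B] {q u : Polynomial B} (hq : Irreducible q) (hu : ¬ q ∣ u) :
    ∃ (r : B) (α β : Polynomial B), r ≠ 0 ∧ Polynomial.C r = α * q + β * u := by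
  by_cases h0 : q.natDegree = 0
  · refine ⟨q.coeff 0, 1, 0, fun h => ?_, ?_⟩
    · rw [Polynomial.eq_C_of_natDegree_eq_zero h0, h, map_zero] at hq
      exact not_irreducible_zero hq
    · rw [← Polynomial.eq_C_of_natDegree_eq_zero h0]; ring
  · set L := FractionRing B
    have hprim : q.IsPrimitive := hq.isPrimitive h0
    have hirr : Irreducible (q.map (algebraMap B L)) :=
      hprim.irreducible_iff_irreducible_map_fraction_map.1 hq
    have hdvd : ¬ q.map (algebraMap B L) ∣ u.map (algebraMap B L) := fun h =>
      hu (hprim.dvd_of_fraction_map_dvd_fraction_map h)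
    obtain ⟨α, β, h⟩ := (hirr.coprime_iff_not_dvd).2 hdvd
    obtain ⟨a, ha, ha'⟩ := IsLocalization.integerNormalization_spec (nonZeroDivisors B) α
    obtain ⟨b, hb, hb'⟩ := IsLocalization.integerNormalization_spec (nonZeroDivisors B) β
    refine ⟨a * b, Polynomial.C b * IsLocalization.integerNormalization (nonZeroDivisors B) α,
      Polynomial.C a * IsLocalization.integerNormalization (nonZeroDivisors B) β,
      mul_ne_zero (nonZeroDivisors.ne_zero ha) (nonZeroDivisors.ne_zero hb), ?_⟩
    apply Polynomial.map_injective (algebraMap B L) (IsFractionRing.injective _ _)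
    simp only [Polynomial.map_add, Polynomial.map_mul, Polynomial.map_C, ha', hb',
      Algebra.smul_def, Polynomial.algebraMap_apply, map_mul]
    linear_combination (-Polynomial.C ((algebraMap B L) a) * Polynomial.C ((algebraMap B L) b)) * h

theorem exists_elimination {B σ : Type*} [CommRing B] [IsDomain B]
    [UniqueFactorizationMonoid B] [Finite σ] {q u : MvPolynomial (Option σ) B}
    (hq : Irreducible q) (hu : ¬ q ∣ u) :
    ∃ (r : MvPolynomial σ B) (α β : MvPolynomial (Option σ) B),
      r ≠ 0 ∧ rename some r = α * q + β * u := by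
  let e := optionEquivLeft B σ
  obtain ⟨r, α, β, hr, h⟩ := exists_elimination_polynomial (q := e q) (u := e u)
    ((MulEquiv.irreducible_iff e).2 hq) (fun hd => hu (by
      have := map_dvd e.symm hd
      simpa using this))
  refine ⟨r, e.symm α, e.symm β, hr, ?_⟩
  apply e.injective
  rw [map_add, map_mul, map_mul, e.apply_symm_apply, e.apply_symm_apply, ← h]
  refine congrArg (fun f : MvPolynomial σ B →ₐ[B] _ => f r)
      (?_ : e.toAlgHom.comp (rename some) = (Algebra.ofId (MvPolynomial σ B)
        (Polynomial (MvPolynomial σ B))).restrictScalars B)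
  ext1 i
  simp [e, Algebra.ofId_apply]

section bounded
variable {A τ : Type*} [CommRing A] {G : DegreeFiltration A}

theorem IsBounded.mul {a b a' b' : ℕ} {p p' : MvPolynomial τ A} (h : IsBounded G a b p)
    (h' : IsBounded G a' b' p') : IsBounded G (a + a') (b + b') (p * p') := by
  classical
  refine ⟨(totalDegree_mul _ _).trans (add_le_add h.1 h'.1), fun m => ?_⟩
  rw [coeff_mul]
  exact sum_mem fun x _ => G.mul_mem (h.2 _) (h'.2 _)

theorem IsBounded.mono {a b a' b' : ℕ} {p : MvPolynomial τ A} (h : IsBounded G a b p)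
    (ha : a ≤ a') (hb : b ≤ b') : IsBounded G a' b' p :=
  ⟨h.1.trans ha, fun m => G.mem_of_le hb (h.2 m)⟩

theorem isBounded_zero (a b : ℕ) : IsBounded G a b (0 : MvPolynomial τ A) :=
  ⟨by simp, fun m => by simp [zero_mem]⟩

theorem IsBounded.add {a b : ℕ} {p p' : MvPolynomial τ A} (h : IsBounded G a b p)
    (h' : IsBounded G a b p') : IsBounded G a b (p + p') :=
  ⟨(totalDegree_add _ _).trans (max_le h.1 h'.1), fun m => by
    rw [coeff_add]; exact add_mem (h.2 m) (h'.2 m)⟩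

theorem IsBounded.neg {a b : ℕ} {p : MvPolynomial τ A} (h : IsBounded G a b p) :
    IsBounded G a b (-p) :=
  ⟨by simpa using h.1, fun m => by rw [coeff_neg]; exact neg_mem (h.2 m)⟩

theorem IsBounded.sum {ι : Type*} {s : Finset ι} {a b : ℕ} {p : ι → MvPolynomial τ A}
    (h : ∀ i ∈ s, IsBounded G a b (p i)) : IsBounded G a b (∑ i ∈ s, p i) := by
  classical
  induction s using Finset.induction_on with
  | empty => simpa using isBounded_zero a b
  | insert i s hi ih =>
    rw [Finset.sum_insert hi]
    exact (h i (Finset.mem_insert_self _ _)).add (ih fun j hj => h j (Finset.mem_insert_of_mem hj))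

theorem isBounded_C {b : ℕ} {x : A} (hx : x ∈ G.piece b) :
    IsBounded G 0 b (C x : MvPolynomial τ A) := by
  classical
  refine ⟨by simp, fun m => ?_⟩
  rw [coeff_C]; split_ifs
  exacts [hx, zero_mem _]

theorem isBounded_X (i : τ) : IsBounded G 1 0 (X i : MvPolynomial τ A) := by
  classical
  refine ⟨(totalDegree_monomial_le _ _).trans (by simp), fun m => ?_⟩
  rw [coeff_X]; split_ifs
  exacts [G.one_mem, zero_mem _]

variable (G τ) in
/-- The filtration of `A[τ]` by the maximum of the degree in `τ` and the degrees of the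
coefficients. -/
def boundedFiltration : DegreeFiltration (MvPolynomial τ A) where
  piece k :=
    { carrier := {p | IsBounded G k k p}
      zero_mem' := isBounded_zero _ _
      add_mem' := IsBounded.add
      neg_mem' := IsBounded.neg }
  mono := fun _ _ h _ hp => hp.mono h h
  one_mem := by
    change IsBounded G 0 0 (1 : MvPolynomial τ A)
    rw [← C_1]; exact isBounded_C G.one_mem
  mul_mem := IsBounded.mul

end bounded

/-- A ring homomorphism that maps the variables to elements of degree one and the coefficients of
`p` to elements of degree `e` raises the degree of `p` by at most `e`. -/
theorem map_mem_piece {ν B B' : Type*} [CommRing B] [CommRing B'] (H : DegreeFiltration B')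
    (Φ : MvPolynomial ν B →+* B') {e k : ℕ} (p : MvPolynomial ν B)
    (hC : ∀ m, Φ (C (p.coeff m)) ∈ H.piece e) (hX : ∀ i, Φ (X i) ∈ H.piece 1)
    (hp : p.totalDegree ≤ k) : Φ p ∈ H.piece (e + k) := by
  classical
  rw [p.as_sum, map_sum]
  refine sum_mem fun m hm => ?_
  rw [monomial_eq, map_mul, Finsupp.prod, map_prod]
  refine H.mul_mem (hC m) ?_
  have h1 := H.prod_mem m.support (fun i => Φ (X i ^ m i)) (fun i => m i) fun i _ => by
    rw [map_pow]; simpa using H.pow_mem (hX i) (m i)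
  refine H.mem_of_le ?_ h1
  exact (le_totalDegree hm).trans hp

/-- The fraction field of `A ⧸ (q)`, together with the map from `A`. -/
theorem exists_residueField {A : Type u} [CommRing A] [IsDomain A] {q : A} (hq : Prime q) :
    ∃ (F : Type u) (_ : Field F) (φ : A →+* F), (∀ a, φ a = 0 ↔ q ∣ a) ∧ HasFractions φ := by
  have hprime : (Ideal.span {q}).IsPrime := (Ideal.span_singleton_prime hq.ne_zero).2 hq
  have hinj := IsFractionRing.injective (A ⧸ Ideal.span {q}) (FractionRing (A ⧸ Ideal.span {q}))
  refine ⟨FractionRing (A ⧸ Ideal.span {q}), inferInstance,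
    (algebraMap (A ⧸ Ideal.span {q}) _).comp (Ideal.Quotient.mk _), fun a => ?_, fun x => ?_⟩
  · rw [← Ideal.mem_span_singleton, ← Ideal.Quotient.eq_zero_iff_mem]
    exact map_eq_zero_iff _ hinj
  · obtain ⟨a, b, hb, rfl⟩ := IsFractionRing.div_surjective (A := A ⧸ Ideal.span {q}) x
    obtain ⟨a, rfl⟩ := Ideal.Quotient.mk_surjective a
    obtain ⟨b, rfl⟩ := Ideal.Quotient.mk_surjective b
    have hb' : algebraMap (A ⧸ Ideal.span {q}) (FractionRing (A ⧸ Ideal.span {q}))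
        (Ideal.Quotient.mk _ b) ≠ 0 := fun h0 =>
      nonZeroDivisors.ne_zero hb ((map_eq_zero_iff _ hinj).1 h0)
    exact ⟨a, b, hb', mul_div_cancel₀ _ hb'⟩

/-- If `q * h` is in the ideal of the `f j`, and bounded multiples of `q` in this ideal can be divided
by `q`, then `h` is annihilated modulo the ideal by an element `u` not divisible by `q`. Indeed
`q * h` gives a syzygy modulo `q`, which up to `u` is a combination of bounded ones. -/
theorem exists_not_dvd_of_prime_mul_mem {A τ : Type*} [CommRing A] [IsDomain A] [Fintype τ]
    (G : DegreeFiltration A) {κ : Type} [Fintype κ] {d n : ℕ} (hd : 0 < d)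
    (hn : Fintype.card τ ≤ n) (f : κ → MvPolynomial τ A) (hf : ∀ j, IsBounded G d d (f j))
    {q : A} (hq : Prime q) (h : MvPolynomial τ A) (hqh : C q * h ∈ Ideal.span (Set.range f))
    (htors : ∀ t, C q * t ∈ Ideal.span (Set.range f) →
      IsBounded G (d + (3 * d) ^ 2 ^ n) (d + ((3 * d) ^ 2 ^ n + d + 1) ^ n * d) (C q * t) →
      t ∈ Ideal.span (Set.range f)) :
    ∃ u, ¬ q ∣ u ∧ C u * h ∈ Ideal.span (Set.range f) := by
  classical
  obtain ⟨F, _, φ, hφ0, hφ⟩ := exists_residueField hq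
  have hmap : ∀ p : MvPolynomial τ A, map φ p = 0 ↔ C q ∣ p := fun p =>
    (C_dvd_iff_map_hom_eq_zero φ q hφ0 p).symm
  have hCq : (C q : MvPolynomial τ A) ≠ 0 := by
    rw [Ne, C_eq_zero]; exact hq.ne_zero
  obtain ⟨g, hg⟩ := (Ideal.mem_span_range_iff_exists_fun).1 hqh
  obtain ⟨u, hu, g', hg', hgg'⟩ := exists_bounded_syzygies G φ hφ hd hn f hf g (by
    rw [hmap]
    refine ⟨h, ?_⟩
    rw [← hg]; exact Finset.sum_congr rfl fun _ _ => mul_comm _ _)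
  refine ⟨u, fun hdvd => hu ((hφ0 u).2 hdvd), ?_⟩
  -- combinations of bounded syzygies modulo `q` contribute `q` times elements of the ideal
  have hsum : ∃ t ∈ Ideal.span (Set.range f), ∑ j, f j * g' j = C q * t := by
    refine Submodule.span_induction (p := fun (z : κ → MvPolynomial τ A) _ =>
      ∃ t ∈ Ideal.span (Set.range f), ∑ j, f j * z j = C q * t) ?_ ?_ ?_ ?_ hg'
    · rintro s ⟨hs, hs'⟩
      obtain ⟨t, ht⟩ := (hmap _).1 hs'
      refine ⟨t, htors t ?_ ?_, ht⟩
      · rw [← ht]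
        exact Ideal.sum_mem _ fun j _ => Ideal.mul_mem_right _ _ (Ideal.subset_span ⟨j, rfl⟩)
      · rw [← ht]
        exact IsBounded.sum fun j _ => (hf j).mul (hs j)
    · exact ⟨0, Ideal.zero_mem _, by simp⟩
    · rintro x y _ _ ⟨t, ht, h1⟩ ⟨t', ht', h2⟩
      refine ⟨t + t', Ideal.add_mem _ ht ht', ?_⟩
      simp only [Pi.add_apply, mul_add, Finset.sum_add_distrib, h1, h2]
    · rintro a x _ ⟨t, ht, h1⟩
      refine ⟨a * t, Ideal.mul_mem_left _ _ ht, ?_⟩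
      rw [mul_left_comm, ← h1, Finset.mul_sum]
      exact Finset.sum_congr rfl fun j _ => by simp [mul_left_comm]
  obtain ⟨t, ht, hgt⟩ := hsum
  choose r hr using fun j => (hmap (C u * g j - g' j)).1 (by rw [map_sub, hgg' j, sub_self])
  have key : C q * (C u * h) = C q * (t + ∑ j, f j * r j) := by
    calc C q * (C u * h) = ∑ j, f j * (C u * g j) := by
          rw [mul_left_comm, ← hg, Finset.mul_sum]
          exact Finset.sum_congr rfl fun j _ => by ring
      _ = ∑ j, f j * (g' j + C q * r j) := by
          refine Finset.sum_congr rfl fun j _ => ?_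
          rw [← hr j]; ring
      _ = _ := by
          simp only [mul_add, Finset.sum_add_distrib, hgt, Finset.mul_sum]
          congr 1
          exact Finset.sum_congr rfl fun j _ => by ring
  rw [mul_left_cancel₀ hCq key]
  exact Ideal.add_mem _ ht
    (Ideal.sum_mem _ fun j _ => Ideal.mul_mem_right _ _ (Ideal.subset_span ⟨j, rfl⟩))


/-! ### Torsion-freeness over the polynomials in independent variables -/

section split
variable (K : Type*) {ν : Type*} [Field K] [DecidableEq ν] (s : Finset ν)

/-- Polynomials in all variables as polynomials in the variables outside `s`, over the polynomials
in the variables from `s`. -/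
noncomputable def splitEquiv :
    MvPolynomial ν K ≃ₐ[K] MvPolynomial {i // i ∉ s} (MvPolynomial {i // i ∈ s} K) :=
  (renameEquiv K ((Equiv.sumComm _ _).trans (Equiv.sumCompl (· ∈ s))).symm).trans
    (sumAlgEquiv K {i // i ∉ s} {i // i ∈ s})

theorem splitEquiv_symm_C (a : MvPolynomial {i // i ∈ s} K) :
    (splitEquiv K s).symm (C a) = rename Subtype.val a := by
  refine congrArg (fun f : MvPolynomial {i // i ∈ s} K →ₐ[K] MvPolynomial ν K => f a)
    (?_ : (splitEquiv K s).symm.toAlgHom.comp (Algebra.ofId (MvPolynomial {i // i ∈ s} K)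
      (MvPolynomial {i // i ∉ s} (MvPolynomial {i // i ∈ s} K)) |>.restrictScalars K) =
        rename Subtype.val)
  ext1 i
  simp [splitEquiv, Algebra.ofId_apply, MvPolynomial.algebraMap_eq]

theorem splitEquiv_symm_X (i : {i // i ∉ s}) :
    (splitEquiv K s).symm (X i) = X i.1 := by
  simp [splitEquiv]

theorem splitEquiv_rename (a : MvPolynomial {i // i ∈ s} K) :
    splitEquiv K s (rename Subtype.val a) = C a := by
  rw [← splitEquiv_symm_C, AlgEquiv.apply_symm_apply]

theorem splitEquiv_X_of_mem {i : ν} (hi : i ∈ s) : splitEquiv K s (X i) = C (X ⟨i, hi⟩) := by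
  rw [← splitEquiv_rename, rename_X]

theorem splitEquiv_X_of_notMem {i : ν} (hi : i ∉ s) : splitEquiv K s (X i) = X ⟨i, hi⟩ := by
  rw [← (splitEquiv K s).apply_symm_apply (X ⟨i, hi⟩), splitEquiv_symm_X]

theorem isBounded_splitEquiv {p : MvPolynomial ν K} {k : ℕ} (hp : p.totalDegree ≤ k) :
    IsBounded (totalDegreeFiltration {i // i ∈ s} K) k k (splitEquiv K s p) := by
  have h := map_mem_piece (boundedFiltration {i // i ∉ s} (totalDegreeFiltration {i // i ∈ s} K))
    (splitEquiv K s : _ →+* _) (e := 0) (k := k) p (fun m => ?_) (fun i => ?_) hp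
  · rwa [zero_add] at h
  · have : splitEquiv K s (C (p.coeff m)) = C (C (p.coeff m)) := (splitEquiv K s).commutes _
    rw [RingHom.coe_coe, this]
    exact isBounded_C (mem_totalDegreeFiltration.2 (by simp))
  · rw [RingHom.coe_coe]
    by_cases hi : i ∈ s
    · rw [splitEquiv_X_of_mem K s hi]
      exact (isBounded_C (mem_totalDegreeFiltration.2 (by simp))).mono (by simp) le_rfl
    · rw [splitEquiv_X_of_notMem K s hi]
      exact (isBounded_X _).mono le_rfl (by simp)

theorem totalDegree_splitEquiv_symm_le
    {p : MvPolynomial {i // i ∉ s} (MvPolynomial {i // i ∈ s} K)} {a b : ℕ}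
    (hp : IsBounded (totalDegreeFiltration {i // i ∈ s} K) a b p) :
    ((splitEquiv K s).symm p).totalDegree ≤ b + a := by
  refine map_mem_piece (totalDegreeFiltration ν K) ((splitEquiv K s).symm : _ →+* _) p
    (fun m => ?_) (fun i => ?_) hp.1
  · rw [RingHom.coe_coe, splitEquiv_symm_C]
    exact (totalDegree_rename_le _ _).trans (hp.2 m)
  · rw [RingHom.coe_coe, splitEquiv_symm_X, mem_totalDegreeFiltration]; simp

theorem splitEquiv_mem_span {κ : Type*} (f : κ → MvPolynomial ν K) (p : MvPolynomial ν K) :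
    splitEquiv K s p ∈ Ideal.span (Set.range fun j => splitEquiv K s (f j)) ↔
      p ∈ Ideal.span (Set.range f) := by
  have h : Ideal.span (Set.range fun j => splitEquiv K s (f j)) =
      (Ideal.span (Set.range f)).map (splitEquiv K s : _ →+* _) := by
    rw [Ideal.map_span, ← Set.range_comp]; rfl
  rw [h]
  refine (Ideal.mem_map_of_equiv (splitEquiv K s).toRingEquiv _).trans ⟨?_, fun hp => ⟨p, hp, rfl⟩⟩
  rintro ⟨y, hy, hyp⟩
  rwa [← (splitEquiv K s).injective hyp]

end split

/-- If the variables in `S` are independent modulo an ideal that is prime up to a sufficiently large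
degree, then the quotient is torsion-free over the polynomials in these variables. The induction is
on the set `s` of variables that occur in the polynomial `a`, and then on its prime factors. -/
theorem mem_of_rename_mul_mem {K : Type*} {ν : Type*} [Field K] [DecidableEq ν] [Fintype ν]
    {κ : Type} [Fintype κ] {d n N : ℕ} (hd : 0 < d) (hn : Fintype.card ν ≤ n)
    (f : κ → MvPolynomial ν K) (hf : ∀ j, (f j).totalDegree ≤ d) (S : Finset ν)
    (hS : ∀ a : MvPolynomial {i // i ∈ S} K,
      rename Subtype.val a ∈ Ideal.span (Set.range f) → a = 0)
    (hprime : IsPrimeUpTo (Ideal.span (Set.range f)) N)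
    (hN : d + ((3 * d) ^ 2 ^ n + d + 1) ^ n * d + (d + (3 * d) ^ 2 ^ n) ≤ N)
    (s : Finset ν) (hs : s ⊆ S) (a : MvPolynomial {i // i ∈ s} K) (ha : a ≠ 0)
    (h : MvPolynomial ν K) (hmem : rename Subtype.val a * h ∈ Ideal.span (Set.range f)) :
    h ∈ Ideal.span (Set.range f) := by
  induction s using Finset.induction_on generalizing h with
  | empty =>
    have : IsEmpty {i // i ∈ (∅ : Finset ν)} := ⟨fun i => absurd i.2 (Finset.notMem_empty _)⟩
    rw [eq_C_of_isEmpty a] at hmem ha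
    rw [rename_C] at hmem
    have hc : coeff 0 a ≠ 0 := fun h0 => ha (by rw [h0, map_zero])
    have := Ideal.mul_mem_left _ (C (coeff 0 a)⁻¹) hmem
    rwa [← mul_assoc, ← C_mul, inv_mul_cancel₀ hc, C_1, one_mul] at this
  | insert x s hx ih =>
    have hs' : s ⊆ S := fun i hi => hs (Finset.mem_insert_of_mem hi)
    induction a using UniqueFactorizationMonoid.induction_on_prime generalizing h with
    | h₁ => exact absurd rfl ha
    | h₂ a hu =>
      obtain ⟨b, hb⟩ := hu.exists_left_inv
      have := Ideal.mul_mem_left _ (rename Subtype.val b) hmem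
      rwa [← mul_assoc, ← map_mul, hb, map_one, one_mul] at this
    | h₃ a q ha0 hq iha =>
      rw [map_mul, mul_assoc] at hmem
      refine iha ha0 h ?_
      generalize rename Subtype.val a * h = h at hmem
      -- pass to polynomials over the coefficient ring in the variables of `insert x s`
      set e := splitEquiv K (insert x s) with he
      have hspan := splitEquiv_mem_span K (insert x s) f
      have hqI : rename Subtype.val q ∉ Ideal.span (Set.range f) := by
        intro hmem
        have h1 := hS (rename (fun i : {i // i ∈ insert x s} => (⟨i.1, hs i.2⟩ : {i // i ∈ S})) q)
          (by rw [rename_rename]; exact hmem)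
        refine hq.ne_zero (rename_injective _ (fun i j hij => ?_) (h1.trans (map_zero _).symm))
        exact Subtype.ext (congrArg (fun i : {i // i ∈ S} => i.1) hij)
      have hcard : Fintype.card {i // i ∉ insert x s} ≤ n := (Fintype.card_subtype_le _).trans hn
      obtain ⟨u, hqu, hu⟩ := exists_not_dvd_of_prime_mul_mem
        (totalDegreeFiltration {i // i ∈ insert x s} K) hd hcard (fun j => e (f j))
        (fun j => isBounded_splitEquiv K _ (hf j)) hq (e h)
        (by rw [← splitEquiv_rename, ← map_mul, hspan]; exact hmem)
        (by
          intro t ht htb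
          obtain ⟨t, rfl⟩ := e.surjective t
          rw [hspan]
          rw [← splitEquiv_rename, ← map_mul] at ht htb
          rw [hspan] at ht
          have hdeg := totalDegree_splitEquiv_symm_le K _ htb
          rw [AlgEquiv.symm_apply_apply] at hdeg
          by_cases ht0 : t = 0
          · rw [ht0]; exact Ideal.zero_mem _
          have hq0 : rename Subtype.val q ≠ (0 : MvPolynomial ν K) := fun h0 =>
            hqI (by rw [h0]; exact Ideal.zero_mem _)
          rw [totalDegree_mul_of_isDomain hq0 ht0] at hdeg
          exact (hprime _ _ (by omega) (by omega) ht).resolve_left hqI)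
      rw [← splitEquiv_rename, ← map_mul, hspan] at hu
      -- eliminate the variable `x` between `q` and `u`
      let ε : MvPolynomial {i // i ∈ insert x s} K ≃ₐ[K] MvPolynomial (Option {i // i ∈ s}) K :=
        renameEquiv K (Finset.subtypeInsertEquivOption hx)
      obtain ⟨r, α, β, hr, hrel⟩ := exists_elimination (q := ε q) (u := ε u)
        ((MulEquiv.irreducible_iff ε).2 hq.irreducible) (fun hd => hqu (by
          have := map_dvd ε.symm hd
          simpa using this))
      refine ih hs' r hr h ?_
      have h1 : rename Subtype.val r = rename Subtype.val (ε.symm α) * rename Subtype.val q +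
          rename Subtype.val (ε.symm β) * (rename Subtype.val u : MvPolynomial ν K) := by
        rw [← map_mul, ← map_mul, ← map_add]
        have h2 : ε.symm α * q + ε.symm β * u = ε.symm (rename some r) := by
          rw [hrel]; simp
        rw [h2]
        simp only [ε, renameEquiv_symm, renameEquiv_apply, rename_rename]
        rfl
      rw [h1, add_mul, mul_assoc, mul_assoc]
      exact Ideal.add_mem _ (Ideal.mul_mem_left _ _ hmem) (Ideal.mul_mem_left _ _ hu)


/-! ### Bounded algebraic relations -/

/-- The filtration of `A[T]` by the maximum of the degree in `T` and the degrees of the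
coefficients. -/
def polynomialFiltration {A : Type*} [CommRing A] (G : DegreeFiltration A) :
    DegreeFiltration (Polynomial A) where
  piece k :=
    { carrier := {p | p.natDegree ≤ k ∧ ∀ i, p.coeff i ∈ G.piece k}
      zero_mem' := by simp [zero_mem]
      add_mem' := fun ha hb => ⟨(Polynomial.natDegree_add_le _ _).trans (max_le ha.1 hb.1),
        fun i => by rw [Polynomial.coeff_add]; exact add_mem (ha.2 i) (hb.2 i)⟩
      neg_mem' := fun ha => ⟨by simpa using ha.1, fun i => by
        rw [Polynomial.coeff_neg]; exact neg_mem (ha.2 i)⟩ }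
  mono := fun _ _ h _ hp => ⟨hp.1.trans h, fun i => G.mem_of_le h (hp.2 i)⟩
  one_mem := by
    refine ⟨by simp, fun i => ?_⟩
    rw [Polynomial.coeff_one]; split_ifs
    exacts [G.one_mem, zero_mem _]
  mul_mem := fun ha hb => ⟨Polynomial.natDegree_mul_le.trans (add_le_add ha.1 hb.1), fun i => by
    rw [Polynomial.coeff_mul]
    exact sum_mem fun x _ => G.mul_mem (ha.2 _) (hb.2 _)⟩

theorem C_mem_polynomialFiltration {A : Type*} [CommRing A] {G : DegreeFiltration A} {k : ℕ}
    {a : A} (ha : a ∈ G.piece k) : Polynomial.C a ∈ (polynomialFiltration G).piece k := by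
  refine ⟨by simp, fun i => ?_⟩
  rw [Polynomial.coeff_C]; split_ifs
  exacts [ha, zero_mem _]

/-- If a bounded polynomial `U` is algebraic over `A` modulo the ideal of the `f j`, then it is a
root modulo this ideal of a nonzero polynomial of bounded degree with bounded coefficients. That
some nonzero `P ∈ A[T]` lies in the ideal generated by `T - U` and the `f j` means that this ideal
contains `1` over the fraction field of `A[T]`; so `P` can be taken to be the denominator of
`exists_bounded_membership`. -/
theorem exists_bounded_annihilator {A τ : Type*} [CommRing A] [IsDomain A] [Fintype τ]
    (G : DegreeFiltration A) {κ : Type} [Fintype κ] {d n : ℕ} (hd : 0 < d)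
    (hn : Fintype.card τ ≤ n) (f : κ → MvPolynomial τ A) (hf : ∀ j, IsBounded G d d (f j))
    (U : MvPolynomial τ A) (hU : IsBounded G d d U) (P₀ : Polynomial A) (hP₀ : P₀ ≠ 0)
    (hP₀U : Polynomial.aeval U P₀ ∈ Ideal.span (Set.range f)) :
    ∃ P : Polynomial A, P ≠ 0 ∧
      P ∈ (polynomialFiltration G).piece (((3 * d) ^ 2 ^ n + d + 1) ^ n * d) ∧
      Polynomial.aeval U P ∈ Ideal.span (Set.range f) := by
  classical
  let ι : MvPolynomial τ A →+* MvPolynomial τ (Polynomial A) := map Polynomial.C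
  let φ : Polynomial A →+* FractionRing (Polynomial A) := algebraMap _ _
  have hφ : Function.Injective φ := IsFractionRing.injective _ _
  let f' : Option κ → MvPolynomial τ (Polynomial A) := fun o =>
    o.elim (C Polynomial.X - ι U) fun j => ι (f j)
  have hι : ∀ p : MvPolynomial τ A, IsBounded G d d p →
      IsBounded (polynomialFiltration G) d d (ι p) := fun p hp =>
    ⟨(totalDegree_map_le _ _).trans hp.1, fun m => by
      rw [coeff_map]; exact C_mem_polynomialFiltration (hp.2 m)⟩
  have hX : (Polynomial.X : Polynomial A) ∈ (polynomialFiltration G).piece d := by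
    refine ⟨Polynomial.natDegree_X_le.trans hd, fun i => ?_⟩
    rw [Polynomial.coeff_X]; split_ifs
    exacts [G.mem_of_le (Nat.zero_le _) G.one_mem, zero_mem _]
  have hf' : ∀ o, IsBounded (polynomialFiltration G) d d (f' o) := by
    rintro (_ | j)
    · change IsBounded _ _ _ (_ - _)
      rw [sub_eq_add_neg]
      exact ((isBounded_C hX).mono (Nat.zero_le _) le_rfl).add (hι U hU).neg
    · exact hι _ (hf j)
  -- `P₀(T)` agrees with `P₀(U)` modulo `T - U`
  have hmem : (C P₀ : MvPolynomial τ (Polynomial A)) ∈ Ideal.span (Set.range f') := by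
    let Q : Polynomial (MvPolynomial τ (Polynomial A)) := P₀.map (ι.comp C)
    have h1 : Q.eval (C Polynomial.X) = C P₀ := by
      rw [Polynomial.eval_map]
      have : (ι.comp C : A →+* _) = (C : Polynomial A →+* MvPolynomial τ _).comp Polynomial.C := by
        ext a; simp [ι]
      rw [this, ← Polynomial.hom_eval₂, Polynomial.eval₂_C_X]
    have h2 : Q.eval (ι U) = ι (Polynomial.aeval U P₀) := by
      rw [Polynomial.eval_map, ← Polynomial.hom_eval₂]; rfl
    have h3 : ι (Polynomial.aeval U P₀) ∈ Ideal.span (Set.range f') := by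
      have := Ideal.mem_map_of_mem ι hP₀U
      rw [Ideal.map_span, ← Set.range_comp] at this
      refine Ideal.span_mono ?_ this
      rintro _ ⟨j, rfl⟩; exact ⟨some j, rfl⟩
    have h4 := Q.sub_dvd_eval_sub (C Polynomial.X) (ι U)
    rw [h1, h2] at h4
    have h5 : C P₀ - ι (Polynomial.aeval U P₀) ∈ Ideal.span (Set.range f') := by
      obtain ⟨w, hw⟩ := h4
      rw [hw]
      exact Ideal.mul_mem_right _ _ (Ideal.subset_span ⟨none, rfl⟩)
    simpa using Ideal.add_mem _ h5 h3
  obtain ⟨g, hg⟩ := (Ideal.mem_span_range_iff_exists_fun).1 hmem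
  have hφP : φ P₀ ≠ 0 := by
    rw [Ne, map_eq_zero_iff _ hφ]; exact hP₀
  obtain ⟨c, hc, hc0, t, ht⟩ := exists_bounded_membership (polynomialFiltration G) φ hd hn f' hf' 1
    (by
      rw [← C_1]
      exact (isBounded_C (polynomialFiltration G).one_mem).mono (Nat.zero_le _) (Nat.zero_le _))
    (fun o => C (φ P₀)⁻¹ * map φ (g o)) (by
      have := congrArg (map φ) hg
      rw [map_sum, map_C] at this
      calc _ = C (φ P₀)⁻¹ * ∑ o, map φ (g o * f' o) := by
            rw [Finset.mul_sum]
            exact Finset.sum_congr rfl fun o _ => by rw [map_mul]; ring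
        _ = _ := by rw [this, ← C_mul, inv_mul_cancel₀ hφP]; simp)
  rw [mul_one] at ht
  have ht' := map_injective φ hφ ht
  refine ⟨c, fun h => hc0 (by rw [h, map_zero]), hc, ?_⟩
  -- substitute `U` for the variable
  let Ψ : MvPolynomial τ (Polynomial A) →+* MvPolynomial τ A :=
    eval₂Hom (Polynomial.aeval U : Polynomial A →ₐ[A] MvPolynomial τ A).toRingHom X
  have hΨC : ∀ a, Ψ (C a) = Polynomial.aeval U a := fun a => by simp [Ψ]
  have hΨι : ∀ p, Ψ (ι p) = p := by
    intro p
    have : Ψ.comp ι = RingHom.id _ := by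
      ext1
      · ext a; simp [Ψ, ι]
      · simp [Ψ, ι]
    exact congrArg (fun F => F p) this
  rw [← hΨC, ← ht', Fintype.sum_option, map_add, map_sum]
  have h0 : Ψ (f' none) = 0 := by
    change Ψ (_ - _) = 0
    rw [map_sub, hΨC, hΨι, Polynomial.aeval_X, sub_self]
  rw [map_mul, h0, zero_mul, zero_add]
  refine Ideal.sum_mem _ fun j _ => ?_
  rw [map_mul]
  change Ψ (ι (f j)) * _ ∈ _
  rw [hΨι]
  exact Ideal.mul_mem_right _ _ (Ideal.subset_span ⟨j, rfl⟩)


/-! ### The generic linear combination of the variables -/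

/-- Some coefficient of a product is a product of nonzero coefficients. The coefficient ring may
have zero divisors. -/
theorem exists_coeff_mul_eq {σ R : Type*} [CommRing R] {f g : MvPolynomial σ R} (hf : f ≠ 0)
    (hg : g ≠ 0) : ∃ m l, f.coeff m ≠ 0 ∧ g.coeff l ≠ 0 ∧
      (f * g).coeff (m + l) = f.coeff m * g.coeff l := by
  classical
  obtain ⟨m, hm, l, hl, hu⟩ := UniqueSums.uniqueAdd_of_nonempty (G := σ →₀ ℕ)
    (support_nonempty.2 hf) (support_nonempty.2 hg)
  refine ⟨m, l, mem_support_iff.1 hm, mem_support_iff.1 hl, ?_⟩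
  rw [coeff_mul]
  refine Finset.sum_eq_single (m, l) ?_ ?_
  · rintro ⟨a, b⟩ hab hne
    rw [Finset.HasAntidiagonal.mem_antidiagonal] at hab
    by_contra h0
    have ha : a ∈ f.support := mem_support_iff.2 (left_ne_zero_of_mul h0)
    have hb : b ∈ g.support := mem_support_iff.2 (right_ne_zero_of_mul h0)
    obtain ⟨h1, h2⟩ := hu ha hb hab
    exact hne (by rw [h1, h2])
  · intro h; rw [Finset.HasAntidiagonal.mem_antidiagonal] at h; exact absurd rfl h

theorem totalDegree_pderiv_lt {σ R : Type*} [CommRing R] (i : σ) (f : MvPolynomial σ R)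
    (h : pderiv i f ≠ 0) : (pderiv i f).totalDegree < f.totalDegree := by
  classical
  have key : ∀ m, (pderiv i f).coeff m ≠ 0 → m.degree + 1 ≤ f.totalDegree := by
    intro m hm
    rw [coeff_pderiv] at hm
    have := totalDegree_le_iff.1 (le_refl f.totalDegree) _ (left_ne_zero_of_mul hm)
    rwa [map_add, Finsupp.degree_single] at this
  obtain ⟨m, hm⟩ := ne_zero_iff.1 h
  have h1 := key m hm
  have : (pderiv i f).totalDegree ≤ f.totalDegree - 1 :=
    totalDegree_le_iff.2 fun m hm => by have := key m hm; omega
  omega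

theorem coeff_mul_cast_eq_zero_of_pderiv_eq_zero {σ R : Type*} [CommRing R]
    {f : MvPolynomial σ R} {i : σ} (h : pderiv i f = 0) (m : σ →₀ ℕ) :
    f.coeff m * (m i : R) = 0 := by
  classical
  by_cases hm : m i = 0
  · rw [hm]; simp
  · have h1 := coeff_pderiv (i := i) f (m - Finsupp.single i 1)
    have h2 : m - Finsupp.single i 1 + Finsupp.single i 1 = m := by
      refine tsub_add_cancel_of_le ?_
      rw [Finsupp.single_le_iff]; omega
    rw [h2, h, coeff_zero] at h1
    have h3 : (((m - Finsupp.single i 1 : σ →₀ ℕ) i : ℕ) : R) + 1 = (m i : R) := by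
      rw [Finsupp.tsub_apply, Finsupp.single_eq_same]
      obtain ⟨k, hk⟩ := Nat.exists_eq_succ_of_ne_zero hm
      rw [hk]; simp
    rw [h3] at h1
    exact h1.symm

/-- In characteristic `p`, a polynomial with vanishing partial derivatives is a polynomial in the
`p`-th powers of the variables. -/
theorem exists_expand_of_pderiv_eq_zero {σ R : Type*} [CommRing R] [IsDomain R] (p : ℕ)
    [CharP R p] {f : MvPolynomial σ R} (h : ∀ i, pderiv i f = 0) : ∃ g, f = expand p g := by
  classical
  refine ⟨∑ m ∈ f.support, monomial (m.mapRange (· / p) (Nat.zero_div p)) (f.coeff m), ?_⟩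
  rw [map_sum]
  conv_lhs => rw [f.as_sum]
  refine Finset.sum_congr rfl fun m hm => ?_
  have : p • m.mapRange (· / p) (Nat.zero_div p) = m := by
    ext i
    have h1 := coeff_mul_cast_eq_zero_of_pderiv_eq_zero (h i) m
    have h2 := (CharP.cast_eq_zero_iff R p (m i)).1
      ((mul_eq_zero.1 h1).resolve_left (mem_support_iff.1 hm))
    simp [Nat.mul_div_cancel' h2]
  rw [expand_monomial, this]

/-- If `Q` is torsion-free over `A`, then `Q[τ]` is torsion-free over `A[τ]`. -/
theorem map_mul_eq_zero {A Q τ : Type*} [CommRing A] [CommRing Q] [Algebra A Q]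
    (htf : ∀ (a : A) (x : Q), a ≠ 0 → algebraMap A Q a * x = 0 → x = 0)
    {r : MvPolynomial τ A} (hr : r ≠ 0) {g : MvPolynomial τ Q}
    (h : map (algebraMap A Q) r * g = 0) : g = 0 := by
  by_contra hg
  by_cases hr' : map (algebraMap A Q) r = 0
  · obtain ⟨m, hm⟩ := ne_zero_iff.1 hr
    have := congrArg (coeff m) hr'
    rw [coeff_map, coeff_zero] at this
    have h1 : (1 : Q) = 0 := htf _ 1 hm (by rw [this, zero_mul])
    apply hg
    rw [← one_mul g, ← C_1, h1, C_0, zero_mul]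
  · obtain ⟨m, l, hm, hl, hml⟩ := exists_coeff_mul_eq hr' hg
    rw [h, coeff_zero, coeff_map] at hml
    rw [coeff_map] at hm
    exact hl (htf _ _ (fun h0 => hm (by rw [h0, map_zero])) hml.symm)

section generic
variable {A Q τ : Type*} [CommRing A] [CommRing Q] [Algebra A Q] [Fintype τ]

/-- The homomorphism from `A[s, T]` to `Q[s]` over `A[s]` that maps `T` to the generic linear
combination `∑ sᵢ yᵢ`. The variable `T` is `X none`. -/
noncomputable def genericEval (y : τ → Q) : MvPolynomial (Option τ) A →+* MvPolynomial τ Q :=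
  eval₂Hom (C.comp (algebraMap A Q)) fun o => o.elim (∑ i, X i * C (y i)) X

variable (y : τ → Q)

theorem genericEval_C (a : A) : genericEval y (C a : MvPolynomial (Option τ) A) =
    C (algebraMap A Q a) := by simp [genericEval]

theorem genericEval_X_some (i : τ) :
    genericEval y (X (some i) : MvPolynomial (Option τ) A) = X i := by simp [genericEval]

theorem genericEval_X_none :
    genericEval y (X none : MvPolynomial (Option τ) A) = ∑ i, X i * C (y i) := by
  simp [genericEval]

theorem genericEval_rename (r : MvPolynomial τ A) :
    genericEval y (rename some r) = map (algebraMap A Q) r := by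
  have : (genericEval y).comp (rename some : MvPolynomial τ A →ₐ[A] _).toRingHom =
      map (algebraMap A Q) := by
    ext1
    · ext a; simp [genericEval_C]
    · simp [genericEval_X_some]
  exact RingHom.congr_fun this r

/-- The chain rule for `h(s, ∑ sᵢ yᵢ)`. -/
theorem pderiv_genericEval (i : τ) (h : MvPolynomial (Option τ) A) :
    pderiv i (genericEval y h) = genericEval y (pderiv (some i) h) +
      genericEval y (pderiv none h) * C (y i) := by
  classical
  induction h using MvPolynomial.induction_on with
  | C a => simp [genericEval_C]
  | add p q hp hq => simp only [map_add, hp, hq]; ring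
  | mul_X p o hp =>
    have hX : pderiv i (genericEval y (X o : MvPolynomial (Option τ) A)) =
        genericEval y (pderiv (some i) (X o : MvPolynomial (Option τ) A)) +
          genericEval y (pderiv none (X o : MvPolynomial (Option τ) A)) * C (y i) := by
      rcases o with _ | j
      · rw [genericEval_X_none, pderiv_X_self, pderiv_X_of_ne (by simp), map_sum]
        simp only [pderiv_mul, pderiv_C, mul_zero, add_zero, map_zero, map_one, one_mul, zero_add]
        rw [Finset.sum_eq_single i]
        · rw [pderiv_X_self, one_mul]
        · intro j _ hj; rw [pderiv_X_of_ne hj, zero_mul]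
        · intro h; exact absurd (Finset.mem_univ _) h
      · rw [genericEval_X_some, pderiv_X_of_ne (i := none) (by simp), map_zero, zero_mul, add_zero,
          pderiv_X, pderiv_X, Pi.single_apply, Pi.single_apply]
        by_cases hij : j = i
        · subst hij; simp
        · rw [if_neg (by simpa [eq_comm] using hij), if_neg (by simpa [eq_comm] using hij),
            map_zero]
    simp only [map_mul, pderiv_mul, map_add, hp, hX]
    ring

variable [IsDomain A]

variable [UniqueFactorizationMonoid A]
  (htf : ∀ (a : A) (x : Q), a ≠ 0 → algebraMap A Q a * x = 0 → x = 0)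
  {ρ : MvPolynomial (Option τ) A} (hρ : Irreducible ρ) (hρ0 : genericEval y ρ = 0)

include htf hρ hρ0 in
/-- If `ρ` is an irreducible relation for the generic combination, then a polynomial in the generic
combination is a multiple of `ρ`, or its value is regular, as `T` can be eliminated against `ρ`. -/
theorem dvd_or_regular_genericEval (h : MvPolynomial (Option τ) A) :
    ρ ∣ h ∨ ∀ x, genericEval y h * x = 0 → x = 0 := by
  by_cases hd : ρ ∣ h
  · exact Or.inl hd
  · refine Or.inr fun x hx => ?_
    obtain ⟨r, α, β, hr, hrel⟩ := exists_elimination hρ hd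
    have h1 := congrArg (genericEval y) hrel
    rw [genericEval_rename, map_add, map_mul, map_mul, hρ0, mul_zero, zero_add] at h1
    refine map_mul_eq_zero htf hr ?_
    rw [h1, mul_assoc, hx, mul_zero]

include htf hρ hρ0 in
/-- If the irreducible relation `ρ` is separable in `T`, then every element of `A[y]` is zero or
regular: a power of the value of `∂ρ/∂T` times this element is a polynomial in the generic
combination, because the value of `∂ρ/∂T` times `yᵢ` is minus that of `∂ρ/∂sᵢ`. -/
theorem eq_zero_or_regular_of_separable (hsep : genericEval y (pderiv none ρ) ≠ 0)
    (p : MvPolynomial τ A) :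
    aeval y p = 0 ∨ ∀ x, aeval y p * x = 0 → x = 0 := by
  set δ := genericEval y (pderiv none ρ) with hδ
  have hδreg : ∀ x, δ * x = 0 → x = 0 := by
    refine (dvd_or_regular_genericEval y htf hρ hρ0 (pderiv none ρ)).resolve_left ?_
    rintro ⟨w, hw⟩
    apply hsep
    rw [hδ, hw, map_mul, hρ0, zero_mul]
  have hδy : ∀ i, δ * C (y i) = genericEval y (-pderiv (some i) ρ) := by
    intro i
    have := pderiv_genericEval y i ρ
    rw [hρ0, map_zero] at this
    rw [map_neg, eq_neg_iff_add_eq_zero, add_comm]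
    exact this.symm
  -- multiply by a power of `δ` that clears all the `yᵢ`
  have hpow : ∃ (k : ℕ) (h : MvPolynomial (Option τ) A),
      δ ^ k * C (aeval y p) = genericEval y h := by
    induction p using MvPolynomial.induction_on with
    | C a => exact ⟨0, C a, by simp [genericEval_C]⟩
    | add p q hp hq =>
      obtain ⟨k, h, hk⟩ := hp
      obtain ⟨l, g, hl⟩ := hq
      refine ⟨k + l, pderiv none ρ ^ l * h + pderiv none ρ ^ k * g, ?_⟩
      rw [map_add, C_add, map_add, map_mul, map_mul, map_pow, map_pow, ← hk, ← hl, ← hδ]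
      ring
    | mul_X p i hp =>
      obtain ⟨k, h, hk⟩ := hp
      refine ⟨k + 1, h * -pderiv (some i) ρ, ?_⟩
      rw [map_mul (genericEval y), ← hk, ← hδy, map_mul (aeval y), aeval_X, C_mul]
      ring
  obtain ⟨k, h, hk⟩ := hpow
  have hδk : ∀ (k : ℕ) x, δ ^ k * x = 0 → x = 0 := by
    intro k
    induction k with
    | zero => intro x hx; simpa using hx
    | succ k ih => intro x hx; rw [pow_succ, mul_assoc] at hx; exact hδreg _ (ih _ hx)
  rcases dvd_or_regular_genericEval y htf hρ hρ0 h with ⟨w, hw⟩ | hreg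
  · left
    rw [hw, map_mul, hρ0, zero_mul] at hk
    exact C_injective _ _ ((hδk k _ hk).trans C_0.symm)
  · right
    intro x hx
    have : genericEval y h * C x = 0 := by
      rw [← hk, mul_assoc, ← C_mul, hx, C_0, mul_zero]
    exact C_injective _ _ ((hreg _ this).trans C_0.symm)

end generic

/-- The generic combination of suitable `p ^ e`-th powers of the `yᵢ` satisfies a separable
irreducible relation. If the relation `π` is not separable, then all its partial derivatives vanish
at the generic combination, hence they are zero by their degrees, so that `π` is a polynomial in
`p`-th powers. -/
theorem exists_separable_generic {A Q τ : Type*} [CommRing A] [CommRing Q] [Algebra A Q]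
    [Fintype τ] [IsDomain A] [UniqueFactorizationMonoid A] [Nontrivial Q] (p : ℕ) [ExpChar A p]
    (htf : ∀ (a : A) (x : Q), a ≠ 0 → algebraMap A Q a * x = 0 → x = 0) (y : τ → Q)
    (π : MvPolynomial (Option τ) A) (hπ : Irreducible π) (hπ0 : genericEval y π = 0) :
    ∃ (e : ℕ) (ρ : MvPolynomial (Option τ) A), p ^ e ≤ π.totalDegree ∧ Irreducible ρ ∧
      genericEval (fun i => y i ^ p ^ e) ρ = 0 ∧
      genericEval (fun i => y i ^ p ^ e) (pderiv none ρ) ≠ 0 := by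
  obtain ⟨n, hn⟩ : ∃ n, n = π.totalDegree := ⟨_, rfl⟩
  induction n using Nat.strong_induction_on generalizing π y with
  | _ n ih =>
  have hinj : Function.Injective (algebraMap A Q) := by
    rw [injective_iff_map_eq_zero]
    intro a ha
    by_contra h0
    exact one_ne_zero (htf a 1 h0 (by rw [ha, zero_mul]))
  have hdeg : π.totalDegree ≠ 0 := by
    intro h0
    rw [totalDegree_eq_zero_iff_eq_C] at h0
    rw [h0, genericEval_C, C_eq_zero, map_eq_zero_iff _ hinj] at hπ0
    rw [hπ0, C_0] at h0
    exact hπ.ne_zero h0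
  by_cases hsep : genericEval y (pderiv none π) ≠ 0
  · exact ⟨0, π, by simp; omega, hπ, by simpa using hπ0, by simpa using hsep⟩
  rw [not_not] at hsep
  have hdvd : ∀ h, genericEval y h = 0 → π ∣ h := by
    intro h h0
    refine (dvd_or_regular_genericEval y htf hπ hπ0 h).resolve_right fun hreg => ?_
    exact one_ne_zero (hreg 1 (by rw [h0, zero_mul]))
  -- the derivatives are multiples of `π` of smaller degree
  have hder : ∀ o, pderiv o π = 0 := by
    intro o
    have h1 : π ∣ pderiv o π := by
      rcases o with _ | i
      · exact hdvd _ hsep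
      · refine hdvd _ ?_
        have := pderiv_genericEval y i π
        rwa [hπ0, map_zero, hsep, zero_mul, add_zero, eq_comm] at this
    by_contra h0
    obtain ⟨w, hw⟩ := h1
    have h2 := totalDegree_pderiv_lt o π h0
    rw [hw] at h0 h2
    rw [totalDegree_mul_of_isDomain hπ.ne_zero (right_ne_zero_of_mul h0)] at h2
    omega
  rcases ‹ExpChar A p› with _ | hp
  · -- in characteristic zero a polynomial with vanishing derivatives is constant
    exfalso
    apply hdeg
    have : π.totalDegree ≤ 0 := by
      rw [totalDegree_le_iff]
      intro m hm
      have : m = 0 := by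
        ext o
        have h1 := coeff_mul_cast_eq_zero_of_pderiv_eq_zero (hder o) m
        exact_mod_cast (mul_eq_zero.1 h1).resolve_left hm
      simp [this]
    omega
  · have : Fact p.Prime := ⟨hp⟩
    have : CharP Q p := charP_of_injective_algebraMap hinj p
    obtain ⟨ρ, rfl⟩ := exists_expand_of_pderiv_eq_zero p hder
    have hρ : Irreducible ρ := MvPolynomial.of_irreducible_expand _ hp.ne_zero hπ
    have hcomm : (genericEval y).comp (expand p : MvPolynomial (Option τ) A →ₐ[A] _).toRingHom =
        (expand p : MvPolynomial τ Q →ₐ[Q] _).toRingHom.comp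
          (genericEval (fun i => y i ^ p)) := by
      refine MvPolynomial.ringHom_ext (fun a => by simp [genericEval_C]) ?_
      rintro (_ | i)
      · simp [genericEval_X_none, sum_pow_char, mul_pow]
      · simp [genericEval_X_some]
    have hρ0 : genericEval (fun i => y i ^ p) ρ = 0 := by
      have := RingHom.congr_fun hcomm ρ
      change genericEval y (expand p ρ) = expand p (genericEval (fun i => y i ^ p) ρ) at this
      rw [hπ0] at this
      exact (expand_eq_zero hp.pos).1 this.symm
    rw [totalDegree_expand] at hn hdeg ⊢
    have hlt : ρ.totalDegree < n := by
      rw [hn]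
      have := hp.two_le
      have : 0 < ρ.totalDegree := Nat.pos_of_ne_zero fun h => hdeg (by rw [h, zero_mul])
      nlinarith
    obtain ⟨e, ρ', he, h1, h2, h3⟩ := ih _ hlt (fun i => y i ^ p) ρ hρ hρ0 rfl
    refine ⟨e + 1, ρ', ?_, h1, ?_, ?_⟩
    · rw [pow_succ]; exact Nat.mul_le_mul_right p he
    · rw [pow_succ']; simpa only [← pow_mul] using h2
    · rw [pow_succ']; simpa only [← pow_mul] using h3


/-! ### A bounded irreducible relation for the generic combination -/

section joint
variable {K σ τ : Type*} [Field K]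

theorem totalDegree_sumAlgEquiv_symm_le {p : MvPolynomial τ (MvPolynomial σ K)} {a b : ℕ}
    (hp : IsBounded (totalDegreeFiltration σ K) a b p) :
    ((sumAlgEquiv K τ σ).symm p).totalDegree ≤ b + a := by
  refine map_mem_piece (totalDegreeFiltration (τ ⊕ σ) K) ((sumAlgEquiv K τ σ).symm : _ →+* _) p
    (fun m => ?_) (fun i => ?_) hp.1
  · have : (sumAlgEquiv K τ σ).symm (C (p.coeff m)) = rename Sum.inr (p.coeff m) := by
      rw [AlgEquiv.symm_apply_eq]
      exact (DFunLike.congr_fun (sumAlgEquiv_comp_rename_inr (R := K) (S₁ := τ) (S₂ := σ)) _).symm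
    rw [RingHom.coe_coe, this]
    exact (totalDegree_rename_le _ _).trans (hp.2 m)
  · rw [RingHom.coe_coe, sumAlgEquiv_symm_X, mem_totalDegreeFiltration]; simp

theorem totalDegree_sumAlgEquiv_le (w : MvPolynomial (τ ⊕ σ) K) :
    (sumAlgEquiv K τ σ w).totalDegree ≤ w.totalDegree := by
  have := map_mem_piece (totalDegreeFiltration τ (MvPolynomial σ K))
    (sumAlgEquiv K τ σ : _ →+* _) (e := 0) w (fun m => ?_) (fun i => ?_) le_rfl
  · rwa [zero_add] at this
  · rw [RingHom.coe_coe, sumAlgEquiv_C_inl, mem_totalDegreeFiltration]; simp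
  · rw [RingHom.coe_coe, mem_totalDegreeFiltration]
    rcases i with i | i
    · rw [sumAlgEquiv_X_inl]; simp
    · rw [sumAlgEquiv_X_inr]; simp

/-- The coefficients in `s` of `w(s, ∑ sᵢ Xᵢ)` have degrees bounded by the total degree of `w`, both
in the variables in `τ` and in those in `σ`. -/
theorem isBounded_coeff_genericEval [Fintype τ] {w : MvPolynomial (Option τ ⊕ σ) K} {k : ℕ}
    (hw : w.totalDegree ≤ k) (m : τ →₀ ℕ) :
    IsBounded (totalDegreeFiltration σ K) k k
      ((genericEval X (sumAlgEquiv K (Option τ) σ w) :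
        MvPolynomial τ (MvPolynomial τ (MvPolynomial σ K))).coeff m) := by
  have := map_mem_piece (boundedFiltration τ (boundedFiltration τ (totalDegreeFiltration σ K)))
    ((genericEval (A := MvPolynomial σ K) (Q := MvPolynomial τ (MvPolynomial σ K)) X).comp
      (sumAlgEquiv K (Option τ) σ : MvPolynomial (Option τ ⊕ σ) K →+* _)) (e := 0) w
      (fun m => ?_) (fun i => ?_) hw
  · rw [zero_add] at this; exact this.2 m
  · rw [RingHom.comp_apply, RingHom.coe_coe, sumAlgEquiv_C_inl, genericEval_C]
    exact isBounded_C (isBounded_C (mem_totalDegreeFiltration.2 (by simp)))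
  · rw [RingHom.comp_apply, RingHom.coe_coe]
    rcases i with (_ | i) | i
    · rw [sumAlgEquiv_X_inl, genericEval_X_none]
      exact sum_mem fun i _ => ((isBounded_X i).mul (isBounded_C (b := 1)
        ((isBounded_X i).mono le_rfl zero_le_one))).mono (by simp) (by simp)
    · rw [sumAlgEquiv_X_inl, genericEval_X_some]
      exact (isBounded_X _).mono le_rfl zero_le_one
    · rw [sumAlgEquiv_X_inr, genericEval_C]
      exact (isBounded_C ((isBounded_C (b := 1) (mem_totalDegreeFiltration.2 (by simp))).mono
        zero_le_one le_rfl)).mono zero_le_one le_rfl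

end joint

theorem map_genericEval {A Q Q' τ : Type*} [CommRing A] [CommRing Q] [CommRing Q'] [Algebra A Q]
    [Algebra A Q'] [Fintype τ] (g : Q →ₐ[A] Q') (y : τ → Q) (h : MvPolynomial (Option τ) A) :
    map (g : Q →+* Q') (genericEval y h) = genericEval (fun i => g (y i)) h := by
  have : (map (g : Q →+* Q')).comp (genericEval y) = genericEval (A := A) (fun i => g (y i)) := by
    refine MvPolynomial.ringHom_ext (fun a => by simp [genericEval_C]) ?_
    rintro (_ | i)
    · simp [genericEval_X_none]
    · simp [genericEval_X_some]
  exact RingHom.congr_fun this h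

/-- If the ideal `I` is prime with respect to the coefficients in `s` of two polynomials in the
generic combination, and the product of the two vanishes modulo `I`, then one of them does. -/
theorem genericEval_eq_zero_or {A τ : Type*} [CommRing A] [Fintype τ]
    (I : Ideal (MvPolynomial τ A)) (h h' : MvPolynomial (Option τ) A)
    (hI : ∀ m l, (genericEval (Q := MvPolynomial τ A) X h).coeff m *
      (genericEval (Q := MvPolynomial τ A) X h').coeff l ∈ I →
      (genericEval (Q := MvPolynomial τ A) X h).coeff m ∈ I ∨
      (genericEval (Q := MvPolynomial τ A) X h').coeff l ∈ I)
    (h0 : genericEval (fun i => Ideal.Quotient.mk I (X i)) h *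
      genericEval (fun i => Ideal.Quotient.mk I (X i)) h' = 0) :
    genericEval (fun i => Ideal.Quotient.mk I (X i)) h = 0 ∨
      genericEval (fun i => Ideal.Quotient.mk I (X i)) h' = 0 := by
  have key : ∀ w : MvPolynomial (Option τ) A,
      genericEval (fun i => Ideal.Quotient.mk I (X i)) w =
        map (Ideal.Quotient.mk I) (genericEval X w) := fun w =>
    (map_genericEval (Ideal.Quotient.mkₐ A I) X w).symm
  rw [key, key] at h0 ⊢
  by_contra! hne
  obtain ⟨m, l, hm, hl, hml⟩ := exists_coeff_mul_eq hne.1 hne.2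
  rw [h0, coeff_zero, coeff_map, coeff_map, ← map_mul, eq_comm,
    Ideal.Quotient.eq_zero_iff_mem] at hml
  rw [coeff_map, Ne, Ideal.Quotient.eq_zero_iff_mem] at hm hl
  rcases hI m l hml with h | h
  exacts [hm h, hl h]

/-- A bounded relation for the generic combination has an irreducible factor which is also a
relation, provided that the ideal is prime up to the corresponding degree. -/
theorem exists_irreducible_generic {K σ τ : Type*} [Field K] [Fintype τ]
    (I : Ideal (MvPolynomial τ (MvPolynomial σ K))) (hI : I ≠ ⊤) {k : ℕ}
    (hI' : ∀ g h, IsBounded (totalDegreeFiltration σ K) k k g →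
      IsBounded (totalDegreeFiltration σ K) k k h → g * h ∈ I → g ∈ I ∨ h ∈ I)
    (w : MvPolynomial (Option τ ⊕ σ) K) (hw0 : w ≠ 0) (hw : w.totalDegree ≤ k)
    (hwI : genericEval (fun i => Ideal.Quotient.mk I (X i)) (sumAlgEquiv K (Option τ) σ w) = 0) :
    ∃ π : MvPolynomial (Option τ) (MvPolynomial σ K), Irreducible π ∧ π.totalDegree ≤ k ∧
      genericEval (fun i => Ideal.Quotient.mk I (X i)) π = 0 := by
  have : Nontrivial (MvPolynomial τ (MvPolynomial σ K) ⧸ I) := Ideal.Quotient.nontrivial_iff.2 hI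
  induction w using UniqueFactorizationMonoid.induction_on_prime with
  | h₁ => exact absurd rfl hw0
  | h₂ w hu =>
    have h1 := (hu.map (sumAlgEquiv K (Option τ) σ)).map
      (genericEval fun i => Ideal.Quotient.mk I (X i))
    rw [hwI] at h1
    exact absurd h1 not_isUnit_zero
  | h₃ w q hw1 hq ih =>
    rw [totalDegree_mul_of_isDomain hq.ne_zero hw1] at hw
    have h2 := genericEval_eq_zero_or I (sumAlgEquiv K (Option τ) σ q)
      (sumAlgEquiv K (Option τ) σ w) (fun m l => hI' _ _
        (isBounded_coeff_genericEval (by omega) m) (isBounded_coeff_genericEval (by omega) l))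
      (by rw [← map_mul, ← map_mul]; exact hwI)
    rcases h2 with h2 | h2
    · exact ⟨_, (MulEquiv.irreducible_iff (sumAlgEquiv K (Option τ) σ)).2 hq.irreducible,
        (totalDegree_sumAlgEquiv_le _).trans (by omega), h2⟩
    · exact ih hw1 (by omega) h2

theorem isAlgebraic_sum_algebraMap_mul {A B τ : Type*} [CommRing A] [IsDomain A] [CommRing B]
    [Algebra A B] (s : Finset τ) (c : τ → A) (y : τ → B) (h : ∀ i, IsAlgebraic A (y i)) :
    IsAlgebraic A (∑ i ∈ s, algebraMap A B (c i) * y i) := by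
  classical
  induction s using Finset.induction_on with
  | empty => simpa using isAlgebraic_zero
  | insert i s hi ih =>
    rw [Finset.sum_insert hi]
    exact ((isAlgebraic_algebraMap (c i)).mul (h i)).add ih

theorem exists_annihilator_sum {A τ : Type*} [CommRing A] [IsDomain A] [Fintype τ]
    (I : Ideal (MvPolynomial τ A)) (h : ∀ i, ∃ P : Polynomial A, P ≠ 0 ∧
      Polynomial.aeval (X i : MvPolynomial τ A) P ∈ I) (c : τ → A) :
    ∃ P : Polynomial A, P ≠ 0 ∧ Polynomial.aeval (∑ i, C (c i) * X i : MvPolynomial τ A) P ∈ I := by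
  have key : ∀ (u : MvPolynomial τ A) (P : Polynomial A),
      Polynomial.aeval (Ideal.Quotient.mk I u) P = 0 ↔ Polynomial.aeval u P ∈ I := by
    intro u P
    rw [← Ideal.Quotient.eq_zero_iff_mem]
    exact (congrArg (· = 0) (Polynomial.aeval_algHom_apply (Ideal.Quotient.mkₐ A I) u P)).to_iff
  have h1 := isAlgebraic_sum_algebraMap_mul Finset.univ c
    (fun i => Ideal.Quotient.mk I (X i : MvPolynomial τ A)) fun i => by
      obtain ⟨P, hP, hPi⟩ := h i
      exact ⟨P, hP, (key _ _).2 hPi⟩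
  obtain ⟨P, hP, hPc⟩ := h1
  refine ⟨P, hP, (key _ _).1 ?_⟩
  rw [← hPc, map_sum]
  congr 1

theorem genericEval_optionEquivLeft_symm {A Q τ : Type*} [CommRing A] [CommRing Q] [Algebra A Q]
    [Fintype τ] (y : τ → Q) (P : Polynomial (MvPolynomial τ A)) :
    genericEval y ((optionEquivLeft A τ).symm P) =
      eval₂Hom (map (algebraMap A Q)) (fun i => C (y i)) (Polynomial.aeval
        (∑ i, C (X i) * X i : MvPolynomial τ (MvPolynomial τ A)) P) := by
  have hcomp : (genericEval y).comp
        ((optionEquivLeft A τ).symm : Polynomial (MvPolynomial τ A) →+* MvPolynomial (Option τ) A) =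
      (eval₂Hom (map (algebraMap A Q)) fun i => C (y i)).comp (Polynomial.aeval
        (∑ i, C (X i) * X i : MvPolynomial τ (MvPolynomial τ A)) :
          Polynomial (MvPolynomial τ A) →ₐ[MvPolynomial τ A] _).toRingHom := by
    refine Polynomial.ringHom_ext' (MvPolynomial.ringHom_ext (fun a => ?_) fun i => ?_) ?_
    · simp [genericEval_C]
    · simp [genericEval_X_some]
    · simp [genericEval_X_none]
  exact RingHom.congr_fun hcomp P

/-- If all variables are algebraic over `A` modulo the ideal of the `f j`, then the generic
combination of them satisfies a bounded nonzero relation. This is `exists_bounded_annihilator` over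
`A[s]`. -/
theorem exists_bounded_generic {A τ : Type*} [CommRing A] [IsDomain A] [Fintype τ]
    (G : DegreeFiltration A) {κ : Type} [Fintype κ] {d n : ℕ} (hd : 0 < d)
    (hn : Fintype.card τ ≤ n) (f : κ → MvPolynomial τ A) (hf : ∀ j, IsBounded G d d (f j))
    (halg : ∀ i, ∃ P : Polynomial A, P ≠ 0 ∧
      Polynomial.aeval (X i : MvPolynomial τ A) P ∈ Ideal.span (Set.range f)) :
    ∃ h : MvPolynomial (Option τ) A, h ≠ 0 ∧ IsBounded G
      (2 * (((3 * d) ^ 2 ^ n + d + 1) ^ n * d)) (((3 * d) ^ 2 ^ n + d + 1) ^ n * d) h ∧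
      genericEval (fun i => Ideal.Quotient.mk (Ideal.span (Set.range f)) (X i)) h = 0 := by
  classical
  let f' : κ → MvPolynomial τ (MvPolynomial τ A) := fun j => map C (f j)
  let U : MvPolynomial τ (MvPolynomial τ A) := ∑ i, C (X i) * X i
  let J := Ideal.span (Set.range f')
  have hf' : ∀ j, IsBounded (boundedFiltration τ G) d d (f' j) := fun j =>
    ⟨(totalDegree_map_le _ _).trans (hf j).1, fun m => by
      rw [coeff_map]; exact (isBounded_C ((hf j).2 m)).mono (Nat.zero_le _) le_rfl⟩
  have hU : IsBounded (boundedFiltration τ G) d d U := IsBounded.sum fun i _ =>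
    ((isBounded_C (b := 1) ((isBounded_X i).mono le_rfl zero_le_one)).mul
      (isBounded_X i)).mono (by omega) (by omega)
  obtain ⟨P₀, hP₀, hP₀U⟩ := exists_annihilator_sum J (fun i => by
    obtain ⟨P, hP, hPi⟩ := halg i
    refine ⟨P.map C, (Polynomial.map_ne_zero_iff (C_injective _ _)).2 hP, ?_⟩
    have h1 : Polynomial.aeval (X i : MvPolynomial τ (MvPolynomial τ A)) 
          (P.map (C : A →+* MvPolynomial τ A)) =
          map C (Polynomial.aeval (X i : MvPolynomial τ A) P) := by
      rw [Polynomial.aeval_def, Polynomial.eval₂_map, Polynomial.aeval_def, Polynomial.hom_eval₂,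
        map_X]
      congr 1
      ext a : 1
      rw [RingHom.comp_apply, RingHom.comp_apply, MvPolynomial.algebraMap_eq,
        MvPolynomial.algebraMap_eq, map_C]
    rw [h1]
    have h2 := Ideal.mem_map_of_mem (map (C : A →+* MvPolynomial τ A)) hPi
    rwa [Ideal.map_span, ← Set.range_comp] at h2) X
  obtain ⟨P, hP, hPb, hPU⟩ := exists_bounded_annihilator (boundedFiltration τ G) hd hn f' hf' U hU
    P₀ hP₀ hP₀U
  set N := ((3 * d) ^ 2 ^ n + d + 1) ^ n * d with hN
  refine ⟨(optionEquivLeft A τ).symm P, ?_, ?_, ?_⟩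
  · simpa using hP
  · rw [P.as_sum_range_C_mul_X_pow, map_sum]
    refine IsBounded.sum fun i hi => ?_
    rw [map_mul, map_pow, optionEquivLeft_symm_X]
    have hi' : i ≤ N := by
      have := hPb.1
      rw [Finset.mem_range] at hi; omega
    have h1 : (optionEquivLeft A τ).symm (Polynomial.C (P.coeff i)) =
        rename some (P.coeff i) := by
      rw [AlgEquiv.symm_apply_eq]
      have : ((optionEquivLeft A τ).toAlgHom.comp (rename some) :
        MvPolynomial τ A →ₐ[A] Polynomial (MvPolynomial τ A)) =
          (Algebra.ofId (MvPolynomial τ A) (Polynomial (MvPolynomial τ A))).restrictScalars A := by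
        ext1 i; simp [optionEquivLeft_X_some, Algebra.ofId_apply]
      exact (DFunLike.congr_fun this (P.coeff i)).symm
    have h2 : IsBounded G N N (rename some (P.coeff i) : MvPolynomial (Option τ) A) := by
      have h3 := hPb.2 i
      refine ⟨(totalDegree_rename_le _ _).trans h3.1, fun m => ?_⟩
      by_cases hm : ∃ l, l.mapDomain some = m ∧ (P.coeff i).coeff l ≠ 0
      · obtain ⟨l, rfl, -⟩ := hm
        rw [coeff_rename_mapDomain _ (Option.some_injective _)]
        exact h3.2 l
      · rw [coeff_rename_eq_zero _ _ _ (fun l hl => by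
          by_contra h; exact hm ⟨l, hl, h⟩)]
        exact zero_mem _
    rw [h1]
    have h4 : IsBounded G (i * 1) 0 (X none ^ i : MvPolynomial (Option τ) A) := by
      clear * -
      induction i with
      | zero => 
        rw [pow_zero, ← C_1]
        exact (isBounded_C G.one_mem).mono (Nat.zero_le _) le_rfl
      | succ i ih => rw [pow_succ]; exact (ih.mul (isBounded_X none)).mono (by omega) le_rfl
    exact (h2.mul h4).mono (by omega) (by omega)
  · let Q := MvPolynomial τ A ⧸ Ideal.span (Set.range f)
    let y : τ → Q := fun i => Ideal.Quotient.mk _ (X i)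
    let Θ : MvPolynomial τ (MvPolynomial τ A) →+* MvPolynomial τ Q :=
      eval₂Hom (map (algebraMap A Q)) fun i => C (y i)
    have hΘf : ∀ p : MvPolynomial τ A, Θ (map C p) = C (Ideal.Quotient.mk _ p) := by
      intro p
      have : Θ.comp (map C) = (C : Q →+* MvPolynomial τ Q).comp (Ideal.Quotient.mk _) := by
        refine MvPolynomial.ringHom_ext (fun a => ?_) fun i => ?_
        · rw [RingHom.comp_apply, map_C, coe_eval₂Hom, eval₂_C, map_C]; rfl
        · simp [Θ, y]
      exact RingHom.congr_fun this p
    have hΘJ : ∀ p ∈ J, Θ p = 0 := by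
      intro p hp
      have : J ≤ RingHom.ker Θ := by
        rw [Ideal.span_le]
        rintro _ ⟨j, rfl⟩
        change Θ (map C (f j)) = 0
        have hj : f j ∈ Ideal.span (Set.range f) := Ideal.subset_span ⟨j, rfl⟩
        rw [hΘf, Ideal.Quotient.eq_zero_iff_mem.2 hj, C_0]
      exact this hp
    rw [genericEval_optionEquivLeft_symm]
    exact hΘJ _ hPU


/-! ### Cartier operators -/

/-- The linear functionals of a field extension `φ : K →+* L` separate points. -/
theorem exists_addMonoidHom_ne_zero {K L : Type*} [Field K] [Field L] (φ : K →+* L) {x : L}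
    (hx : x ≠ 0) : ∃ l : L →+ K, (∀ a b, l (φ a * b) = a * l b) ∧ l x ≠ 0 := by
  let := φ.toAlgebra
  by_contra! h
  refine hx ((Module.forall_dual_apply_eq_zero_iff K x).1 fun l => h l.toAddMonoidHom fun a b => ?_)
  have h1 : φ a * b = a • b := (Algebra.smul_def a b).symm
  rw [h1]
  exact l.map_smul a b

section cartier
variable {K σ : Type*} [Field K] (q : ℕ) (l : K →+ K) (β : σ →₀ ℕ)

theorem injective_add_nsmul {q : ℕ} (hq : q ≠ 0) (β : σ →₀ ℕ) :
    Function.Injective fun m : σ →₀ ℕ => β + q • m := by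
  intro m m' h
  ext i
  have := DFunLike.congr_fun (add_left_cancel h) i
  simpa [hq] using this

open Classical in
/-- The Cartier operator for the exponent `q`, a functional `l` and a residue `β`: it selects the
monomials with exponents `β + q • m`, replaces them by those with exponents `m`, and applies `l` to
the coefficients. For `q = 0` it is zero. -/
noncomputable def cartier (f : MvPolynomial σ K) : MvPolynomial σ K :=
  if hq : q = 0 then 0 else
    ∑ m ∈ f.support.preimage (fun m => β + q • m) (injective_add_nsmul hq β).injOn,
      monomial m (l (f.coeff (β + q • m)))

theorem coeff_cartier {q : ℕ} (hq : q ≠ 0) (f : MvPolynomial σ K) (m : σ →₀ ℕ) :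
    (cartier q l β f).coeff m = l (f.coeff (β + q • m)) := by
  classical
  rw [cartier, dif_neg hq, coeff_sum]
  simp only [coeff_monomial, Finset.sum_ite_eq', Finset.mem_preimage, mem_support_iff]
  split_ifs with h
  · rfl
  · rw [not_not.1 h, map_zero]

theorem cartier_add {q : ℕ} (hq : q ≠ 0) (f g : MvPolynomial σ K) :
    cartier q l β (f + g) = cartier q l β f + cartier q l β g := by
  ext m; simp [coeff_cartier _ _ hq]

theorem cartier_zero {q : ℕ} (hq : q ≠ 0) : cartier q l β 0 = 0 := by
  ext m; simp [coeff_cartier _ _ hq]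

theorem totalDegree_cartier_le {q : ℕ} (hq : q ≠ 0) (f : MvPolynomial σ K) :
    (cartier q l β f).totalDegree ≤ f.totalDegree := by
  rw [totalDegree_le_iff]
  intro m hm
  rw [coeff_cartier _ _ hq] at hm
  have h := totalDegree_le_iff.1 (le_refl f.totalDegree) (β + q • m)
    fun h => hm (by rw [h, map_zero])
  rw [map_add, map_nsmul, smul_eq_mul] at h
  have : 1 * m.degree ≤ q * m.degree := Nat.mul_le_mul_right _ (Nat.one_le_iff_ne_zero.2 hq)
  omega

/-- If `l` is linear with respect to the Frobenius `a ↦ a ^ p ^ e` of `K`, then the Cartier operator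
is linear with respect to that of the polynomial ring. -/
theorem cartier_pow_mul {p e : ℕ} [ExpChar K p] (hl : ∀ a b, l (a ^ p ^ e * b) = a * l b)
    (hβ : ∀ i, β i < p ^ e) (g f : MvPolynomial σ K) :
    cartier (p ^ e) l β (g ^ p ^ e * f) = g * cartier (p ^ e) l β f := by
  classical
  have hq : p ^ e ≠ 0 := (expChar_pow_pos K p e).ne'
  have : ExpChar (MvPolynomial σ K) p := expChar_of_injective_ringHom (C_injective σ K) p
  induction g using MvPolynomial.induction_on' with
  | add g g' h h' => rw [add_pow_expChar_pow, add_mul, cartier_add _ _ hq, h, h', add_mul]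
  | monomial m a =>
    ext k
    rw [coeff_cartier _ _ hq, monomial_pow, coeff_monomial_mul', coeff_monomial_mul']
    have hle : p ^ e • m ≤ β + p ^ e • k ↔ m ≤ k := by
      constructor
      · intro h i
        have h1 := h i
        simp only [Finsupp.add_apply, Finsupp.smul_apply, smul_eq_mul] at h1
        by_contra! h2
        have h3 : p ^ e * (k i + 1) ≤ p ^ e * m i := Nat.mul_le_mul_left _ h2
        have := hβ i
        rw [mul_add, mul_one] at h3
        omega
      · intro h
        exact le_add_left (nsmul_le_nsmul_right h _)
    by_cases hm : m ≤ k
    · rw [if_pos hm, if_pos (hle.2 hm), hl, coeff_cartier _ _ hq]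
      obtain ⟨k, rfl⟩ := exists_add_of_le hm
      rw [add_tsub_cancel_left, nsmul_add, add_left_comm, add_tsub_cancel_left]
    · rw [if_neg hm, if_neg (fun h => hm (hle.1 h)), map_zero]

end cartier

theorem exists_cartier_ne_zero {K σ : Type*} [Field K] {p e : ℕ} [ExpChar K p]
    {f : MvPolynomial σ K} (hf : f ≠ 0) : ∃ (l : K →+ K) (β : σ →₀ ℕ),
      (∀ a b, l (a ^ p ^ e * b) = a * l b) ∧ (∀ i, β i < p ^ e) ∧ cartier (p ^ e) l β f ≠ 0 := by
  have hq := expChar_pow_pos K p e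
  obtain ⟨m, hm⟩ := ne_zero_iff.1 hf
  obtain ⟨l, hl, hlm⟩ := exists_addMonoidHom_ne_zero (iterateFrobenius K p e) hm
  refine ⟨l, m.mapRange (· % p ^ e) (Nat.zero_mod _), fun a b => ?_, fun i => ?_, fun h => hlm ?_⟩
  · rw [← hl, iterateFrobenius_def]
  · rw [Finsupp.mapRange_apply]; exact Nat.mod_lt _ hq
  · have h1 := coeff_cartier l (m.mapRange (· % p ^ e) (Nat.zero_mod _)) hq.ne' f
      (m.mapRange (· / p ^ e) (Nat.zero_div _))
    rw [h, coeff_zero] at h1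
    have h2 : m.mapRange (· % p ^ e) (Nat.zero_mod _) +
        p ^ e • m.mapRange (· / p ^ e) (Nat.zero_div _) = m := by
      ext i
      simp [Nat.mod_add_div]
    rw [h2] at h1
    exact h1.symm

/-- An equation that is linear in the `p ^ e`-th powers of the `h i` is equivalent to a family of
equations that are linear in the `h i`. -/
theorem sum_mul_pow_eq_zero_iff {K σ : Type*} [Field K] {p e : ℕ} [ExpChar K p] {ι : Type*}
    (s : Finset ι) (v h : ι → MvPolynomial σ K) :
    ∑ i ∈ s, v i * h i ^ p ^ e = 0 ↔ ∀ (l : K →+ K) (β : σ →₀ ℕ),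
      (∀ a b, l (a ^ p ^ e * b) = a * l b) → (∀ i, β i < p ^ e) →
        ∑ i ∈ s, cartier (p ^ e) l β (v i) * h i = 0 := by
  classical
  have hq : p ^ e ≠ 0 := (expChar_pow_pos K p e).ne'
  have key : ∀ (l : K →+ K) (β : σ →₀ ℕ),
      (∀ a b, l (a ^ p ^ e * b) = a * l b) → (∀ i, β i < p ^ e) →
        cartier (p ^ e) l β (∑ i ∈ s, v i * h i ^ p ^ e) =
          ∑ i ∈ s, cartier (p ^ e) l β (v i) * h i := by
    intro l β hl hβ
    let c : MvPolynomial σ K →+ MvPolynomial σ K :=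
      { toFun := cartier (p ^ e) l β, map_zero' := cartier_zero l β hq
        map_add' := cartier_add l β hq }
    change c _ = _
    rw [map_sum]
    refine Finset.sum_congr rfl fun i _ => ?_
    rw [mul_comm (v i), mul_comm _ (h i)]
    exact cartier_pow_mul l β hl hβ _ _
  constructor
  · intro h0 l β hl hβ
    rw [← key l β hl hβ, h0, cartier_zero _ _ hq]
  · intro h0
    by_contra hne
    obtain ⟨l, β, hl, hβ, hc⟩ := exists_cartier_ne_zero (p := p) (e := e) hne
    exact hc ((key l β hl hβ).trans (h0 l β hl hβ))


/-! ### Tests for membership, and representatives of bounded degree -/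

/-- If the quotient by the ideal of the `f j` is torsion-free over `A`, then membership in this
ideal of a polynomial of degree at most `δ` is tested by `A`-linear functionals with bounded values
at the monomials. By Hermann's theorem it amounts to a linear system over the fraction field of `A`,
whose left kernel is spanned by bounded vectors. -/
theorem exists_membership_tests {A τ : Type*} [CommRing A] [IsDomain A] [Fintype τ]
    (G : DegreeFiltration A) {κ : Type} [Fintype κ] {d n δ : ℕ} (hd : 0 < d) (hδ : d ≤ δ)
    (hn : Fintype.card τ ≤ n) (f : κ → MvPolynomial τ A) (hf : ∀ j, IsBounded G d d (f j))
    (htf : ∀ a h, a ≠ 0 → C a * h ∈ Ideal.span (Set.range f) → h ∈ Ideal.span (Set.range f)) :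
    ∃ V : Set (MvPolynomial τ A →ₗ[A] A),
      (∀ v ∈ V, ∀ m, v (monomial m 1) ∈ G.piece (((3 * δ) ^ 2 ^ n + d + 1) ^ n * d)) ∧
      ∀ w, w.totalDegree ≤ δ → (w ∈ Ideal.span (Set.range f) ↔ ∀ v ∈ V, v w = 0) := by
  classical
  set D := (3 * δ) ^ 2 ^ n with hD
  let F := FractionRing A
  let φ : A →+* F := algebraMap A F
  have hφ : Function.Injective φ := IsFractionRing.injective A F
  let W := monomialsLE τ (D + d)
  -- the products of the `f j` with monomials of degree at most `D`, as vectors of coefficients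
  let M : Matrix (κ × monomialsLE τ D) W A := fun t l => (monomial t.2.1 1 * f t.1).coeff l.1
  have hM : ∀ t l, M t l ∈ G.piece d := fun t l =>
    (isBounded_monomial_mul G (hf t.1) (mem_monomialsLE.1 t.2.2)).2 l.1
  let T : (W → A) → MvPolynomial τ A →ₗ[A] A := fun u => ∑ l, u l • lcoeff A l.1
  have hT : ∀ u w, T u w = ∑ l, u l * w.coeff l.1 := fun u w => by simp [T]
  have hδD : δ ≤ D + d := by
    have : 3 * δ ≤ D := (pow_one _).symm.le.trans <|
      Nat.pow_le_pow_right (by omega) Nat.one_le_two_pow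
    omega
  have hcard : Fintype.card W ≤ (D + d + 1) ^ n := by
    rw [Fintype.card_coe]
    exact (card_monomialsLE_le τ _).trans (Nat.pow_le_pow_right (by omega) hn)
  let Z : Set (W → A) := {u | (∀ l, u l ∈ G.piece ((D + d + 1) ^ n * d)) ∧
    ∀ t, φ (∑ l, M t l * u l) = 0}
  have hcol : ∀ (c : κ × monomialsLE τ D → F) (l : W),
      (∑ t, C (c t) * map φ (monomial t.2.1 1 * f t.1)).coeff l.1 = ∑ t, c t * φ (M t l) := by
    intro c l
    rw [coeff_sum]
    exact Finset.sum_congr rfl fun t _ => by rw [coeff_C_mul, coeff_map]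
  refine ⟨T '' Z, ?_, fun w hw => ⟨?_, fun htest => ?_⟩⟩
  · rintro _ ⟨u, hu, rfl⟩ m
    rw [hT]
    refine sum_mem fun l _ => ?_
    rw [coeff_monomial]
    split_ifs
    · rw [mul_one]; exact hu.1 l
    · rw [mul_zero]; exact zero_mem _
  · rintro hwI _ ⟨u, hu, rfl⟩
    obtain ⟨g, hg⟩ := Ideal.mem_span_range_iff_exists_fun.1 hwI
    obtain ⟨g', hg', hgD, -⟩ := exists_bounded_solution (d := δ) (by omega) hn
      (fun j => map φ (f j)) (map φ w) (fun j => map φ (g j))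
      (fun j => (totalDegree_map_le _ _).trans ((hf j).1.trans hδ))
      ((totalDegree_map_le _ _).trans hw) (by
        rw [← hg, map_sum]
        exact Finset.sum_congr rfl fun j _ => by rw [map_mul, mul_comm])
    have h1 : map φ w = ∑ t : κ × monomialsLE τ D,
        C ((g' t.1).coeff t.2.1) * map φ (monomial t.2.1 1 * f t.1) := by
      rw [← hg', Fintype.sum_prod_type]
      refine Finset.sum_congr rfl fun j _ => ?_
      conv_lhs => rw [← sum_monomialsLE (hgD j)]
      rw [Finset.mul_sum]
      refine Finset.sum_congr rfl fun m _ => ?_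
      rw [map_mul, map_monomial, map_one, ← mul_assoc, C_mul_monomial, mul_one, mul_comm]
    refine hφ ?_
    rw [hT, map_zero, map_sum]
    calc ∑ l, φ (u l * w.coeff l.1)
        = ∑ l : W, φ (u l) * ∑ t : κ × monomialsLE τ D, (g' t.1).coeff t.2.1 * φ (M t l) := by
          refine Finset.sum_congr rfl fun l _ => ?_
          rw [← hcol, ← h1, coeff_map, map_mul]
      _ = ∑ t : κ × monomialsLE τ D, (g' t.1).coeff t.2.1 * φ (∑ l, M t l * u l) := by
          simp only [Finset.mul_sum, map_sum, map_mul]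
          rw [Finset.sum_comm]
          exact Finset.sum_congr rfl fun t _ => Finset.sum_congr rfl fun l _ => by ring
      _ = 0 := Finset.sum_eq_zero fun t _ => by rw [hu.2 t, mul_zero]
  · let b : W → F := fun l => φ (w.coeff l.1)
    let col : κ × monomialsLE τ D → W → F := fun t l => φ (M t l)
    -- a functional that separates `b` from the columns is a combination of bounded ones
    have hb : b ∈ Submodule.span F (Set.range col) := by
      by_contra hb
      obtain ⟨g, hgb, hg⟩ := Submodule.exists_le_ker_of_notMem hb
      have hgx : ∀ z : W → F, g z = ∑ l, z l * g (Pi.single l 1) := fun z => by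
        conv_lhs => rw [pi_eq_sum_univ' z]
        rw [map_sum]
        exact Finset.sum_congr rfl fun l _ => by rw [map_smul, smul_eq_mul]
      have hx := mem_span_bounded_kernel G φ M hM (Or.inl hcard) (fun l => g (Pi.single l 1))
        fun t => by
          have : g (col t) = 0 := hg (Submodule.subset_span ⟨t, rfl⟩)
          rwa [hgx] at this
      refine hgb ?_
      rw [hgx]
      have hlin : ∀ x ∈ Submodule.span F ((fun u : W → A => fun l => φ (u l)) '' Z),
          ∑ l, b l * x l = 0 := by
        intro x hx
        induction hx using Submodule.span_induction with
        | mem x hx =>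
          obtain ⟨u, hu, rfl⟩ := hx
          have h2 := congrArg φ (htest _ ⟨u, hu, rfl⟩)
          rw [hT, map_zero, map_sum] at h2
          rw [← h2]
          exact Finset.sum_congr rfl fun l _ => by rw [map_mul, mul_comm]
        | zero => simp
        | add x y _ _ hx hy => simp only [Pi.add_apply, mul_add, Finset.sum_add_distrib, hx, hy,
            add_zero]
        | smul c x _ hx =>
          have : ∑ l, b l * (c • x) l = c * ∑ l, b l * x l := by
            rw [Finset.mul_sum]
            exact Finset.sum_congr rfl fun l _ => by rw [Pi.smul_apply, smul_eq_mul]; ring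
          rw [this, hx, mul_zero]
      exact hlin _ hx
    obtain ⟨c, hc⟩ := (Submodule.mem_span_range_iff_exists_fun F).1 hb
    have h1 : map φ w = ∑ t, C (c t) * map φ (monomial t.2.1 1 * f t.1) := by
      ext l
      by_cases hl : l.degree ≤ D + d
      · have h2 := hcol c ⟨l, mem_monomialsLE.2 hl⟩
        have h3 := congrFun hc ⟨l, mem_monomialsLE.2 hl⟩
        rw [h2, coeff_map]
        rw [Finset.sum_apply] at h3
        exact h3.symm
      · have hz : ∀ p : MvPolynomial τ F, p.totalDegree ≤ D + d → p.coeff l = 0 := fun p hp => by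
          by_contra h0; exact hl (totalDegree_le_iff.1 hp l h0)
        rw [hz _ ((totalDegree_map_le _ _).trans (hw.trans hδD)), coeff_sum]
        refine (Finset.sum_eq_zero fun t _ => ?_).symm
        rw [coeff_C_mul, hz _ ((totalDegree_map_le _ _).trans
          (isBounded_monomial_mul G (hf t.1) (mem_monomialsLE.1 t.2.2)).1), mul_zero]
    obtain ⟨s, hs⟩ := IsLocalization.exist_integer_multiples_of_finite (nonZeroDivisors A) c
    choose a ha using hs
    refine htf s w (nonZeroDivisors.coe_ne_zero s) ?_
    have h2 : C (s : A) * w = ∑ t, C (a t) * (monomial t.2.1 1 * f t.1) := by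
      refine map_injective φ hφ ?_
      rw [map_mul, map_C, h1, map_sum, Finset.mul_sum]
      refine Finset.sum_congr rfl fun t _ => ?_
      have h3 : φ (a t) = φ s * c t := by
        rw [show φ (a t) = _ from ha t, Algebra.smul_def]
      rw [map_mul (map φ) (C (a t)), map_C, h3, C_mul, mul_assoc]
    rw [h2]
    exact Ideal.sum_mem _ fun t _ => Ideal.mul_mem_left _ _
      (Ideal.mul_mem_left _ _ (Ideal.subset_span ⟨t.1, rfl⟩))

/-- Pseudo-division of powers of the variable by `P`. -/
theorem exists_dvd_C_mul_X_pow_sub {A : Type*} [CommRing A] [IsDomain A] {P : Polynomial A}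
    (hP : P ≠ 0) {N : ℕ} (hN : P.natDegree ≤ N) (k : ℕ) :
    ∃ c ≠ 0, ∃ r : Polynomial A, r.natDegree ≤ N ∧
      P ∣ Polynomial.C c * Polynomial.X ^ k - r := by
  induction k with
  | zero => exact ⟨1, one_ne_zero, 1, by simp, by simp⟩
  | succ k ih =>
    obtain ⟨c, hc, r, hr, w, hw⟩ := ih
    refine ⟨P.leadingCoeff * c, mul_ne_zero (Polynomial.leadingCoeff_ne_zero.2 hP) hc,
      Polynomial.C P.leadingCoeff * (Polynomial.X * r) -
        Polynomial.C (r.coeff N) * Polynomial.X ^ (N + 1 - P.natDegree) * P, ?_,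
      Polynomial.C P.leadingCoeff * Polynomial.X * w +
        Polynomial.C (r.coeff N) * Polynomial.X ^ (N + 1 - P.natDegree), ?_⟩
    · rw [Polynomial.natDegree_le_iff_coeff_eq_zero]
      intro i hi
      obtain ⟨i, rfl⟩ : ∃ j, i = j + 1 := ⟨i - 1, by omega⟩
      rw [Polynomial.coeff_sub, Polynomial.coeff_C_mul, Polynomial.coeff_X_mul, mul_assoc,
        Polynomial.coeff_C_mul, mul_comm (Polynomial.X ^ _)]
      obtain ⟨t, ht⟩ : ∃ t, i + 1 = t + (N + 1 - P.natDegree) := ⟨i + 1 - (N + 1 - P.natDegree),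
        by omega⟩
      rw [ht, Polynomial.coeff_mul_X_pow]
      rcases eq_or_ne i N with rfl | hiN
      · have : t = P.natDegree := by omega
        rw [this, Polynomial.coeff_natDegree]; ring
      · rw [Polynomial.coeff_eq_zero_of_natDegree_lt (p := r) (by omega),
          Polynomial.coeff_eq_zero_of_natDegree_lt (p := P) (n := t) (by omega)]; ring
    · rw [Polynomial.C_mul, pow_succ]
      linear_combination (Polynomial.C P.leadingCoeff * Polynomial.X) * hw

/-- If every variable is a root modulo `I` of a nonzero polynomial over `A` of degree at most `N`,
then every polynomial has a multiple, by a nonzero element of `A`, that is congruent to a polynomial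
of degree at most `n * N`. -/
theorem exists_bounded_representative {A τ : Type*} [CommRing A] [IsDomain A] [Fintype τ]
    (I : Ideal (MvPolynomial τ A)) {n N : ℕ} (hn : Fintype.card τ ≤ n)
    (hI : ∀ i, ∃ P : Polynomial A, P ≠ 0 ∧ P.natDegree ≤ N ∧
      Polynomial.aeval (X i : MvPolynomial τ A) P ∈ I) (a : MvPolynomial τ A) :
    ∃ c ≠ 0, ∃ b : MvPolynomial τ A, b.totalDegree ≤ n * N ∧ C c * a - b ∈ I := by
  classical
  induction a using MvPolynomial.induction_on' with
  | add a a' ha ha' =>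
    obtain ⟨c, hc, b, hb, hab⟩ := ha
    obtain ⟨c', hc', b', hb', hab'⟩ := ha'
    refine ⟨c * c', mul_ne_zero hc hc', C c' * b + C c * b', ?_, ?_⟩
    · refine (totalDegree_add _ _).trans (max_le ?_ ?_) <;>
        refine (totalDegree_mul _ _).trans ?_ <;> rw [totalDegree_C, zero_add] <;> assumption
    · have := Ideal.add_mem _ (Ideal.mul_mem_left _ (C c') hab) (Ideal.mul_mem_left _ (C c) hab')
      convert this using 1
      rw [C_mul]; ring
  | monomial m x =>
    have h : ∀ i, ∃ c : A, c ≠ 0 ∧ ∃ b : MvPolynomial τ A, b.totalDegree ≤ N ∧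
        C c * X i ^ m i - b ∈ I := by
      intro i
      obtain ⟨P, hP, hPN, hPI⟩ := hI i
      obtain ⟨c, hc, r, hr, hdvd⟩ := exists_dvd_C_mul_X_pow_sub hP hPN (m i)
      refine ⟨c, hc, Polynomial.aeval (X i) r, ?_, ?_⟩
      · rw [Polynomial.aeval_eq_sum_range]
        refine totalDegree_finsetSum_le fun j hj => ?_
        rw [Finset.mem_range] at hj
        refine (totalDegree_smul_le _ _).trans ((totalDegree_pow _ _).trans ?_)
        have : (X i : MvPolynomial τ A).totalDegree ≤ 1 := by simp
        calc j * _ ≤ j * 1 := Nat.mul_le_mul_left _ this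
          _ ≤ N := by omega
      · obtain ⟨w, hw⟩ := hdvd
        have h1 := congrArg (Polynomial.aeval (X i : MvPolynomial τ A)) hw
        rw [map_sub, map_mul, map_pow, Polynomial.aeval_C, Polynomial.aeval_X, map_mul,
          MvPolynomial.algebraMap_eq] at h1
        rw [h1]
        exact Ideal.mul_mem_right _ _ hPI
    choose c hc b hb hcb using h
    refine ⟨∏ i, c i, Finset.prod_ne_zero_iff.2 fun i _ => hc i, C x * ∏ i, b i, ?_, ?_⟩
    · refine (totalDegree_mul _ _).trans ?_
      rw [totalDegree_C, zero_add]
      refine (totalDegree_finsetProd _ _).trans ((Finset.sum_le_sum fun i _ => hb i).trans ?_)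
      rw [Finset.sum_const, Finset.card_univ, smul_eq_mul]
      exact Nat.mul_le_mul_right _ hn
    · rw [← Ideal.Quotient.eq_zero_iff_mem, map_sub, sub_eq_zero]
      have h1 : ∀ i, Ideal.Quotient.mk I (C (c i) * X i ^ m i) = Ideal.Quotient.mk I (b i) :=
        fun i => Ideal.Quotient.eq.2 (hcb i)
      have h2 : (C (∏ i, c i) * monomial m x : MvPolynomial τ A) =
          C x * ∏ i, (C (c i) * X i ^ m i) := by
        rw [monomial_eq, Finsupp.prod_fintype _ _ (fun i => pow_zero _), Finset.prod_mul_distrib,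
          map_prod]
        ring
      rw [h2, map_mul, map_mul, map_prod, map_prod, Finset.prod_congr rfl fun i _ => h1 i]


/-! ### Elements with a vanishing `p ^ e`-th power -/

/-- Let the quotient by the ideal of the `f j` be torsion-free over `A = K[σ]`. If every polynomial
with `p ^ e`-th power in this ideal that is bounded in `τ` and in its coefficients belongs to the
ideal, then so does every such polynomial that is only bounded in `τ`. -/
theorem mem_of_pow_mem_of_totalDegree_le {K σ τ : Type*} [Field K] [Fintype τ] {p e : ℕ}
    [ExpChar K p] {κ : Type} [Fintype κ] {d n δ B : ℕ} (hd : 0 < d) (hδ : d ≤ δ)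
    (hB : p ^ e * B ≤ δ) (hn : Fintype.card τ ≤ n) (f : κ → MvPolynomial τ (MvPolynomial σ K))
    (hf : ∀ j, IsBounded (totalDegreeFiltration σ K) d d (f j))
    (htf : ∀ a h, a ≠ 0 → C a * h ∈ Ideal.span (Set.range f) → h ∈ Ideal.span (Set.range f))
    (hpow : ∀ h, IsBounded (totalDegreeFiltration σ K) B
      ((B + 1) ^ n * (((3 * δ) ^ 2 ^ n + d + 1) ^ n * d)) h →
      h ^ p ^ e ∈ Ideal.span (Set.range f) → h ∈ Ideal.span (Set.range f))
    (h : MvPolynomial τ (MvPolynomial σ K)) (hh : h.totalDegree ≤ B)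
    (hmem : h ^ p ^ e ∈ Ideal.span (Set.range f)) : h ∈ Ideal.span (Set.range f) := by
  classical
  set I := Ideal.span (Set.range f) with hI
  set G := totalDegreeFiltration σ K
  have : ExpChar (MvPolynomial σ K) p := expChar_of_injective_ringHom (C_injective σ K) p
  have : ExpChar (MvPolynomial τ (MvPolynomial σ K)) p :=
    expChar_of_injective_ringHom (C_injective τ _) p
  obtain ⟨V, hV, htest⟩ := exists_membership_tests G hd hδ hn f hf htf
  let W := monomialsLE τ B
  let H : (W → MvPolynomial σ K) → MvPolynomial τ (MvPolynomial σ K) := fun x =>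
    ∑ m, monomial m.1 (x m)
  have hHpow : ∀ x, H x ^ p ^ e ∈ I ↔ ∀ v ∈ V,
      ∑ m, v (monomial (p ^ e • m.1) 1) * x m ^ p ^ e = 0 := by
    intro x
    have h1 : H x ^ p ^ e = ∑ m : W, monomial (p ^ e • m.1) (x m ^ p ^ e) := by
      rw [sum_pow_char_pow]
      exact Finset.sum_congr rfl fun m _ => monomial_pow
    have h2 : (H x ^ p ^ e).totalDegree ≤ δ := by
      refine (totalDegree_pow _ _).trans (le_trans (Nat.mul_le_mul_left _ ?_) hB)
      exact totalDegree_finsetSum_le fun m _ =>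
        (totalDegree_monomial_le _ _).trans (mem_monomialsLE.1 m.2)
    rw [htest _ h2]
    refine forall₂_congr fun v _ => ?_
    rw [h1, map_sum]
    refine iff_of_eq (congrArg (· = 0) (Finset.sum_congr rfl fun m _ => ?_))
    rw [mul_comm, ← smul_eq_mul, ← map_smul, smul_monomial, smul_eq_mul, mul_one]
  -- the Cartier operators turn the equations for the `p ^ e`-th powers into linear equations
  let ι := {t : (MvPolynomial τ (MvPolynomial σ K) →ₗ[MvPolynomial σ K] MvPolynomial σ K) ×
    (K →+ K) × (σ →₀ ℕ) // t.1 ∈ V ∧ (∀ a b, t.2.1 (a ^ p ^ e * b) = a * t.2.1 b) ∧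
      ∀ i, t.2.2 i < p ^ e}
  let M : Matrix ι W (MvPolynomial σ K) := fun t m =>
    cartier (p ^ e) t.1.2.1 t.1.2.2 (t.1.1 (monomial (p ^ e • m.1) 1))
  have hM : ∀ t m, M t m ∈ G.piece (((3 * δ) ^ 2 ^ n + d + 1) ^ n * d) := fun t m =>
    (totalDegree_cartier_le _ _ (expChar_pow_pos K p e).ne' _).trans (hV _ t.2.1 _)
  have hHM : ∀ x, H x ^ p ^ e ∈ I ↔ ∀ t, ∑ m, M t m * x m = 0 := by
    intro x
    rw [hHpow]
    constructor
    · intro h1 t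
      exact (sum_mul_pow_eq_zero_iff Finset.univ _ x).1 (h1 _ t.2.1) _ _ t.2.2.1 t.2.2.2
    · intro h1 v hv
      exact (sum_mul_pow_eq_zero_iff Finset.univ _ x).2 fun l β hl hβ =>
        h1 ⟨(v, l, β), hv, hl, hβ⟩
  let F := FractionRing (MvPolynomial σ K)
  let φ : MvPolynomial σ K →+* F := algebraMap _ F
  have hφ : Function.Injective φ := IsFractionRing.injective _ F
  have hcard : Fintype.card W ≤ (B + 1) ^ n := by
    rw [Fintype.card_coe]
    exact (card_monomialsLE_le τ _).trans (Nat.pow_le_pow_right (by omega) hn)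
  let x : W → MvPolynomial σ K := fun m => h.coeff m.1
  have hxh : H x = h := sum_monomialsLE hh
  have hspan := mem_span_bounded_kernel G φ M hM (Or.inl hcard) (fun m => φ (x m)) fun t => by
    rw [← hxh, hHM] at hmem
    rw [← map_zero φ, ← hmem t, map_sum]
    exact Finset.sum_congr rfl fun m _ => (map_mul _ _ _).symm
  have hadd : ∀ y z, H (y + z) = H y + H z := fun y z => by
    simp only [H, Pi.add_apply, map_add, Finset.sum_add_distrib]
  have hsmul : ∀ c y, H (c • y) = C c * H y := fun c y => by
    simp only [H, Finset.mul_sum, C_mul_monomial, Pi.smul_apply, smul_eq_mul]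
  -- up to denominators, combinations of bounded solutions are in the ideal
  have key : ∀ z ∈ Submodule.span F ((fun w : W → MvPolynomial σ K => fun m => φ (w m)) ''
      {w | (∀ m, w m ∈ G.piece ((B + 1) ^ n * (((3 * δ) ^ 2 ^ n + d + 1) ^ n * d))) ∧
        ∀ t, φ (∑ m, M t m * w m) = 0}),
      ∃ s ≠ 0, ∃ w, H w ∈ I ∧ ∀ m, φ s * z m = φ (w m) := by
    intro z hz
    induction hz using Submodule.span_induction with
    | mem z hz =>
      obtain ⟨w, ⟨hw, hw0⟩, rfl⟩ := hz
      refine ⟨1, one_ne_zero, w, hpow _ (isBounded_sum_monomial G B w hw) ((hHM w).2 fun t => ?_),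
        fun m => by rw [map_one, one_mul]⟩
      exact hφ ((hw0 t).trans (map_zero φ).symm)
    | zero => exact ⟨1, one_ne_zero, 0, by simp [H], fun m => by simp⟩
    | add y z _ _ hy hz =>
      obtain ⟨s, hs, w, hw, hwy⟩ := hy
      obtain ⟨s', hs', w', hw', hwz⟩ := hz
      refine ⟨s * s', mul_ne_zero hs hs', s' • w + s • w', ?_, fun m => ?_⟩
      · rw [hadd, hsmul, hsmul]
        exact Ideal.add_mem _ (Ideal.mul_mem_left _ _ hw) (Ideal.mul_mem_left _ _ hw')
      · simp only [Pi.add_apply, Pi.smul_apply, smul_eq_mul, map_add, map_mul, ← hwy, ← hwz]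
        ring
    | smul c z _ hz =>
      obtain ⟨s, hs, w, hw, hwz⟩ := hz
      obtain ⟨a, b, hb, rfl⟩ := IsFractionRing.div_surjective (A := MvPolynomial σ K) c
      refine ⟨b * s, mul_ne_zero (nonZeroDivisors.ne_zero hb) hs, a • w, ?_, fun m => ?_⟩
      · rw [hsmul]; exact Ideal.mul_mem_left _ _ hw
      · have hb0 : algebraMap (MvPolynomial σ K) F b ≠ 0 :=
          (map_ne_zero_iff _ hφ).2 (nonZeroDivisors.ne_zero hb)
        simp only [Pi.smul_apply, smul_eq_mul, map_mul, ← hwz]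
        have h1 : φ b * (φ a / φ b) = φ a := mul_div_cancel₀ _ hb0
        linear_combination (φ s * z m) * h1
  obtain ⟨s, hs, w, hw, hwx⟩ := key _ hspan
  refine htf s h hs ?_
  have h1 : w = s • x := funext fun m => hφ (by rw [← hwx, Pi.smul_apply, smul_eq_mul, map_mul])
  rwa [h1, hsmul, hxh] at hw

/-- The version of `mem_of_pow_mem_of_totalDegree_le` for arbitrary polynomials, if the variables
are algebraic over `A` of degree at most `N` modulo the ideal. -/
theorem mem_of_pow_mem {K σ τ : Type*} [Field K] [Fintype τ] {p e : ℕ}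
    [ExpChar K p] {κ : Type} [Fintype κ] {d n N δ : ℕ} (hd : 0 < d) (hδ : d ≤ δ)
    (hN : p ^ e * (n * N) ≤ δ) (hn : Fintype.card τ ≤ n)
    (f : κ → MvPolynomial τ (MvPolynomial σ K))
    (hf : ∀ j, IsBounded (totalDegreeFiltration σ K) d d (f j))
    (htf : ∀ a h, a ≠ 0 → C a * h ∈ Ideal.span (Set.range f) → h ∈ Ideal.span (Set.range f))
    (halg : ∀ i, ∃ P : Polynomial (MvPolynomial σ K), P ≠ 0 ∧ P.natDegree ≤ N ∧
      Polynomial.aeval (X i : MvPolynomial τ (MvPolynomial σ K)) P ∈ Ideal.span (Set.range f))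
    (hpow : ∀ h, IsBounded (totalDegreeFiltration σ K) (n * N)
      ((n * N + 1) ^ n * (((3 * δ) ^ 2 ^ n + d + 1) ^ n * d)) h →
      h ^ p ^ e ∈ Ideal.span (Set.range f) → h ∈ Ideal.span (Set.range f))
    (h : MvPolynomial τ (MvPolynomial σ K)) (hmem : h ^ p ^ e ∈ Ideal.span (Set.range f)) :
    h ∈ Ideal.span (Set.range f) := by
  obtain ⟨c, hc, b, hb, hcb⟩ := exists_bounded_representative _ hn halg h
  have h1 : b ^ p ^ e ∈ Ideal.span (Set.range f) := by
    rw [← Ideal.Quotient.eq_zero_iff_mem] at hmem ⊢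
    rw [map_pow, ← Ideal.Quotient.eq.2 hcb, map_mul, mul_pow, ← map_pow _ h, hmem, mul_zero]
  have h2 := mem_of_pow_mem_of_totalDegree_le hd hδ hN hn f hf htf hpow b hb h1
  exact htf c h hc (by simpa using Ideal.add_mem _ hcb h2)


/-! ### The primality criterion with explicit bounds -/

theorem IsPrimeUpTo.mem_of_pow_mem {σ K : Type*} [Field K] {I : Ideal (MvPolynomial σ K)} {N : ℕ}
    (h : IsPrimeUpTo I N) (hI : I ≠ ⊤) {g : MvPolynomial σ K} {b k : ℕ} (hg : g.totalDegree ≤ b)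
    (hk : k * b ≤ N) (hmem : g ^ k ∈ I) : g ∈ I := by
  induction k with
  | zero => exact absurd ((Ideal.eq_top_iff_one _).2 (by simpa using hmem)) hI
  | succ k ih =>
    rw [add_mul, one_mul] at hk
    rw [pow_succ] at hmem
    refine (h _ _ ?_ (by omega) hmem).elim (ih (by omega)) id
    have := (totalDegree_pow g k).trans (Nat.mul_le_mul_left k hg)
    omega

/-- A maximal set of variables which are independent modulo `I`. -/
theorem exists_maximal_independent {K ν : Type*} [Field K] [DecidableEq ν] [Finite ν]
    {I : Ideal (MvPolynomial ν K)} (hI : I ≠ ⊤) :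
    ∃ S : Finset ν, (∀ a : MvPolynomial {i // i ∈ S} K, rename Subtype.val a ∈ I → a = 0) ∧
      ∀ i ∉ S, ∃ b : MvPolynomial {j // j ∈ insert i S} K, b ≠ 0 ∧ rename Subtype.val b ∈ I := by
  classical
  obtain ⟨S, hS, hmax⟩ := Set.Finite.exists_maximal (Set.toFinite {S : Finset ν |
    ∀ a : MvPolynomial {i // i ∈ S} K, rename Subtype.val a ∈ I → a = 0}) ⟨∅, fun a ha => by
      have : IsEmpty {i // i ∈ (∅ : Finset ν)} := ⟨fun i => absurd i.2 (Finset.notMem_empty _)⟩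
      by_contra h0
      rw [eq_C_of_isEmpty a] at ha h0
      rw [rename_C] at ha
      have hc : coeff 0 a ≠ 0 := fun h => h0 (by rw [h, map_zero])
      exact hI (Ideal.eq_top_of_isUnit_mem _ ha ((isUnit_iff_ne_zero.2 hc).map C))⟩
  refine ⟨S, hS, fun i hi => ?_⟩
  by_contra! h
  exact hi (hmax (y := insert i S) (fun a ha => by
    by_contra h0; exact h a h0 ha) (Finset.subset_insert i S) (Finset.mem_insert_self i S))

/-- A polynomial in the variables from `insert i S`, read as a univariate polynomial over the
polynomials in the variables from `S` and evaluated at the `i`-th variable. -/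
theorem aeval_X_optionEquivLeft {K ν : Type*} [Field K] [DecidableEq ν] {S : Finset ν} {i : ν}
    (hi : i ∉ S) (b : MvPolynomial {j // j ∈ insert i S} K) :
    Polynomial.aeval (X ⟨i, hi⟩ : MvPolynomial {j // j ∉ S} (MvPolynomial {j // j ∈ S} K))
      (optionEquivLeft K _ (rename (Finset.subtypeInsertEquivOption hi) b)) =
        splitEquiv K S (rename Subtype.val b) := by
  have : (((Polynomial.aeval (X ⟨i, hi⟩ : MvPolynomial {j // j ∉ S}
      (MvPolynomial {j // j ∈ S} K))).restrictScalars K).comp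
        (optionEquivLeft K {j // j ∈ S}).toAlgHom).comp
          (rename (Finset.subtypeInsertEquivOption hi)) =
      (splitEquiv K S).toAlgHom.comp (rename Subtype.val) := by
    ext1 ⟨j, hj⟩
    by_cases hji : j = i
    · subst hji
      simp [Finset.subtypeInsertEquivOption, splitEquiv_X_of_notMem K S hi]
    · have hjS : j ∈ S := (Finset.mem_insert.1 hj).resolve_left hji
      simp [Finset.subtypeInsertEquivOption, splitEquiv_X_of_mem K S hjS, hji,
        MvPolynomial.algebraMap_eq]
  exact DFunLike.congr_fun this b

/-- The `p ^ e`-th power of an element of `A[y]` is a polynomial in the `yᵢ ^ p ^ e`. -/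
theorem mk_pow_eq_aeval {A τ : Type*} [CommRing A] (p e : ℕ) [ExpChar A p]
    (I : Ideal (MvPolynomial τ A)) (a : MvPolynomial τ A) :
    Ideal.Quotient.mk I (a ^ p ^ e) = aeval (fun i => Ideal.Quotient.mk I (X i) ^ p ^ e)
      (map (iterateFrobenius A p e) a) := by
  rw [← map_iterateFrobenius_expand, map_expand]
  have : ((Ideal.Quotient.mkₐ A I).comp (expand (p ^ e))) =
      aeval (fun i => Ideal.Quotient.mk I (X i) ^ p ^ e) := by
    ext1 i; simp
  exact DFunLike.congr_fun this _

/-- An ideal with generators of degree at most `d` that is prime up to a degree `N` large enough for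
the torsion step, the choice of an irreducible relation, and the removal of nilpotents is prime. -/
theorem isPrime_of_isPrimeUpTo {K ν : Type*} [Field K] [Fintype ν] {κ : Type} [Fintype κ]
    {d n N D₁ N₁ δ : ℕ} (hd : 0 < d) (hn : Fintype.card ν ≤ n) (f : κ → MvPolynomial ν K)
    (hf : ∀ j, (f j).totalDegree ≤ d) (hI : Ideal.span (Set.range f) ≠ ⊤)
    (hprime : IsPrimeUpTo (Ideal.span (Set.range f)) N)
    (hD₁ : D₁ = (3 * d) ^ 2 ^ n) (hN₁ : N₁ = (D₁ + d + 1) ^ n * d)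
    (hδ : δ = 3 * N₁ * (n * N₁) + d) (hN : d + N₁ + (d + D₁) ≤ N) (hN' : 3 * N₁ + 3 * N₁ ≤ N)
    (hN'' : 3 * N₁ *
      ((n * N₁ + 1) ^ n * (((3 * δ) ^ 2 ^ n + d + 1) ^ n * d) + n * N₁) ≤ N) :
    (Ideal.span (Set.range f)).IsPrime := by
  classical
  obtain ⟨S, hS, hmax⟩ := exists_maximal_independent hI
  let A := MvPolynomial {i // i ∈ S} K
  let E := splitEquiv K S
  let G := totalDegreeFiltration {i // i ∈ S} K
  let f' := fun j => E (f j)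
  have hspan : ∀ p, E p ∈ Ideal.span (Set.range f') ↔ p ∈ Ideal.span (Set.range f) :=
    splitEquiv_mem_span K S f
  set I' := Ideal.span (Set.range f') with hI'
  have hf' : ∀ j, IsBounded G d d (f' j) := fun j => isBounded_splitEquiv K S (hf j)
  have hn' : Fintype.card {i // i ∉ S} ≤ n := (Fintype.card_subtype_le _).trans hn
  have hI'top : I' ≠ ⊤ := fun h => hI ((Ideal.eq_top_iff_one _).2 ((hspan 1).1 (by
    rw [h]; exact Submodule.mem_top)))
  have htf : ∀ a h, a ≠ 0 → C a * h ∈ I' → h ∈ I' := by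
    intro a h ha hmem
    obtain ⟨h, rfl⟩ := E.surjective h
    rw [← splitEquiv_rename, ← map_mul, hspan] at hmem
    rw [hspan]
    exact mem_of_rename_mul_mem hd hn f hf S hS hprime (by rw [← hD₁, ← hN₁]; exact hN) S
      subset_rfl a ha h hmem
  have halg : ∀ i : {i // i ∉ S}, ∃ P : Polynomial A, P ≠ 0 ∧
      Polynomial.aeval (X i : MvPolynomial {i // i ∉ S} A) P ∈ I' := by
    rintro ⟨i, hi⟩
    obtain ⟨b, hb, hbI⟩ := hmax i hi
    refine ⟨optionEquivLeft K _ (rename (Finset.subtypeInsertEquivOption hi) b), ?_, ?_⟩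
    · rw [Ne, EmbeddingLike.map_eq_zero_iff]
      exact (map_ne_zero_iff _ (rename_injective _ (Equiv.injective _))).2 hb
    · rw [aeval_X_optionEquivLeft hi b]
      exact (hspan _).2 hbI
  have halg' : ∀ i : {i // i ∉ S}, ∃ P : Polynomial A, P ≠ 0 ∧ P.natDegree ≤ N₁ ∧
      Polynomial.aeval (X i : MvPolynomial {i // i ∉ S} A) P ∈ I' := by
    intro i
    obtain ⟨P₀, hP₀, hP₀I⟩ := halg i
    obtain ⟨P, hP, hPN, hPI⟩ := exists_bounded_annihilator G hd hn' f' hf' (X i)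
      ((isBounded_X i).mono hd (Nat.zero_le _)) P₀ hP₀ hP₀I
    exact ⟨P, hP, by rw [hN₁, hD₁]; exact hPN.1, hPI⟩
  -- an irreducible relation for the generic linear combination of the variables outside `S`
  obtain ⟨π, hπ, hπN, hπ0⟩ : ∃ π : MvPolynomial (Option {i // i ∉ S}) A, Irreducible π ∧
      π.totalDegree ≤ 3 * N₁ ∧ genericEval (fun i => Ideal.Quotient.mk I' (X i)) π = 0 := by
    obtain ⟨h, hh0, hhb, hhI⟩ := exists_bounded_generic G hd hn' f' hf' halg
    rw [← hD₁, ← hN₁] at hhb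
    have hw := totalDegree_sumAlgEquiv_symm_le hhb
    refine exists_irreducible_generic I' hI'top (fun g h hg hh hgh => ?_)
      ((sumAlgEquiv K (Option {i // i ∉ S}) {i // i ∈ S}).symm h) (by simpa using hh0)
      (by omega) (by rw [AlgEquiv.apply_symm_apply]; exact hhI)
    obtain ⟨g, rfl⟩ := E.surjective g
    obtain ⟨h, rfl⟩ := E.surjective h
    have hg' := totalDegree_splitEquiv_symm_le K S hg
    have hh' := totalDegree_splitEquiv_symm_le K S hh
    rw [AlgEquiv.symm_apply_apply] at hg' hh'
    rw [← map_mul, hspan] at hgh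
    rw [hspan, hspan]
    exact hprime g h (by omega) (by omega) hgh
  obtain ⟨p, hp⟩ := ExpChar.exists K
  have : ExpChar A p := expChar_of_injective_ringHom (C_injective _ K) p
  have : Nontrivial (MvPolynomial {i // i ∉ S} A ⧸ I') := Ideal.Quotient.nontrivial_iff.2 hI'top
  have htfQ : ∀ (a : A) (x : MvPolynomial {i // i ∉ S} A ⧸ I'), a ≠ 0 →
      algebraMap A _ a * x = 0 → x = 0 := by
    intro a x ha hx
    obtain ⟨x, rfl⟩ := Ideal.Quotient.mk_surjective x
    have h1 : algebraMap A (MvPolynomial {i // i ∉ S} A ⧸ I') a = Ideal.Quotient.mk I' (C a) := rfl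
    rw [h1, ← map_mul, Ideal.Quotient.eq_zero_iff_mem] at hx
    exact Ideal.Quotient.eq_zero_iff_mem.2 (htf a x ha hx)
  obtain ⟨e, ρ, he, hρ, hρ0, hρsep⟩ := exists_separable_generic p htfQ _ π hπ hπ0
  have hq : p ^ e ≤ 3 * N₁ := he.trans hπN
  -- `p ^ e`-th roots of zero in the quotient are zero
  have hred : ∀ h, h ^ p ^ e ∈ I' → h ∈ I' := by
    refine mem_of_pow_mem (δ := δ) (N := N₁) hd (by omega) ?_ hn' f' hf' htf halg' ?_
    · rw [hδ]
      exact (Nat.mul_le_mul_right _ hq).trans (Nat.le_add_right _ _)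
    · intro h hb hmem
      obtain ⟨h, rfl⟩ := E.surjective h
      have hb' := totalDegree_splitEquiv_symm_le K S hb
      rw [AlgEquiv.symm_apply_apply] at hb'
      rw [← map_pow] at hmem
      exact (hspan h).2 (hprime.mem_of_pow_mem hI hb'
        ((Nat.mul_le_mul_right _ hq).trans hN'') ((hspan _).1 hmem))
  refine Ideal.isPrime_iff.2 ⟨hI, fun {a b} hab => ?_⟩
  rw [← hspan, map_mul] at hab
  rw [← hspan a, ← hspan b]
  generalize E a = a at hab ⊢
  generalize E b = b at hab ⊢
  by_cases ha : a ∈ I'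
  · exact Or.inl ha
  · right
    rcases eq_zero_or_regular_of_separable _ htfQ hρ hρ0 hρsep (map (iterateFrobenius A p e) a) with
      h0 | hreg
    · rw [← mk_pow_eq_aeval, Ideal.Quotient.eq_zero_iff_mem] at h0
      exact absurd (hred a h0) ha
    · rw [← Ideal.Quotient.eq_zero_iff_mem]
      apply hreg
      rw [← mk_pow_eq_aeval, ← map_mul, Ideal.Quotient.eq_zero_iff_mem]
      obtain ⟨k, hk⟩ := Nat.exists_eq_succ_of_ne_zero (expChar_pow_pos K p e).ne'
      rw [hk, pow_succ, mul_assoc]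
      exact Ideal.mul_mem_left _ _ hab


/-! ### The size of the bounds, and the cases of few variables -/

theorem le_primeBound (n d : ℕ) : d ≤ primeBound n d := by
  match n with
  | 0 => exact le_rfl
  | 1 => exact le_rfl
  | n + 2 =>
    rw [primeBound]
    refine le_trans ?_ (le_max_right _ _)
    rw [extBound]
    omega

theorem succ_le_choose {k m : ℕ} (hk : 0 < k) : m + 1 ≤ (m + k).choose k := by
  calc m + 1 = (m + 1).choose 1 := (Nat.choose_one_right _).symm
    _ = (m + 1).choose m := (Nat.choose_symm_add (a := m) (b := 1)).symm
    _ ≤ (m + k).choose m := Nat.choose_le_choose m (by omega)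
    _ = (m + k).choose k := Nat.choose_symm_add

/-- A lower bound for `𝔭_n(d)`, from `ζ₁ ≥ 4 (x + 1)` and `ζ₂ ≥ 2 ^ (2 ^ ζ₁ - 1)`. -/
theorem two_pow_two_pow_le_primeBound {n d : ℕ} (hd : 0 < d) :
    2 ^ 2 ^ (4 * ((2 * d) ^ 2 ^ (n + 1)) + 4) ≤ primeBound (n + 2) d := by
  set x := (2 * d) ^ 2 ^ (n + 1) with hx
  set b := primeBound (n + 1) d with hb
  have hζ₀ : x + 1 ≤ zeta0 (n + 1) b := by
    rw [zeta0, flatBound, add_comm (n + 1)]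
    refine le_trans ?_ (succ_le_choose (Nat.succ_pos n))
    exact Nat.succ_le_succ (Nat.pow_le_pow_left (Nat.mul_le_mul_left 2 (le_primeBound _ d)) _)
  have hζ₁ : 4 * x + 4 ≤ zeta1 (n + 1) b d := by
    have h1 := succ_le_choose (m := d) (k := n + 1) (by omega)
    calc 4 * x + 4 = 4 * (x + 1) := by ring
      _ ≤ _ := Nat.mul_le_mul (by omega) hζ₀
  set z := zeta1 (n + 1) b d with hz
  have hζ₂ : 2 ^ (2 ^ z - 1) ≤ zeta2 (n + 1) b d := Nat.pow_le_pow_left (by omega) _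
  rw [primeBound]
  refine le_trans ?_ (le_max_left _ _)
  refine le_trans ?_ (Nat.le_mul_of_pos_left _ (Nat.mul_pos two_pos (Nat.choose_pos (by omega))))
  calc 2 ^ 2 ^ (4 * x + 4) ≤ 2 ^ 2 ^ z :=
        Nat.pow_le_pow_right two_pos (Nat.pow_le_pow_right two_pos hζ₁)
    _ = 2 * 2 ^ (2 ^ z - 1) := by
        rw [← pow_succ', Nat.sub_add_cancel Nat.one_le_two_pow]
    _ ≤ z * zeta2 (n + 1) b d := Nat.mul_le_mul (by omega) hζ₂

/-- The degrees that occur in `isPrime_of_isPrimeUpTo` are at most `2 ^ (10 * x ^ 4)`, which is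
below the lower bound for `𝔭_n(d)`. -/
theorem bounds_le {n d x D₁ N₁ δ N : ℕ} (hx : 4 ≤ x) (hn : 2 ^ n ≤ x) (hdx : d ≤ x)
    (hD₁ : D₁ ≤ x ^ 4) (hN₁ : N₁ = (D₁ + d + 1) ^ n * d) (hδ : δ = 3 * N₁ * (n * N₁) + d)
    (hN : 2 ^ 2 ^ (4 * x + 4) ≤ N) :
    d + N₁ + (d + D₁) ≤ N ∧ 3 * N₁ + 3 * N₁ ≤ N ∧ 3 * N₁ *
      ((n * N₁ + 1) ^ n * (((3 * δ) ^ 2 ^ n + d + 1) ^ n * d) + n * N₁) ≤ N := by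
  have hnx : n ≤ x := Nat.lt_two_pow_self.le.trans hn
  have hx2 : x ^ 2 ≤ 2 ^ x := by
    clear * - hx
    induction x, hx using Nat.le_induction with
    | base => norm_num
    | succ k hk ih => rw [pow_succ 2 k]; nlinarith
  have hxx : x ≤ 2 ^ x := Nat.lt_two_pow_self.le
  have hx4 : x ^ 4 ≤ 2 ^ (2 * x) := by
    calc x ^ 4 = (x ^ 2) ^ 2 := by ring
      _ ≤ (2 ^ x) ^ 2 := Nat.pow_le_pow_left hx2 2
      _ = _ := by rw [← pow_mul, mul_comm]
  -- a bound by a power of two is raised to the power `n ≤ x` or `2 ^ n ≤ x`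
  have hpow : ∀ {a k m : ℕ}, a ≤ 2 ^ k → m ≤ x → a ^ m ≤ 2 ^ (k * x) := fun {a k m} ha hm => by
    rw [pow_mul]
    exact (Nat.pow_le_pow_left ha m).trans (Nat.pow_le_pow_right Nat.one_le_two_pow hm)
  have hmul : ∀ {a b k l : ℕ}, a ≤ 2 ^ k → b ≤ 2 ^ l → a * b ≤ 2 ^ (k + l) := fun ha hb => by
    rw [pow_add]; exact Nat.mul_le_mul ha hb
  have hmono : ∀ {a k l : ℕ}, a ≤ 2 ^ k → k ≤ l → a ≤ 2 ^ l := fun ha h =>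
    ha.trans (Nat.pow_le_pow_right two_pos h)
  have hadd : ∀ {a b k : ℕ}, a ≤ 2 ^ k → b ≤ 2 ^ k → a + b ≤ 2 ^ (k + 1) := fun ha hb => by
    rw [pow_succ]; omega
  have hd1 : d + 1 ≤ 2 ^ (2 * x) := by
    have h1 : 2 ^ (x + 1) ≤ 2 ^ (2 * x) := Nat.pow_le_pow_right two_pos (by omega)
    rw [pow_succ] at h1
    omega
  have hdx' : d ≤ 2 ^ x := hdx.trans hxx
  have hn' : n ≤ 2 ^ x := hnx.trans hxx
  have e1 : 2 * x ≤ x ^ 2 := by nlinarith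
  have e2 : 4 * x ^ 2 ≤ x ^ 3 := by rw [pow_succ x 2]; nlinarith
  have e3 : 4 * x ^ 3 ≤ x ^ 4 := by rw [pow_succ x 3]; nlinarith
  have hN₁' : N₁ ≤ 2 ^ (3 * x ^ 2) := by
    have h1 : D₁ + d + 1 ≤ 2 ^ (2 * x + 1) := by
      rw [add_assoc]; exact hadd (hD₁.trans hx4) hd1
    rw [hN₁]
    exact hmono (hmul (hpow h1 hnx) hdx') (by nlinarith)
  have h3N₁ : 3 * N₁ ≤ 2 ^ (2 + 3 * x ^ 2) := hmul (by norm_num) hN₁'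
  have hnN₁ : n * N₁ ≤ 2 ^ (x + 3 * x ^ 2) := hmul hn' hN₁'
  have hδ' : δ ≤ 2 ^ (7 * x ^ 2) := by
    rw [hδ]
    exact hmono (hadd (hmul h3N₁ hnN₁) (hmono hdx' (by omega))) (by omega)
  have hE : ((3 * δ) ^ 2 ^ n + d + 1) ^ n * d ≤ 2 ^ (8 * x ^ 4) := by
    have h1 : (3 * δ) ^ 2 ^ n ≤ 2 ^ ((2 + 7 * x ^ 2) * x) := hpow (hmul (by norm_num) hδ') hn
    have h2 : (3 * δ) ^ 2 ^ n + d + 1 ≤ 2 ^ ((2 + 7 * x ^ 2) * x + 1) := by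
      rw [add_assoc]; exact hadd h1 (hmono hd1 (by nlinarith))
    refine hmono (hmul (hpow h2 hnx) hdx') ?_
    have : ((2 + 7 * x ^ 2) * x + 1) * x + x = 7 * x ^ 4 + 2 * x ^ 2 + 2 * x := by ring
    omega
  have hn1 : (n * N₁ + 1) ^ n ≤ 2 ^ (x ^ 4) := by
    have h1 : n * N₁ + 1 ≤ 2 ^ (x + 3 * x ^ 2 + 1) := hadd hnN₁ Nat.one_le_two_pow
    refine hmono (hpow h1 hnx) ?_
    have : (x + 3 * x ^ 2 + 1) * x = 3 * x ^ 3 + x ^ 2 + x := by ring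
    omega
  have hexp : 10 * x ^ 4 ≤ 2 ^ (4 * x + 4) := by
    calc 10 * x ^ 4 ≤ 2 ^ (4 + 2 * x) := hmul (by norm_num) hx4
      _ ≤ _ := Nat.pow_le_pow_right two_pos (by omega)
  have hfin : ∀ {a k : ℕ}, a ≤ 2 ^ k → k ≤ 10 * x ^ 4 → a ≤ N := fun ha hk =>
    (hmono ha (hk.trans hexp)).trans hN
  refine ⟨?_, ?_, ?_⟩
  · exact hfin (hadd (hadd (hmono hdx' (by omega)) hN₁') (hadd (k := 3 * x ^ 2)
      (hmono hdx' (by omega)) (hmono (hD₁.trans hx4) (by omega)))) (by omega)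
  · exact hfin (hadd h3N₁ h3N₁) (by omega)
  · exact hfin (hmul h3N₁ (hadd (hmul hn1 hE) (hmono hnN₁ (by omega)))) (by omega)

theorem span_isPrime_of_forall_mem_eq_C {K σ : Type*} [Field K] {Λ : Set (MvPolynomial σ K)}
    (hΛ : ∀ p ∈ Λ, ∃ c, p = C c) (h1 : (1 : MvPolynomial σ K) ∉ Ideal.span Λ) :
    (Ideal.span Λ).IsPrime := by
  have : Ideal.span Λ = ⊥ := by
    rw [Ideal.span_eq_bot]
    intro p hp
    obtain ⟨c, rfl⟩ := hΛ p hp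
    by_contra h0
    have hc : c ≠ 0 := fun h => h0 (by rw [h, map_zero])
    refine h1 ((Ideal.eq_top_iff_one _).1 ?_)
    exact Ideal.eq_top_of_isUnit_mem _ (Ideal.subset_span hp) ((isUnit_iff_ne_zero.2 hc).map C)
  rw [this]
  exact Ideal.isPrime_bot

/-- In one variable the generator of the ideal has degree at most `d`, and primality up to `d` makes
it irreducible. -/
theorem span_isPrime_of_unique {K σ : Type*} [Field K] [Unique σ] {d : ℕ}
    {Λ : Set (MvPolynomial σ K)} (hdeg : ∀ p ∈ Λ, p.totalDegree ≤ d)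
    (h1 : (1 : MvPolynomial σ K) ∉ Ideal.span Λ) (hprime : IsPrimeUpTo (Ideal.span Λ) d) :
    (Ideal.span Λ).IsPrime := by
  have : IsPrincipalIdealRing (MvPolynomial σ K) :=
    IsPrincipalIdealRing.of_surjective (uniqueAlgEquiv K σ).symm.toRingEquiv
      (uniqueAlgEquiv K σ).symm.surjective
  obtain ⟨g, hg⟩ := (IsPrincipalIdealRing.principal (Ideal.span Λ)).principal
  rw [Ideal.submodule_span_eq] at hg
  by_cases hg0 : g = 0
  · rw [hg, hg0, Ideal.span_singleton_eq_bot.2 rfl]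
    exact Ideal.isPrime_bot
  have hgd : g.totalDegree ≤ d := by
    obtain ⟨p, hp, hp0⟩ : ∃ p ∈ Λ, p ≠ 0 := by
      by_contra! h
      have h2 := hg
      rw [Ideal.span_eq_bot.2 h, eq_comm, Ideal.span_singleton_eq_bot] at h2
      exact hg0 h2
    obtain ⟨w, hw⟩ := Ideal.mem_span_singleton.1 (hg ▸ Ideal.subset_span hp)
    have h2 := hdeg p hp
    rw [hw] at hp0 h2
    rw [totalDegree_mul_of_isDomain hg0 (right_ne_zero_of_mul hp0)] at h2
    omega
  have hirr : Irreducible g := by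
    refine ⟨fun hu => h1 ?_, fun a b hab => ?_⟩
    · rw [hg, Ideal.span_singleton_eq_top.2 hu]; exact Submodule.mem_top
    · have hab0 := hab ▸ hg0
      have hdab := hgd
      rw [hab, totalDegree_mul_of_isDomain (left_ne_zero_of_mul hab0)
        (right_ne_zero_of_mul hab0)] at hdab
      have hmem : a * b ∈ Ideal.span Λ := by
        rw [hg, ← hab]; exact Ideal.mem_span_singleton_self g
      rcases hprime a b (by omega) (by omega) hmem with h | h
      · rw [hg, Ideal.mem_span_singleton] at h
        obtain ⟨c, hc⟩ := h
        refine Or.inr (IsUnit.of_mul_eq_one c (mul_left_cancel₀ hg0 ?_))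
        rw [mul_one]
        nth_rewrite 2 [hab]
        rw [hc]; ring
      · rw [hg, Ideal.mem_span_singleton] at h
        obtain ⟨c, hc⟩ := h
        refine Or.inl (IsUnit.of_mul_eq_one c (mul_left_cancel₀ hg0 ?_))
        rw [mul_one]
        nth_rewrite 2 [hab]
        rw [hc]; ring
  rw [hg]
  exact (Ideal.span_singleton_prime hg0).2 hirr.prime

theorem span_isPrime_of_two_le {K : Type*} [Field K] {n d : ℕ} (hd : 0 < d)
    {Λ : Set (MvPolynomial (Fin (n + 2)) K)} (hdeg : ∀ p ∈ Λ, p.totalDegree ≤ d)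
    (h1 : 1 ∉ Ideal.span Λ) (hprime : IsPrimeUpTo (Ideal.span Λ) (primeBound (n + 2) d)) :
    (Ideal.span Λ).IsPrime := by
  classical
  obtain ⟨s, hs, hspan⟩ := Submodule.fg_span_iff_fg_span_finset_subset Λ |>.1
    ((isNoetherianRing_iff_ideal_fg _).1 inferInstance (Ideal.span Λ))
  let f : Fin s.card → MvPolynomial (Fin (n + 2)) K := fun i => s.equivFin.symm i
  have hf : Ideal.span Λ = Ideal.span (Set.range f) := by
    have : Set.range f = s := by
      ext p
      constructor
      · rintro ⟨i, rfl⟩; exact (s.equivFin.symm i).2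
      · intro hp; exact ⟨s.equivFin ⟨p, hp⟩, by simp [f]⟩
    rw [this]; exact hspan
  set x := (2 * d) ^ 2 ^ (n + 1) with hx
  have h2x : 2 ^ 2 ^ (n + 1) ≤ x := Nat.pow_le_pow_left (by omega) _
  have hpow : n + 2 ≤ 2 ^ (n + 1) := Nat.lt_two_pow_self
  have hnx : 2 ^ (n + 2) ≤ x := (Nat.pow_le_pow_right two_pos hpow).trans h2x
  have hx4 : 4 ≤ x := by
    refine le_trans ?_ hnx
    exact Nat.pow_le_pow_right (n := 2) two_pos (show 2 ≤ n + 2 by omega)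
  have hdx : d ≤ x := by
    calc d ≤ (2 * d) ^ 1 := by rw [pow_one]; omega
      _ ≤ x := Nat.pow_le_pow_right (by omega) Nat.one_le_two_pow
  have hD₁ : (3 * d) ^ 2 ^ (n + 2) ≤ x ^ 4 := by
    calc (3 * d) ^ 2 ^ (n + 2) ≤ ((2 * d) ^ 2) ^ 2 ^ (n + 2) :=
          Nat.pow_le_pow_left (by nlinarith) _
      _ = x ^ 4 := by rw [hx, ← pow_mul, ← pow_mul]; congr 1; ring
  obtain ⟨b1, b2, b3⟩ := bounds_le hx4 hnx hdx hD₁ rfl rfl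
    (two_pow_two_pow_le_primeBound (n := n) hd)
  rw [hf] at hprime h1 ⊢
  exact isPrime_of_isPrimeUpTo hd (by simp) f (fun j => hdeg _ (hs (s.equivFin.symm j).2))
    ((Ideal.ne_top_iff_one _).2 h1) hprime rfl rfl rfl b1 b2 b3


end PrimalityBound

theorem mainTheorem1 {K : Type*} [Field K] (n d : ℕ) (Λ : Set (MvPolynomial (Fin n) K))
    (hdeg : ∀ p ∈ Λ, p.totalDegree ≤ d)
    (hproper : (1 : MvPolynomial (Fin n) K) ∉ Ideal.span Λ)
    (hprime : PrimalityBound.IsPrimeUpTo (Ideal.span Λ) (PrimalityBound.primeBound n d)) :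
    (Ideal.span Λ).IsPrime := by
  rcases Nat.eq_zero_or_pos d with rfl | hd
  · exact PrimalityBound.span_isPrime_of_forall_mem_eq_C (fun p hp =>
      ⟨_, MvPolynomial.totalDegree_eq_zero_iff_eq_C.1 (Nat.le_zero.1 (hdeg p hp))⟩) hproper
  match n with
  | 0 =>
    exact PrimalityBound.span_isPrime_of_forall_mem_eq_C (fun p _ =>
      ⟨_, MvPolynomial.eq_C_of_isEmpty p⟩) hproper
  | 1 => exact PrimalityBound.span_isPrime_of_unique hdeg hproper hprime
  | n + 2 => exact PrimalityBound.span_isPrime_of_two_le hd hdeg hproper hprime
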